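/- **State preparation.** Let $n,b\ge 1$, $N=2^n$, and label the rows and columns of $N\times N$ matrices by the $n$-bit strings. For a nonzero Hermitian $H\in\mathbb{C}^{N\times N}$ put $\sigma_j=\sum_k|H_{jk}|$, $\|H\|_1=\max_j\sigma_j$ and $\Lambda=\max\{\|H\|_1,\|H\|\}$, where $\|\cdot\|$ is the spectral norm. For $z=re^{i\varphi}$ with $r\ge0$, $-\pi<\varphi\le\pi$ write $\sqrt{z}=\sqrt r\,e^{i\varphi/2}$ and $\sqrt{z^*}=\sqrt r\,e^{-i\varphi/2}$ (so for a negative real $z$ the symbol $\sqrt{z^*}$ means $\sqrt r\,e^{-i\pi/2}$). *Data structure.* For each row $j$ there is a complete binary tree $D_j$ of height $n$. Its leaf $k$ stores $\bigl(H_{jk}^*,(\Lambda-\sigma_j)/N\bigr)$. A parent of two leaves storing $(a,t)$, $(a',t)$ stores $(|a|+|a'|,2t)$, and every inner node above stores the componentwise sum of the pairs stored by its two children. Each real number in the trees (real and imaginary parts separately) is held in memory in floating point with $b$ bits of precision: a sign bit, the $b$ leading binary digits, and $n+b+3$ bits of exponent (numbers whose exponent is too small are held as $0$). The entries of $H$ are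 assumed to be within range: the real and imaginary part of each entry is $0$ or has absolute value in $[2^{-2^{n+b}},2^{2^{n+b}})$. The memory is a register of qubits in the computational basis state $|M_H\rangle$ given by these bits. *Circuits.* A circuit acts on the $n$-qubit row register, the $n$-qubit column register, a flag qubit, the memory and any number of ancilla qubits initially in the state $|0\rangle$. It is a sequence of time steps, each consisting of arbitrary 1- and 2-qubit unitary gates on pairwise disjoint sets of qubits; its depth is the number of time steps. Thus reading the memory is included in the depth. Then the following holds. 1. There is an absolute constant $C$ such that for all $n,b\ge1$ there is a circuit $U$, depending only on $n$ and $b$, of depth at most $C\,n\,b^{5/2}$, which for every such $H$ performs the mapping $$|j\rangle|0^n\rangle|0\rangle\;\mapsto\;\frac1{\sqrt\Lambda}\,|j\rangle\sum_{k}|k\rangle\Bigl(\sqrt{H_{jk}^*}\,|0\rangle+\sqrt{\tfrac{\Lambda-\sigma_j}{N}}\,|1\rangle\Bigr)\qquad\text{for all } j$$ up to the error of $b$-bit arithmetic, with the memory and the ancillas returned to $|M_H\rangle$ and $|0\rangle$: for all $\alpha\in\mathbb{C}^N$, the image under $U$ of the superposition with coefficients $\alpha_j$ of the left-hand sides (with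 $|M_H\rangle$ and the ancillas attached) differs from the superposition with coefficients $\alpha_j$ of the right-hand sides (with the same attached) by a vector of Euclidean norm at most $C\,n\,2^{-b}\|\alpha\|_2$. 2. The square roots satisfy $(\sqrt z)^2=z$, $(\sqrt{z^*})^2=z^*$ and $\sqrt{z}\,\bigl(\sqrt{z^*}\bigr)^*=z$ for all $z\in\mathbb{C}$; in particular $\sqrt{H_{jk}}\bigl(\sqrt{H_{jk}^*}\bigr)^*=H_{jk}$. 3. If $b=O(\log N)$, the memory holding the data structure of all $N^2$ entries consists of $O(N^2\log^2N)$ bits: for every $c$ there is a constant $C'$ such that for all $n,b\ge1$ with $b\le c\,n$ the number of bits is at most $C'N^2n^2$. -/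

import Mathlib

noncomputable section

namespace StatePrep

/-! ## Quantum circuits of one- and two-qubit gates, with their depth -/

/-- Pure states of a register whose qubits are labelled by `Q`. -/
abbrev QState (Q : Type) [Fintype Q] [DecidableEq Q] : Type :=
  EuclideanSpace ℂ (Q → Bool)

/-- The computational basis state of the register in which qubit `q` has the value `x q`. -/
def ket {Q : Type} [Fintype Q] [DecidableEq Q] (x : Q → Bool) : QState Q :=
  EuclideanSpace.single x (1 : ℂ)

/-- An arbitrary unitary acting on one qubit, or on two distinct qubits. -/
inductive Gate (Q : Type) : Type
  | one (q : Q) (U : Matrix.unitaryGroup Bool ℂ) : Gate Q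
  | two (p q : Q) (hpq : p ≠ q) (U : Matrix.unitaryGroup (Bool × Bool) ℂ) : Gate Q

/-- The set of qubits on which a gate acts. -/
def Gate.support {Q : Type} : Gate Q → Set Q
  | .one q _ => {q}
  | .two p q _ _ => {p, q}

/-- The action of a gate on a state: the gate tensored with the identity on the other qubits. -/
def Gate.apply {Q : Type} [Fintype Q] [DecidableEq Q] : Gate Q → QState Q → QState Q
  | .one q U, ψ =>
      WithLp.toLp 2 fun x => ∑ s : Bool, U.1 (x q) s * ψ (Function.update x q s)
  | .two p q _ U, ψ =>
      WithLp.toLp 2 fun x => ∑ s : Bool × Bool,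
        U.1 (x p, x q) s * ψ (Function.update (Function.update x p s.1) q s.2)

/-- A time step: gates on pairwise disjoint sets of qubits, executed in parallel. -/
structure Layer (Q : Type) : Type where
  gates : List (Gate Q)
  disjoint : gates.Pairwise fun g h => Disjoint g.support h.support

/-- A circuit is a sequence of time steps, the first one being executed first. -/
abbrev Circuit (Q : Type) : Type := List (Layer Q)

/-- The depth of a circuit is the number of its time steps. -/
def Circuit.depth {Q : Type} (c : Circuit Q) : ℕ := List.length c

/-- The state that a circuit produces from a given state. -/
def Circuit.run {Q : Type} [Fintype Q] [DecidableEq Q] (c : Circuit Q) (ψ : QState Q) :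
    QState Q :=
  List.foldl (fun φ L => L.gates.foldl (fun χ g => g.apply χ) φ) ψ c

/-! ## The quantities attached to a Hermitian matrix

The `N = 2 ^ n` rows and columns are labelled by the `n`-bit strings, most significant bit
first. -/

/-- Bit strings of length `n`. -/
abbrev BitStr (n : ℕ) : Type := Fin n → Bool

/-- `N × N` complex matrices, `N = 2 ^ n`. -/
abbrev Mat (n : ℕ) : Type := Matrix (BitStr n) (BitStr n) ℂ

/-- The absolute row sum `σ_j = ∑_k |H_jk|`. -/
def rowSum {n : ℕ} (H : Mat n) (j : BitStr n) : ℝ := ∑ k, ‖H j k‖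

/-- The norm `‖H‖₁ = max_j ∑_k |H_jk|`. -/
def oneNorm {n : ℕ} (H : Mat n) : ℝ := ⨆ j, rowSum H j

/-- The spectral norm. -/
def specNorm {n : ℕ} (H : Mat n) : ℝ := ‖Matrix.toEuclideanCLM (𝕜 := ℂ) H‖

/-- `Λ = max {‖H‖₁, ‖H‖}`. -/
def Lam {n : ℕ} (H : Mat n) : ℝ := max (oneNorm H) (specNorm H)

/-- For `z = r e^{iφ}` with `r ≥ 0` and `-π < φ ≤ π`, the square root `√z = √r e^{iφ/2}`. -/
def root (z : ℂ) : ℂ := (√‖z‖ : ℂ) * Complex.exp ((z.arg / 2 : ℝ) * Complex.I)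

/-- For `z = r e^{iφ}` with `r ≥ 0` and `-π < φ ≤ π`, the square root `√(z^*) = √r e^{-iφ/2}`
of the conjugate of `z` (so that a negative real `z` gives `√r e^{-iπ/2}`). -/
def rootConj (z : ℂ) : ℂ := (√‖z‖ : ℂ) * Complex.exp ((-(z.arg / 2) : ℝ) * Complex.I)

/-! ## The data structure: one binary tree for each row -/

/-- Complete binary trees of height `d`. A leaf stores a complex and a real number, an inner
node stores two real numbers. -/
inductive RowTree : ℕ → Type
  | leaf (a : ℂ) (t : ℝ) : RowTree 0
  | node {d : ℕ} (t₀ t₁ : ℝ) (left right : RowTree d) : RowTree (d + 1)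

/-- What a vertex contributes to its parent: a leaf `(a, t)` contributes `(|a|, t)`, an inner
node contributes the pair that it stores. -/
def RowTree.weight : {d : ℕ} → RowTree d → ℝ × ℝ
  | _, .leaf a t => (‖a‖, t)
  | _, .node t₀ t₁ _ _ => (t₀, t₁)

/-- The tree with leaves `f k`, in which each inner node stores the sum of the contributions of
its two children. -/
def RowTree.build : (d : ℕ) → (BitStr d → ℂ × ℝ) → RowTree d
  | 0, f => .leaf (f Fin.elim0).1 (f Fin.elim0).2
  | d + 1, f =>
      let l := RowTree.build d fun y => f (Fin.cons false y)
      let r := RowTree.build d fun y => f (Fin.cons true y)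
      .node (l.weight.1 + r.weight.1) (l.weight.2 + r.weight.2) l r

/-- The tree `D_j`, whose leaf `k` stores `(H_jk^*, (Λ - σ_j) / N)`. -/
def rowTree {n : ℕ} (H : Mat n) (j : BitStr n) : RowTree n :=
  RowTree.build n fun k => (star (H j k), (Lam H - rowSum H j) / 2 ^ n)

/-- The places for real numbers in a tree of height `d`: three in a leaf (real and imaginary
part of the complex number, and the real number), two in each inner node. -/
def Cell : ℕ → Type
  | 0 => Fin 3
  | d + 1 => Fin 2 ⊕ (Cell d ⊕ Cell d)

instance instFintypeCell : (d : ℕ) → Fintype (Cell d)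
  | 0 => inferInstanceAs (Fintype (Fin 3))
  | d + 1 =>
      letI := instFintypeCell d
      inferInstanceAs (Fintype (Fin 2 ⊕ (Cell d ⊕ Cell d)))

instance instDecidableEqCell : (d : ℕ) → DecidableEq (Cell d)
  | 0 => inferInstanceAs (DecidableEq (Fin 3))
  | d + 1 =>
      letI := instDecidableEqCell d
      inferInstanceAs (DecidableEq (Fin 2 ⊕ (Cell d ⊕ Cell d)))

/-- The real number at a given place of a tree. -/
def RowTree.entry : {d : ℕ} → RowTree d → Cell d → ℝ
  | _, .leaf a t => fun i : Fin 3 => ![a.re, a.im, t] i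
  | _, .node t₀ t₁ l r => Sum.elim (fun i : Fin 2 => ![t₀, t₁] i) (Sum.elim l.entry r.entry)

/-! ## The memory: every real number of the data structure with `b` bits of precision -/

/-- The bits of the word that holds a real number in floating point with `b` bits of precision:
a sign bit, `b` bits of mantissa, and `n + b + 3` bits of exponent. -/
abbrev WordBit (n b : ℕ) : Type := Unit ⊕ (Fin b ⊕ Fin (n + b + 3))

/-- The word holding `x`. With `2 ^ e ≤ |x| < 2 ^ (e + 1)`, it holds the sign of `x`, the `b`
leading binary digits `m = ⌊|x| 2 ^ (b - 1 - e)⌋` of `|x|`, and the exponent `e`, shifted by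
`2 ^ (n + b + 2)`; so it stands for `± m 2 ^ (e - b + 1)`. The number `0`, and any number whose
exponent does not fit, is held as `0` (all bits zero). -/
def word (n b : ℕ) (x : ℝ) : WordBit n b → Bool :=
  let e : ℤ := Int.log 2 |x|
  if x = 0 ∨ e < -2 ^ (n + b + 2) ∨ 2 ^ (n + b + 2) ≤ e then fun _ => false
  else Sum.elim (fun _ => decide (x < 0))
    (Sum.elim (fun i => Nat.testBit ⌊|x| * (2 : ℝ) ^ ((b : ℤ) - 1 - e)⌋₊ i)
      (fun i => Nat.testBit (e + 2 ^ (n + b + 2)).toNat i))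

/-- The (qu)bits of the memory: one word for each place of each of the `N` trees. -/
abbrev MemBit (n b : ℕ) : Type := BitStr n × Cell n × WordBit n b

instance instDecidableEqMemBit (n b : ℕ) : DecidableEq (MemBit n b) :=
  letI : DecidableEq (WordBit n b) := inferInstance
  letI : DecidableEq (Cell n × WordBit n b) := inferInstance
  inferInstance

/-- The content of the memory that stores `H`. -/
def memory {n : ℕ} (b : ℕ) (H : Mat n) : MemBit n b → Bool :=
  fun m => word n b ((rowTree H m.1).entry m.2.1) m.2.2

/-- A real number is zero or has an exponent of at most `n + b` bits: no overflow or underflow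
when it is stored. -/
def InRange (n b : ℕ) (x : ℝ) : Prop :=
  x = 0 ∨ ((2 : ℝ) ^ (-(2 ^ (n + b) : ℤ)) ≤ |x| ∧ |x| < (2 : ℝ) ^ (2 ^ (n + b) : ℤ))

/-- Every entry of `H` can be stored with `b` bits of precision. -/
def Storable {n : ℕ} (b : ℕ) (H : Mat n) : Prop :=
  ∀ j k, InRange n b (H j k).re ∧ InRange n b (H j k).im

/-! ## The state preparation map -/

/-- The qubits of a quantum computer with access to the memory: row register, column register,
flag qubit, memory, and `a` ancilla qubits. -/
abbrev Wire (n b a : ℕ) : Type := Fin n ⊕ (Fin n ⊕ (Unit ⊕ (MemBit n b ⊕ Fin a)))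

/-- The state `|j⟩|k⟩|s⟩`, with the memory holding `H` and the ancillas in the state zero. -/
def regKet {n : ℕ} (b a : ℕ) (H : Mat n) (j k : BitStr n) (s : Bool) : QState (Wire n b a) :=
  ket (Sum.elim j (Sum.elim k (Sum.elim (fun _ => s) (Sum.elim (memory b H) fun _ => false))))

/-- `|j⟩|0⟩|0⟩`. -/
def inputState {n : ℕ} (b a : ℕ) (H : Mat n) (j : BitStr n) : QState (Wire n b a) :=
  regKet b a H j (fun _ => false) false

/-- `(1/√Λ) |j⟩ ∑_k |k⟩ (√(H_jk^*) |0⟩ + √((Λ - σ_j) / N) |1⟩)`. -/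
def targetState {n : ℕ} (b a : ℕ) (H : Mat n) (j : BitStr n) : QState (Wire n b a) :=
  (1 / (√(Lam H) : ℂ)) • ∑ k : BitStr n,
    (rootConj (H j k) • regKet b a H j k false
      + (√((Lam H - rowSum H j) / 2 ^ n) : ℂ) • regKet b a H j k true)

end StatePrep

end

open StatePrep

/-!
The amplitude of `|k⟩|s⟩` in the target state for the row `j` is a product along the path that leads
from the root of the tree `D_j` to the leaf `k` and on to the flag `s`, the leaf being regarded as a
node with one child for each value of the flag. The factor at a node is the square root of the
proportion in which the weight `∑ |H_jk| + ∑ (Λ - σ_j) / N` below the node is shared between its two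
children; at a leaf, the child `0` also gets the phase of `√(H_jk^*)` (`sqrt_mul_amp`).

The number of ancillas is not limited, so every node of a tree of height `n` has a qubit of its own,
which is set if and only if the node is on the path. Starting with the root, all the nodes of a level
rotate the excitation to their children at the same time, controlled by `b + 3` bits of the rotation
angle and of the phase (`exists_node`, `exists_level`, `exists_descent`); this takes depth `O(b)` for
each of the `n` levels. The bits of the angles are Boolean functions of the row register and of the
words in memory, and only six words of each row matter for one node. So they have formulas of depth
`O(n + b)`: arbitrary functions of `O(n + b)` bits, selected by the row. All these formulas are
evaluated in parallel, each on copies of its variables made by binary trees of controlled NOTs, added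
to their targets, and uncomputed (`exists_xor`). The same tool reads the leaf off from the path, then
clears the path, which is a function of the leaf, and the angles (`exists_prepare`). The total depth
is `O(n b)`.

For the error, a word determines the number held in it up to the sign-preserving relative error
`2 ^ (1 - b)`, or up to a negligible absolute error in the case of underflow (`word_eq_imp_close`,
`abs_sub_stored_le`), and no overflow occurs since `Λ` is at most the sum of all `|H_jk|`
(`Lam_lt`). The amplitudes at a node depend on the stored numbers in a stable way: the proportion of
two nonnegative weights has a small error if the weights have small relative errors, and the square
root of a phase is continuous as long as the sign of the imaginary part is kept. This gives an error
`O(2 ^ (-b))` at every node (`GoodLeaves.norm_treeVec_sub_le`). The amplitudes being products of unit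
vectors, the errors at the `n + 1` levels add up (`sum_amp_sub_sq_le`).

The identities for the square roots, and the count of the bits of the memory, are direct.
-/

set_option linter.unusedSectionVars false

namespace StatePrep

/-! ### Circuits -/

section Circuits

variable {Q : Type} [Fintype Q] [DecidableEq Q]

theorem Gate.apply_add (g : Gate Q) (φ ψ : QState Q) :
    g.apply (φ + ψ) = g.apply φ + g.apply ψ := by
  cases g <;> ext x <;> simp [Gate.apply, mul_add, Finset.sum_add_distrib]

theorem Gate.apply_smul (g : Gate Q) (a : ℂ) (ψ : QState Q) :
    g.apply (a • ψ) = a • g.apply ψ := by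
  cases g <;> ext x <;> simp [Gate.apply, Finset.mul_sum, mul_left_comm, mul_add]

/-- Gates on disjoint sets of qubits commute. -/
theorem Gate.apply_comm {g h : Gate Q} (hd : Disjoint g.support h.support) (ψ : QState Q) :
    g.apply (h.apply ψ) = h.apply (g.apply ψ) := by
  cases g <;> cases h <;> simp [Gate.support] at hd <;> ext x <;>
    simp only [Gate.apply, Finset.mul_sum] <;> rw [Finset.sum_comm] <;>
    refine Finset.sum_congr rfl fun s _ => Finset.sum_congr rfl fun t _ => ?_
  · rw [Function.update_of_ne hd, Function.update_of_ne (Ne.symm hd), Function.update_comm hd]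
    ring
  · obtain ⟨h1, h2⟩ := hd
    simp only [Function.update_of_ne (Ne.symm h1), Function.update_of_ne (Ne.symm h2),
      Function.update_of_ne h1, Function.update_of_ne h2]
    rw [Function.update_comm h1, Function.update_comm h2]
    ring
  · obtain ⟨h1, h2⟩ := hd
    simp only [Function.update_of_ne (Ne.symm h1), Function.update_of_ne (Ne.symm h2),
      Function.update_of_ne h1, Function.update_of_ne h2]
    rw [Function.update_comm (Ne.symm h2), Function.update_comm (Ne.symm h1)]
    ring
  · obtain ⟨⟨h1, h2⟩, h3, h4⟩ := hd
    simp only [Function.update_of_ne (Ne.symm h1), Function.update_of_ne (Ne.symm h2),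
      Function.update_of_ne h1, Function.update_of_ne h2, Function.update_of_ne (Ne.symm h3),
      Function.update_of_ne (Ne.symm h4), Function.update_of_ne h3, Function.update_of_ne h4]
    rw [Function.update_comm (Ne.symm h2), Function.update_comm (Ne.symm h1),
      Function.update_comm (Ne.symm h4), Function.update_comm (Ne.symm h3)]
    ring

/-- Executing a list of gates one after the other. -/
def runGates (l : List (Gate Q)) (ψ : QState Q) : QState Q :=
  l.foldl (fun χ g => g.apply χ) ψ

theorem Circuit.run_nil (ψ : QState Q) : Circuit.run ([] : Circuit Q) ψ = ψ := rfl

theorem Circuit.run_cons (L : Layer Q) (c : Circuit Q) (ψ : QState Q) :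
    Circuit.run (L :: c) ψ = Circuit.run c (runGates L.gates ψ) := rfl

theorem Circuit.run_append (c c' : Circuit Q) (ψ : QState Q) :
    Circuit.run (c ++ c') ψ = Circuit.run c' (Circuit.run c ψ) := by
  simp [Circuit.run]

theorem Circuit.depth_append (c c' : Circuit Q) :
    Circuit.depth (c ++ c') = Circuit.depth c + Circuit.depth c' := by
  simp [Circuit.depth]

theorem runGates_append (l l' : List (Gate Q)) (ψ : QState Q) :
    runGates (l ++ l') ψ = runGates l' (runGates l ψ) := by
  simp [runGates]

theorem runGates_add (l : List (Gate Q)) (φ ψ : QState Q) :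
    runGates l (φ + ψ) = runGates l φ + runGates l ψ := by
  induction l generalizing φ ψ with
  | nil => rfl
  | cons g l ih => simpa [runGates, Gate.apply_add] using ih (g.apply φ) (g.apply ψ)

theorem runGates_smul (l : List (Gate Q)) (a : ℂ) (ψ : QState Q) :
    runGates l (a • ψ) = a • runGates l ψ := by
  induction l generalizing ψ with
  | nil => rfl
  | cons g l ih => simpa [runGates, Gate.apply_smul] using ih (g.apply ψ)

theorem Circuit.run_add (c : Circuit Q) (φ ψ : QState Q) :
    c.run (φ + ψ) = c.run φ + c.run ψ := by
  induction c generalizing φ ψ with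
  | nil => rfl
  | cons L c ih => simp only [Circuit.run_cons, runGates_add, ih]

theorem Circuit.run_smul (c : Circuit Q) (a : ℂ) (ψ : QState Q) :
    c.run (a • ψ) = a • c.run ψ := by
  induction c generalizing ψ with
  | nil => rfl
  | cons L c ih => simp only [Circuit.run_cons, runGates_smul, ih]

/-- The linear map that a circuit performs. -/
def Circuit.lin (c : Circuit Q) : QState Q →ₗ[ℂ] QState Q where
  toFun := c.run
  map_add' := c.run_add
  map_smul' := c.run_smul

theorem Circuit.run_sum {ι : Type*} (c : Circuit Q) (s : Finset ι) (f : ι → QState Q) :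
    c.run (∑ i ∈ s, f i) = ∑ i ∈ s, c.run (f i) :=
  map_sum c.lin f s

/-- All gates of the circuit act on qubits in `S`. -/
def Within (S : Set Q) (c : Circuit Q) : Prop :=
  ∀ L ∈ c, ∀ g ∈ L.gates, g.support ⊆ S

theorem Within.mono {S T : Set Q} {c : Circuit Q} (h : Within S c) (hST : S ⊆ T) : Within T c :=
  fun L hL g hg => (h L hL g hg).trans hST

theorem Within.append {S : Set Q} {c c' : Circuit Q} (h : Within S c) (h' : Within S c') :
    Within S (c ++ c') := by
  intro L hL
  rcases List.mem_append.1 hL with hL | hL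
  · exact h L hL
  · exact h' L hL

theorem within_nil (S : Set Q) : Within S ([] : Circuit Q) := fun _ h => by simp at h

theorem runGates_apply_comm {S T : Set Q} (hST : Disjoint S T) {g : Gate Q} (hg : g.support ⊆ T)
    {l : List (Gate Q)} (hl : ∀ h ∈ l, h.support ⊆ S) (ψ : QState Q) :
    runGates l (g.apply ψ) = g.apply (runGates l ψ) := by
  induction l generalizing ψ with
  | nil => rfl
  | cons h l ih =>
    simp only [List.mem_cons, forall_eq_or_imp] at hl
    change runGates l (h.apply (g.apply ψ)) = g.apply (runGates l (h.apply ψ))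
    rw [Gate.apply_comm (hST.mono hl.1 hg), ih hl.2]

theorem runGates_comm {S T : Set Q} (hST : Disjoint S T)
    {l l' : List (Gate Q)} (hl : ∀ h ∈ l, h.support ⊆ S) (hl' : ∀ h ∈ l', h.support ⊆ T)
    (ψ : QState Q) :
    runGates l (runGates l' ψ) = runGates l' (runGates l ψ) := by
  induction l' generalizing ψ with
  | nil => rfl
  | cons g l' ih =>
    simp only [List.mem_cons, forall_eq_or_imp] at hl'
    change runGates l (runGates l' (g.apply ψ)) = runGates l' (g.apply (runGates l ψ))
    rw [ih hl'.2, runGates_apply_comm hST hl'.1 hl]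

theorem Circuit.run_runGates_comm {S T : Set Q} (hST : Disjoint S T)
    {c : Circuit Q} {l' : List (Gate Q)} (hc : Within S c) (hl' : ∀ h ∈ l', h.support ⊆ T)
    (ψ : QState Q) :
    c.run (runGates l' ψ) = runGates l' (c.run ψ) := by
  induction c generalizing ψ with
  | nil => rfl
  | cons L c ih =>
    have h1 : ∀ h ∈ L.gates, h.support ⊆ S := hc L (by simp)
    have h2 : Within S c := fun L' h' => hc L' (by simp [h'])
    rw [Circuit.run_cons, Circuit.run_cons, runGates_comm hST h1 hl', ih h2]

/-- Two circuits on disjoint sets of qubits can be executed simultaneously. -/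
theorem exists_par_pair {S T : Set Q} (hST : Disjoint S T) (c c' : Circuit Q)
    (hc : Within S c) (hc' : Within T c') :
    ∃ c'' : Circuit Q, c''.depth = max c.depth c'.depth ∧ Within (S ∪ T) c'' ∧
      ∀ ψ, c''.run ψ = c'.run (c.run ψ) := by
  induction c generalizing c' with
  | nil => exact ⟨c', by simp [Circuit.depth], hc'.mono Set.subset_union_right, fun _ => rfl⟩
  | cons L c ih =>
    cases c' with
    | nil => exact ⟨L :: c, by simp [Circuit.depth], hc.mono Set.subset_union_left, fun _ => rfl⟩
    | cons L' c' =>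
      have h1 : ∀ h ∈ L.gates, h.support ⊆ S := hc L (by simp)
      have h2 : Within S c := fun L' h' => hc L' (by simp [h'])
      have h1' : ∀ h ∈ L'.gates, h.support ⊆ T := hc' L' (by simp)
      have h2' : Within T c' := fun L' h' => hc' L' (by simp [h'])
      obtain ⟨c'', hd, hw, hr⟩ := ih c' h2 h2'
      refine ⟨⟨L.gates ++ L'.gates, List.pairwise_append.2 ⟨L.disjoint, L'.disjoint,
        fun g hg h hh => hST.mono (h1 g hg) (h1' h hh)⟩⟩ :: c'', ?_, ?_, ?_⟩
      · simp only [Circuit.depth, List.length_cons] at hd ⊢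
        omega
      · intro M hM
        rcases List.mem_cons.1 hM with rfl | hM
        · intro g hg
          rcases List.mem_append.1 hg with hg | hg
          · exact (h1 g hg).trans Set.subset_union_left
          · exact (h1' g hg).trans Set.subset_union_right
        · exact hw M hM
      · intro ψ
        rw [Circuit.run_cons, runGates_append, hr, Circuit.run_cons, Circuit.run_cons,
          Circuit.run_runGates_comm hST h2 h1']

/-- Circuits on pairwise disjoint sets of qubits can be executed simultaneously. -/
theorem exists_par {ι : Type*} (l : List ι) (S : ι → Set Q) (c : ι → Circuit Q) (d : ℕ)
    (hS : l.Pairwise fun i j => Disjoint (S i) (S j)) (hc : ∀ i ∈ l, Within (S i) (c i))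
    (hd : ∀ i ∈ l, (c i).depth ≤ d) :
    ∃ c' : Circuit Q, c'.depth ≤ d ∧ Within (⋃ i ∈ l, S i) c' ∧
      ∀ ψ, c'.run ψ = l.foldl (fun φ i => (c i).run φ) ψ := by
  induction l with
  | nil => exact ⟨[], by simp [Circuit.depth], within_nil _, fun _ => rfl⟩
  | cons i l ih =>
    simp only [List.pairwise_cons, List.mem_cons, forall_eq_or_imp] at hS hc hd
    obtain ⟨c₁, hd₁, hw₁, hr₁⟩ := ih hS.2 hc.2 hd.2
    have hdis : Disjoint (S i) (⋃ j ∈ l, S j) := by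
      simp only [Set.disjoint_iUnion_right]
      exact hS.1
    obtain ⟨c₂, hd₂, hw₂, hr₂⟩ := exists_par_pair hdis (c i) c₁ hc.1 hw₁
    refine ⟨c₂, ?_, hw₂.mono ?_, fun ψ => ?_⟩
    · rw [hd₂]; exact max_le hd.1 hd₁
    · simp [Set.iUnion_or, Set.iUnion_union_distrib]
    · rw [hr₂, hr₁]; rfl

/-- A single gate as a circuit. -/
def single (g : Gate Q) : Circuit Q := [⟨[g], List.pairwise_singleton _ _⟩]

theorem run_single (g : Gate Q) (ψ : QState Q) : (single g).run ψ = g.apply ψ := rfl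

theorem depth_single (g : Gate Q) : (single g).depth = 1 := rfl

theorem within_single {g : Gate Q} {S : Set Q} (h : g.support ⊆ S) : Within S (single g) := by
  intro L hL g' hg'
  simp only [single, List.mem_singleton] at hL
  subst hL
  simp only [List.mem_singleton] at hg'
  subst hg'
  exact h

/-- Matrix elements of a one-qubit gate on basis states. -/
theorem apply_one_ket (q : Q) (U : Matrix.unitaryGroup Bool ℂ) (y : Q → Bool) :
    (Gate.one q U).apply (ket y) = ∑ s : Bool, U.1 s (y q) • ket (Function.update y q s) := by
  ext x
  simp only [Gate.apply, ket, PiLp.single_apply, WithLp.ofLp_sum, Finset.sum_apply,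
    PiLp.smul_apply, smul_eq_mul, mul_ite, mul_one, mul_zero]
  by_cases h : ∀ r, r ≠ q → x r = y r
  · have h1 : ∀ s, (Function.update x q s = y) ↔ s = y q := by
      intro s; rw [Function.update_eq_iff]; exact ⟨fun h => h.1, fun h' => ⟨h', h⟩⟩
    have h2 : ∀ s, (x = Function.update y q s) ↔ x q = s := by
      intro s; rw [Function.eq_update_iff]; exact ⟨fun h => h.1, fun h' => ⟨h', h⟩⟩
    simp [h1, h2]
  · have h1 : ∀ s, ¬ (Function.update x q s = y) := by
      intro s; rw [Function.update_eq_iff]; exact fun h' => h h'.2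
    have h2 : ∀ s, ¬ (x = Function.update y q s) := by
      intro s; rw [Function.eq_update_iff]; exact fun h' => h h'.2
    simp [h1, h2]

/-- Matrix elements of a two-qubit gate on basis states. -/
theorem apply_two_ket (p q : Q) (hpq : p ≠ q) (U : Matrix.unitaryGroup (Bool × Bool) ℂ)
    (y : Q → Bool) :
    (Gate.two p q hpq U).apply (ket y) =
      ∑ s : Bool × Bool, U.1 s (y p, y q) •
        ket (Function.update (Function.update y p s.1) q s.2) := by
  ext x
  simp only [Gate.apply, ket, PiLp.single_apply, WithLp.ofLp_sum, Finset.sum_apply,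
    PiLp.smul_apply, smul_eq_mul, mul_ite, mul_one, mul_zero]
  by_cases h : ∀ r, r ≠ p → r ≠ q → x r = y r
  · have h1 : ∀ s : Bool × Bool,
        (Function.update (Function.update x p s.1) q s.2 = y) ↔ s = (y p, y q) := by
      intro s
      constructor
      · rintro rfl; ext <;> simp [Function.update_of_ne hpq]
      · rintro rfl; ext r; simp only [Function.update_apply]; grind
    have h2 : ∀ s : Bool × Bool,
        (x = Function.update (Function.update y p s.1) q s.2) ↔ (x p, x q) = s := by
      intro s
      constructor
      · rintro rfl; ext <;> simp [Function.update_of_ne hpq]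
      · rintro rfl; ext r; simp only [Function.update_apply]; grind
    simp [h1, h2]
  · have h1 : ∀ s : Bool × Bool, ¬ (Function.update (Function.update x p s.1) q s.2 = y) := by
      rintro s rfl; apply h; intro r hp hq; simp [Function.update_of_ne, hp, hq]
    have h2 : ∀ s : Bool × Bool, ¬ (x = Function.update (Function.update y p s.1) q s.2) := by
      rintro s rfl; apply h; intro r hp hq; simp [Function.update_of_ne, hp, hq]
    simp [h1, h2]

end Circuits

section Relabel

variable {Q R : Type} [Fintype Q] [DecidableEq Q] [Fintype R] [DecidableEq R]

/-- Relabelling the qubits of a gate. -/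
def Gate.relabel (e : Q ≃ R) : Gate Q → Gate R
  | .one q U => .one (e q) U
  | .two p q h U => .two (e p) (e q) (e.injective.ne h) U

/-- Relabelling the qubits of a state. -/
def relabelState (e : Q ≃ R) (ψ : QState Q) : QState R := WithLp.toLp 2 fun x => ψ (x ∘ e)

theorem Gate.support_relabel (e : Q ≃ R) (g : Gate Q) :
    (g.relabel e).support = e '' g.support := by
  cases g <;> simp [Gate.relabel, Gate.support, Set.image_pair]

theorem Gate.apply_relabel (e : Q ≃ R) (g : Gate Q) (ψ : QState Q) :
    (g.relabel e).apply (relabelState e ψ) = relabelState e (g.apply ψ) := by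
  cases g <;> ext x <;>
    simp [Gate.relabel, Gate.apply, relabelState, Function.update_comp_eq_of_injective _ e.injective]

/-- Relabelling the qubits of a circuit. -/
def Circuit.relabel (e : Q ≃ R) (c : Circuit Q) : Circuit R :=
  c.map fun L => ⟨L.gates.map (Gate.relabel e), by
    rw [List.pairwise_map]
    refine L.disjoint.imp fun h => ?_
    rw [Gate.support_relabel, Gate.support_relabel]
    exact (Set.disjoint_image_iff e.injective).2 h⟩

theorem Circuit.depth_relabel (e : Q ≃ R) (c : Circuit Q) : (c.relabel e).depth = c.depth := by
  simp [Circuit.relabel, Circuit.depth]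

theorem Circuit.run_relabel (e : Q ≃ R) (c : Circuit Q) (ψ : QState Q) :
    (c.relabel e).run (relabelState e ψ) = relabelState e (c.run ψ) := by
  induction c generalizing ψ with
  | nil => rfl
  | cons L c ih =>
    have h : ∀ (l : List (Gate Q)) (φ : QState Q),
        runGates (l.map (Gate.relabel e)) (relabelState e φ) = relabelState e (runGates l φ) := by
      intro l
      induction l with
      | nil => intro φ; rfl
      | cons g l ihl =>
        intro φ
        change runGates (l.map (Gate.relabel e)) ((g.relabel e).apply (relabelState e φ)) = _
        rw [Gate.apply_relabel, ihl]; rfl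
    change Circuit.run (Circuit.relabel e c)
      (runGates (L.gates.map (Gate.relabel e)) (relabelState e ψ)) = _
    rw [h, ih]; rfl

theorem relabelState_ket (e : Q ≃ R) (x : Q → Bool) :
    relabelState e (ket x) = ket (x ∘ e.symm) := by
  ext y
  simp only [relabelState, ket, PiLp.single_apply]
  congr 1
  rw [Equiv.eq_comp_symm]

/-- Relabelling the qubits as a linear map on states. -/
def relabelLin (e : Q ≃ R) : QState Q →ₗ[ℂ] QState R where
  toFun := relabelState e
  map_add' _ _ := rfl
  map_smul' _ _ := rfl

end Relabel

/-! ### Controlled gates -/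

section Gates

variable {Q : Type} [Fintype Q] [DecidableEq Q]

/-- A one-qubit unitary, controlled by another qubit (the first factor). -/
noncomputable def ctrlMat (V : Matrix Bool Bool ℂ) : Matrix (Bool × Bool) (Bool × Bool) ℂ :=
  fun s t => if s.1 = t.1 then (if s.1 then V s.2 t.2 else if s.2 = t.2 then 1 else 0) else 0

theorem ctrlMat_mem (V : Matrix.unitaryGroup Bool ℂ) :
    ctrlMat V.1 ∈ Matrix.unitaryGroup (Bool × Bool) ℂ := by
  have h := Matrix.mem_unitaryGroup_iff.1 V.2
  have h' : ∀ i j, ∑ k, V.1 i k * star (V.1 j k) = if i = j then 1 else 0 := by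
    intro i j
    have := congrFun (congrFun h i) j
    simpa [Matrix.mul_apply, Matrix.one_apply] using this
  rw [Matrix.mem_unitaryGroup_iff]
  ext ⟨a, b⟩ ⟨c, d⟩
  have h2 := h' b d
  simp only [Fintype.sum_bool] at h2
  cases a <;> cases c <;> cases b <;> cases d <;>
    simp_all [Matrix.mul_apply, ctrlMat, Fintype.sum_prod_type]

/-- The controlled version of a one-qubit unitary, as an element of the unitary group. -/
noncomputable def ctrl (V : Matrix.unitaryGroup Bool ℂ) : Matrix.unitaryGroup (Bool × Bool) ℂ :=
  ⟨ctrlMat V.1, ctrlMat_mem V⟩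

theorem apply_ctrl_ket (p q : Q) (hpq : p ≠ q) (V : Matrix.unitaryGroup Bool ℂ) (y : Q → Bool) :
    (Gate.two p q hpq (ctrl V)).apply (ket y) =
      if y p then ∑ s : Bool, V.1 s (y q) • ket (Function.update y q s) else ket y := by
  have hp : ∀ u, y p = u → Function.update y p u = y := by rintro _ rfl; simp
  have hq : ∀ u, y q = u → Function.update y q u = y := by rintro _ rfl; simp
  rw [apply_two_ket]
  cases h : y p <;> cases h' : y q <;>
    simp [ctrl, ctrlMat, Fintype.sum_prod_type, hp _ h, hq _ h']

/-- The NOT matrix. -/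
def notMat : Matrix Bool Bool ℂ := fun s t => if s = t then 0 else 1

/-- A square root of the NOT matrix. -/
noncomputable def sqrtNotMat : Matrix Bool Bool ℂ :=
  fun s t => if s = t then (1 + Complex.I) / 2 else (1 - Complex.I) / 2

/-- Rotation by the angle `θ` in the real plane spanned by `|0⟩` and `|1⟩`. -/
noncomputable def rotMat (θ : ℝ) : Matrix Bool Bool ℂ
  | false, false => Real.cos θ
  | false, true => -Real.sin θ
  | true, false => Real.sin θ
  | true, true => Real.cos θ

/-- The phase gate `|1⟩ ↦ e^{iφ} |1⟩`. -/
noncomputable def phaseMat (φ : ℝ) : Matrix Bool Bool ℂ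
  | false, false => 1
  | true, true => Complex.exp (φ * Complex.I)
  | _, _ => 0

theorem notMat_mem : notMat ∈ Matrix.unitaryGroup Bool ℂ := by
  rw [Matrix.mem_unitaryGroup_iff]
  ext a b
  cases a <;> cases b <;> simp [Matrix.mul_apply, notMat]

theorem sqrtNotMat_mem : sqrtNotMat ∈ Matrix.unitaryGroup Bool ℂ := by
  rw [Matrix.mem_unitaryGroup_iff]
  ext a b
  cases a <;> cases b <;>
    simp [Matrix.mul_apply, sqrtNotMat, Complex.conj_ofNat] <;> ring_nf <;> simp <;> norm_num

theorem rotMat_mem (θ : ℝ) : rotMat θ ∈ Matrix.unitaryGroup Bool ℂ := by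
  have h := Complex.sin_sq_add_cos_sq (θ : ℂ)
  rw [Matrix.mem_unitaryGroup_iff]
  ext a b
  cases a <;> cases b <;>
    simp [Matrix.mul_apply, rotMat, ← Complex.cos_conj, ← Complex.sin_conj] <;>
    first | linear_combination h | ring

theorem phaseMat_mem (φ : ℝ) : phaseMat φ ∈ Matrix.unitaryGroup Bool ℂ := by
  rw [Matrix.mem_unitaryGroup_iff]
  ext a b
  cases a <;> cases b <;> simp [Matrix.mul_apply, phaseMat, ← Complex.exp_conj, ← Complex.exp_add]

theorem sqrtNotMat_mul : sqrtNotMat * sqrtNotMat = notMat := by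
  ext a b
  cases a <;> cases b <;> simp [Matrix.mul_apply, sqrtNotMat, notMat] <;> ring_nf <;> simp <;>
    norm_num

theorem rotMat_mul (θ φ : ℝ) : rotMat θ * rotMat φ = rotMat (θ + φ) := by
  ext a b
  cases a <;> cases b <;>
    simp [Matrix.mul_apply, rotMat, Complex.cos_add, Complex.sin_add] <;> ring

/-- A doubly controlled unitary `V ^ 2` takes five two-qubit gates: with the parity of the two
controls in the second one, `V V` is applied if both are set, and `V⁻¹` undoes the single `V` that
fires if only one of them is. -/
theorem exists_ctrl_ctrl {a b t : Q} (hab : a ≠ b) (hat : a ≠ t) (hbt : b ≠ t)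
    (V : Matrix.unitaryGroup Bool ℂ) :
    ∃ c : Circuit Q, c.depth ≤ 5 ∧ Within {a, b, t} c ∧ ∀ y, c.run (ket y) =
      if y a && y b then ∑ s : Bool, (V.1 * V.1) s (y t) • ket (Function.update y t s)
      else ket y := by
  let X : Matrix.unitaryGroup Bool ℂ := ⟨notMat, notMat_mem⟩
  have hX : ∀ y : Q → Bool, (Gate.two a b hab (ctrl X)).apply (ket y) =
      ket (Function.update y b (y b ^^ y a)) := by
    intro y
    rw [apply_ctrl_ket]
    cases ha : y a <;> cases hb : y b <;> simp [X, notMat] <;> rw [← hb, Function.update_eq_self]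
  have hVV : ∀ i j, ∑ k, V.1 i k * star (V.1 j k) = if i = j then 1 else 0 := by
    intro i j
    have := congrFun (congrFun (Matrix.mem_unitaryGroup_iff.1 V.2) i) j
    simpa [Matrix.mul_apply, Matrix.one_apply] using this
  have hVV' : ∀ i j, ∑ k, star (V.1 k i) * V.1 k j = if i = j then 1 else 0 := by
    intro i j
    have := congrFun (congrFun (Matrix.mem_unitaryGroup_iff'.1 V.2) i) j
    simpa [Matrix.mul_apply, Matrix.one_apply] using this
  refine ⟨single (.two b t hbt (ctrl V)) ++ (single (.two a b hab (ctrl X)) ++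
    (single (.two b t hbt (ctrl V⁻¹)) ++ (single (.two a b hab (ctrl X)) ++
      single (.two a t hat (ctrl V))))), ?_, ?_, ?_⟩
  · simp [Circuit.depth_append, depth_single]
  · refine (within_single ?_).append ((within_single ?_).append ((within_single ?_).append
      ((within_single ?_).append (within_single ?_)))) <;> intro x <;>
      simp [Gate.support] <;> tauto
  · intro y
    let Y : Bool → Bool → Q → Bool := fun u v => Function.update (Function.update y b u) t v
    have hyY : y = Y (y b) (y t) := by
      simp only [Y, Function.update_eq_self]
    have hYa : ∀ u v, Y u v a = y a := fun u v => by simp [Y, hab, hat]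
    have hYb : ∀ u v, Y u v b = u := fun u v => by simp [Y, hbt]
    have hYt : ∀ u v, Y u v t = v := fun u v => by simp [Y]
    have hut : ∀ u v w, Function.update (Y u v) t w = Y u w := fun u v w => by simp [Y]
    have hub : ∀ u v w, Function.update (Y u v) b w = Y w v := fun u v w => by
      simp only [Y]; rw [Function.update_comm hbt.symm]; simp
    have hv : (V⁻¹).1 = star V.1 := rfl
    have h00 := hVV' false false
    have h01 := hVV' false true
    have h10 := hVV' true false
    have h11 := hVV' true true
    have g00 := hVV false false
    have g01 := hVV false true
    have g10 := hVV true false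
    have g11 := hVV true true
    simp only [Circuit.run_append, run_single]
    rw [hyY]
    generalize y b = u
    generalize y t = v
    simp only [hYa, hYb, hYt, hut]
    cases ha : y a <;> cases u <;>
      simp [apply_ctrl_ket, hX, hYa, hYb, hYt, hut, hub, Gate.apply_add, Gate.apply_smul, ha,
        hv, Matrix.mul_apply]
    · cases v <;> simp at h00 h01 h10 h11 <;> match_scalars <;>
        first | linear_combination h00 | linear_combination h01 | linear_combination h10 |
          linear_combination h11
    · cases v <;> simp at g00 g01 g10 g11 <;> match_scalars <;>
        first | linear_combination g00 | linear_combination g01 | linear_combination g10 |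
          linear_combination g11
    · module

end Gates

/-! ### Reversible evaluation of Boolean circuits -/

section Classical

variable {Q : Type} [Fintype Q] [DecidableEq Q]

/-- The bit of `q` is flipped if `b` is set. -/
def flip (q : Q) (b : Bool) (x : Q → Bool) : Q → Bool := Function.update x q (x q ^^ b)

theorem flip_false (q : Q) (x : Q → Bool) : flip q false x = x := by simp [flip]

theorem flip_of_ne {q r : Q} (h : r ≠ q) (b : Bool) (x : Q → Bool) : flip q b x r = x r := by
  simp [flip, h]

theorem flip_same (q : Q) (b : Bool) (x : Q → Bool) : flip q b x q = (x q ^^ b) := by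
  simp [flip]

theorem flip_flip (q : Q) (b b' : Bool) (x : Q → Bool) :
    flip q b' (flip q b x) = flip q (b ^^ b') x := by
  simp [flip]

theorem exists_flip (q : Q) (k : Bool) : ∃ c : Circuit Q, c.depth ≤ 1 ∧ Within {q} c ∧
    ∀ x, c.run (ket x) = ket (flip q k x) := by
  cases k
  · exact ⟨[], by simp [Circuit.depth], within_nil _, fun x => by simp [flip, Circuit.run_nil]⟩
  · refine ⟨single (.one q ⟨notMat, notMat_mem⟩), by simp [depth_single],
      within_single (by simp [Gate.support]), fun x => ?_⟩
    rw [run_single, apply_one_ket]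
    cases h : x q <;> simp [notMat, flip, h]

theorem exists_cflip {p q : Q} (hpq : p ≠ q) (k : Bool) :
    ∃ c : Circuit Q, c.depth ≤ 1 ∧ Within {p, q} c ∧
      ∀ x, c.run (ket x) = ket (flip q (k && x p) x) := by
  cases k
  · exact ⟨[], by simp [Circuit.depth], within_nil _, fun x => by simp [flip, Circuit.run_nil]⟩
  · refine ⟨single (.two p q hpq (ctrl ⟨notMat, notMat_mem⟩)), by simp [depth_single],
      within_single (by simp [Gate.support]), fun x => ?_⟩
    rw [run_single, apply_ctrl_ket]
    cases h : x q <;> cases h' : x p <;> simp [notMat, flip, h] <;> rw [← h] <;> simp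

theorem exists_ccflip {a b q : Q} (hab : a ≠ b) (ha : a ≠ q) (hb : b ≠ q) (k : Bool) :
    ∃ c : Circuit Q, c.depth ≤ 5 ∧ Within {a, b, q} c ∧
      ∀ x, c.run (ket x) = ket (flip q (k && (x a && x b)) x) := by
  cases k
  · exact ⟨[], by simp [Circuit.depth], within_nil _, fun x => by simp [flip, Circuit.run_nil]⟩
  · obtain ⟨c, hd, hw, hr⟩ := exists_ctrl_ctrl hab ha hb ⟨sqrtNotMat, sqrtNotMat_mem⟩
    refine ⟨c, hd, hw, fun x => ?_⟩
    rw [hr]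
    simp only [sqrtNotMat_mul]
    by_cases hh : (x a && x b) = true
    · cases h : x q <;> simp [notMat, flip, h, hh]
    · simp [hh, flip]

/-- Every Boolean function of two bits can be added to a third one in depth `8`: by its algebraic
normal form, it takes at most one NOT, two controlled NOTs and one Toffoli gate. -/
theorem exists_op {a b q : Q} (ha : a ≠ q) (hb : b ≠ q) (op : Bool → Bool → Bool) :
    ∃ c : Circuit Q, c.depth ≤ 8 ∧ Within {a, b, q} c ∧
      ∀ x, c.run (ket x) = ket (flip q (op (x a) (x b)) x) := by
  by_cases hab : a = b
  · subst hab
    obtain ⟨c₁, hd₁, hw₁, hr₁⟩ := exists_flip q (op false false)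
    obtain ⟨c₂, hd₂, hw₂, hr₂⟩ := exists_cflip ha (op false false ^^ op true true)
    refine ⟨c₁ ++ c₂, ?_, (hw₁.mono ?_).append (hw₂.mono ?_), fun x => ?_⟩
    · rw [Circuit.depth_append]; omega
    · intro; simp; tauto
    · intro; simp
    · rw [Circuit.run_append, hr₁, hr₂, flip_flip, flip_of_ne ha]
      congr 2
      cases x a <;> cases op false false <;> cases op true true <;> rfl
  · obtain ⟨c₁, hd₁, hw₁, hr₁⟩ := exists_flip q (op false false)
    obtain ⟨c₂, hd₂, hw₂, hr₂⟩ := exists_cflip ha (op false false ^^ op true false)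
    obtain ⟨c₃, hd₃, hw₃, hr₃⟩ := exists_cflip hb (op false false ^^ op false true)
    obtain ⟨c₄, hd₄, hw₄, hr₄⟩ := exists_ccflip hab ha hb
      ((op false false ^^ op false true) ^^ (op true false ^^ op true true))
    refine ⟨c₁ ++ (c₂ ++ (c₃ ++ c₄)), ?_,
      (hw₁.mono ?_).append ((hw₂.mono ?_).append ((hw₃.mono ?_).append hw₄)), fun x => ?_⟩
    · simp only [Circuit.depth_append]; omega
    · intro; simp; tauto
    · intro; simp; tauto
    · intro; simp; tauto
    · simp only [Circuit.run_append, hr₁, hr₂, hr₃, hr₄, flip_flip, flip_of_ne ha, flip_of_ne hb]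
      congr 2
      cases x a <;> cases x b <;> cases op false false <;> cases op true false <;>
        cases op false true <;> cases op true true <;> rfl

/-- To every bit `q ∈ A`, the Boolean function `op q` of the bits `s q` and `s' q` is added. -/
def stepMap (A : Q → Bool) (op : Q → Bool → Bool → Bool) (s s' : Q → Q) (x : Q → Bool) :
    Q → Bool :=
  fun q => x q ^^ (A q && op q (x (s q)) (x (s' q)))

/-- Boolean functions on disjoint sets of bits are added to their targets simultaneously. -/
theorem exists_stepMap (A : Q → Bool) (op : Q → Bool → Bool → Bool) (s s' : Q → Q)
    (hs : ∀ q, A q → s q ≠ q) (hs' : ∀ q, A q → s' q ≠ q)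
    (hdis : ∀ q r, A q → A r → q ≠ r → Disjoint ({s q, s' q, q} : Set Q) {s r, s' r, r}) :
    ∃ c : Circuit Q, c.depth ≤ 8 ∧ ∀ x, c.run (ket x) = ket (stepMap A op s s' x) := by
  have hex : ∀ q, ∃ c : Circuit Q, A q → c.depth ≤ 8 ∧ Within {s q, s' q, q} c ∧
      ∀ x, c.run (ket x) = ket (flip q (op q (x (s q)) (x (s' q))) x) := by
    intro q
    by_cases h : A q
    · obtain ⟨c, hc⟩ := exists_op (hs q h) (hs' q h) (op q)
      exact ⟨c, fun _ => hc⟩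
    · exact ⟨[], fun h' => absurd h' h⟩
  choose c hc using hex
  let l : List Q := (Finset.univ.filter fun q => A q = true).toList
  have hl : ∀ q ∈ l, A q = true := fun q hq => by simpa [l] using hq
  have hnd : l.Nodup := Finset.nodup_toList _
  obtain ⟨C, hd, -, hr⟩ := exists_par l (fun q => {s q, s' q, q}) c 8
    (hnd.pairwise_of_forall_ne fun q hq r hr hne => hdis q r (hl q hq) (hl r hr) hne)
    (fun q hq => (hc q (hl q hq)).2.1) (fun q hq => (hc q (hl q hq)).1)
  refine ⟨C, hd, fun x => ?_⟩
  rw [hr]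
  have key : ∀ (l' : List Q), l'.Nodup → (∀ q ∈ l', A q = true) → ∀ x : Q → Bool,
      l'.foldl (fun φ i => (c i).run φ) (ket x) =
        ket fun q => x q ^^ (decide (q ∈ l') && op q (x (s q)) (x (s' q))) := by
    intro l'
    induction l' with
    | nil => intro _ _ x; simp
    | cons r l' ih =>
      intro hnd' hA x
      simp only [List.nodup_cons, List.mem_cons, forall_eq_or_imp] at hnd' hA
      rw [List.foldl_cons, (hc r hA.1).2.2, ih hnd'.2 hA.2]
      congr 1
      ext q
      by_cases hq : q = r
      · subst hq
        simp [hnd'.1, flip_same]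
      · by_cases hql : q ∈ l'
        · have hdq := hdis q r (hA.2 q hql) hA.1 hq
          have h1 : s q ≠ r := by
            rintro h; exact Set.disjoint_left.1 hdq (show r ∈ ({s q, s' q, q} : Set Q) by simp [h]) (by simp)
          have h2 : s' q ≠ r := by
            rintro h; exact Set.disjoint_left.1 hdq (show r ∈ ({s q, s' q, q} : Set Q) by simp [h]) (by simp)
          simp [hql, flip_of_ne, hq, h1, h2]
        · simp [hql, hq, flip_of_ne]
  rw [key l hnd hl]
  congr 1
  ext q
  simp [stepMap, l]

/-- A Boolean circuit of fan-out one, evaluated level by level. A qubit `q` of positive level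
`lev q` is the value of the gate `op q` on the qubits `s q` and `s' q`, which are of smaller level;
gates of the same level share no qubits. Any assignment of bits that is consistent with the gates is
computed from its inputs (the qubits of level zero), and uncomputed by the reverse circuit. -/
theorem exists_eval (lev : Q → ℕ) (op : Q → Bool → Bool → Bool) (s s' : Q → Q)
    (hs : ∀ q, 0 < lev q → lev (s q) < lev q) (hs' : ∀ q, 0 < lev q → lev (s' q) < lev q)
    (hdis : ∀ q r, 0 < lev q → lev q = lev r → q ≠ r →
      Disjoint ({s q, s' q, q} : Set Q) {s r, s' r, r}) (R : ℕ) :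
    (∃ c : Circuit Q, c.depth ≤ 8 * R ∧
      ∀ y : Q → Bool, (∀ q, 0 < lev q → y q = op q (y (s q)) (y (s' q))) →
        c.run (ket fun q => decide (lev q = 0) && y q) = ket fun q => decide (lev q ≤ R) && y q) ∧
    ∃ c : Circuit Q, c.depth ≤ 8 * R ∧
      ∀ y : Q → Bool, (∀ q, 0 < lev q → y q = op q (y (s q)) (y (s' q))) →
        c.run (ket fun q => decide (lev q ≤ R) && y q) = ket fun q => decide (lev q = 0) && y q := by
  induction R with
  | zero =>
    refine ⟨⟨[], by simp [Circuit.depth], fun y _ => ?_⟩, [], by simp [Circuit.depth],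
      fun y _ => ?_⟩ <;> simp [Circuit.run_nil]
  | succ R ih =>
    obtain ⟨⟨c₁, hd₁, hr₁⟩, c₂, hd₂, hr₂⟩ := ih
    obtain ⟨c, hd, hr⟩ := exists_stepMap (fun q => decide (lev q = R + 1)) op s s'
      (fun q h h' => by simp at h; have := hs q (by omega); rw [h'] at this; omega)
      (fun q h h' => by simp at h; have := hs' q (by omega); rw [h'] at this; omega)
      (fun q r h h' hne => by
        simp at h h'
        exact hdis q r (by omega) (by omega) hne)
    refine ⟨⟨c₁ ++ c, ?_, fun y hy => ?_⟩, c ++ c₂, ?_, fun y hy => ?_⟩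
    · rw [Circuit.depth_append]; omega
    · rw [Circuit.run_append, hr₁ y hy, hr]
      congr 1
      ext q
      by_cases h : lev q = R + 1
      · have h1 := hs q (by omega)
        have h2 := hs' q (by omega)
        have h3 : lev (s q) ≤ R := by omega
        have h4 : lev (s' q) ≤ R := by omega
        simp [stepMap, h, h3, h4, hy q (by omega)]
      · have : lev q ≤ R + 1 ↔ lev q ≤ R := by omega
        simp [stepMap, h, this]
    · rw [Circuit.depth_append]; omega
    · rw [Circuit.run_append, hr, ← hr₂ y hy]
      congr 2
      ext q
      by_cases h : lev q = R + 1
      · have h1 := hs q (by omega)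
        have h2 := hs' q (by omega)
        have h3 : lev (s q) ≤ R + 1 := by omega
        have h4 : lev (s' q) ≤ R + 1 := by omega
        simp [stepMap, h, h3, h4, hy q (by omega)]
      · have : lev q ≤ R + 1 ↔ lev q ≤ R := by omega
        simp [stepMap, h, this]

end Classical

/-! ### Boolean formulas -/

section Formulas

/-- `Cplx P d f`: the Boolean function `f` is given by a formula, a complete binary tree of height
`d` with a Boolean function of two bits at each inner node and a variable from `P` at each leaf. -/
inductive Cplx {V : Type} (P : Set V) : ℕ → ((V → Bool) → Bool) → Prop
  | var {v : V} (hv : v ∈ P) : Cplx P 0 fun x => x v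
  | op (g : Bool → Bool → Bool) {d : ℕ} {f₁ f₂ : (V → Bool) → Bool} :
      Cplx P d f₁ → Cplx P d f₂ → Cplx P (d + 1) fun x => g (f₁ x) (f₂ x)

/-- The subformulas of a formula, addressed by the paths from the root. -/
theorem Cplx.exists_family {V : Type} {P : Set V} {d : ℕ} {f : (V → Bool) → Bool}
    (h : Cplx P d f) : ∃ (F : List Bool → (V → Bool) → Bool) (op : List Bool → Bool → Bool → Bool)
      (v : List Bool → V), F [] = f ∧
      (∀ l, l.length = d → v l ∈ P ∧ ∀ x, F l x = x (v l)) ∧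
      (∀ l, l.length < d → ∀ x, F l x = op l (F (l ++ [false]) x) (F (l ++ [true]) x)) ∧
      ∀ l, l.length ≤ d → ∀ x x', (∀ u ∈ P, x u = x' u) → F l x = F l x' := by
  induction h with
  | @var v hv =>
    exact ⟨fun _ x => x v, fun _ _ _ => false, fun _ => v, rfl, fun _ _ => ⟨hv, fun _ => rfl⟩,
      fun _ h => absurd h (by simp), fun _ _ x x' h => h v hv⟩
  | @op g d f₁ f₂ _ _ ih₁ ih₂ =>
    obtain ⟨F₁, op₁, v₁, h1, h2, h3, h4⟩ := ih₁
    obtain ⟨F₂, op₂, v₂, k1, k2, k3, k4⟩ := ih₂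
    refine ⟨fun l => match l with
      | [] => fun x => g (f₁ x) (f₂ x)
      | false :: l => F₁ l
      | true :: l => F₂ l, fun l => match l with
      | [] => g
      | false :: l => op₁ l
      | true :: l => op₂ l, fun l => match l with
      | [] => v₁ []
      | false :: l => v₁ l
      | true :: l => v₂ l, rfl, ?_, ?_, ?_⟩
    · rintro (_ | ⟨_ | _, l⟩) hl
      · simp at hl
      · exact h2 l (by simpa using hl)
      · exact k2 l (by simpa using hl)
    · rintro (_ | ⟨_ | _, l⟩) hl x
      · simp [h1, k1]
      · exact h3 l (by simpa using hl) x
      · exact k3 l (by simpa using hl) x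
    · rintro (_ | ⟨_ | _, l⟩) hl x x' hx
      · simp only []
        rw [← h1, ← k1, h4 [] (by simp) x x' hx, k4 [] (by simp) x x' hx]
      · exact h4 l (by simpa using hl) x x' hx
      · exact k4 l (by simpa using hl) x x' hx

theorem Cplx.mono {V : Type} {P : Set V} {d d' : ℕ} {f : (V → Bool) → Bool}
    (h : Cplx P d f) (hd : d ≤ d') : Cplx P d' f := by
  induction hd with
  | refl => exact h
  | step _ ih => exact Cplx.op (fun a _ => a) ih ih

theorem Cplx.const {V : Type} {P : Set V} {d : ℕ} {v : V} (hv : v ∈ P) (b : Bool) :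
    Cplx P (d + 1) fun _ => b :=
  (Cplx.op (fun _ _ => b) (Cplx.var hv) (Cplx.var hv)).mono (by omega)

theorem Cplx.mux {V : Type} {P : Set V} {d : ℕ} {v : V} (hv : v ∈ P)
    {f : Bool → (V → Bool) → Bool} (h : ∀ b, Cplx P d (f b)) :
    Cplx P (d + 2) fun x => f (x v) x := by
  have h1 := (Cplx.op (fun a b => !a && b) ((Cplx.var hv).mono (Nat.zero_le d)) (h false))
  have h2 := (Cplx.op (fun a b => a && b) ((Cplx.var hv).mono (Nat.zero_le d)) (h true))
  convert Cplx.op (fun a b => a || b) h1 h2 using 1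
  ext x
  cases hx : x v <;> simp

/-- Selection by the values of `m` variables. -/
theorem Cplx.muxFin {V : Type} {P : Set V} {d : ℕ} : ∀ {m : ℕ} (r : Fin m → V)
    (_ : ∀ i, r i ∈ P) (f : (Fin m → Bool) → (V → Bool) → Bool) (_ : ∀ b, Cplx P d (f b)),
    Cplx P (d + 2 * m) fun x => f (fun i => x (r i)) x
  | 0, r, _, f, h => by
    have e : (fun x : V → Bool => f (fun i => x (r i)) x) = f Fin.elim0 :=
      funext fun x => congrFun (congrArg f (Subsingleton.elim _ _)) x
    rw [e]
    exact h _
  | m + 1, r, hr, f, h => by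
    have ih := fun b => Cplx.muxFin (fun i : Fin m => r i.succ) (fun i => hr _)
      (fun k => f (Fin.cons b k)) (fun k => h _)
    have e : (fun x : V → Bool => f (fun i => x (r i)) x) =
        fun x => f (Fin.cons (x (r 0)) fun i => x (r i.succ)) x := by
      funext x
      congr 1
      ext i
      refine Fin.cases ?_ (fun i => ?_) i <;> simp
    rw [e]
    exact Cplx.mux (hr 0) ih

/-- Every Boolean function of `m` variables has a formula of depth `2 m + 1`. -/
theorem Cplx.ofFintype {V ι : Type} [Fintype ι] {P : Set V} {v : V} (hv : v ∈ P) (r : ι → V)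
    (hr : ∀ i, r i ∈ P) (f : (ι → Bool) → Bool) :
    Cplx P (1 + 2 * Fintype.card ι) fun x => f fun i => x (r i) := by
  let e := Fintype.equivFin ι
  convert Cplx.muxFin (P := P) (d := 1) (fun i => r (e.symm i)) (fun i => hr _)
    (fun b _ => f (b ∘ e)) (fun b => Cplx.const hv _) using 3
  ext i
  simp

/-- A disjunction over all bit strings of length `m` adds `m` to the depth. -/
theorem Cplx.exists {V : Type} {P : Set V} {d : ℕ} : ∀ {m : ℕ}
    (f : (Fin m → Bool) → (V → Bool) → Bool) (_ : ∀ b, Cplx P d (f b)),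
    Cplx P (d + m) fun x => decide (∃ k, f k x = true)
  | 0, f, h => by
    have e : (fun x : V → Bool => decide (∃ k, f k x = true)) = f Fin.elim0 := by
      funext x
      rw [Bool.eq_iff_iff, decide_eq_true_iff]
      exact ⟨fun ⟨k, hk⟩ => by rwa [Subsingleton.elim Fin.elim0 k], fun h => ⟨_, h⟩⟩
    rw [e]
    exact h _
  | m + 1, f, h => by
    have ih := fun b => Cplx.exists (fun k : Fin m → Bool => f (Fin.cons b k)) (fun k => h _)
    have e : (fun x : V → Bool => decide (∃ k, f k x = true)) = fun x =>
        (decide (∃ k, f (Fin.cons false k) x = true) ||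
          decide (∃ k, f (Fin.cons true k) x = true)) := by
      funext x
      rw [Bool.eq_iff_iff, decide_eq_true_iff, Bool.or_eq_true, decide_eq_true_iff,
        decide_eq_true_iff]
      constructor
      · rintro ⟨k, hk⟩
        rw [← Fin.cons_self_tail k] at hk
        cases hb : k 0
        · rw [hb] at hk; exact Or.inl ⟨_, hk⟩
        · rw [hb] at hk; exact Or.inr ⟨_, hk⟩
      · rintro (⟨k, hk⟩ | ⟨k, hk⟩) <;> exact ⟨_, hk⟩
    rw [e]
    exact Cplx.op (fun a b => a || b) (ih false) (ih true)

end Formulas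

section XorCircuit

/-- Lists of at most `k` bits. -/
abbrev BL (k : ℕ) : Type := {l : List Bool // l.length ≤ k}

/-- Lists of at most `k` bits as pairs of a length and a string of this length. -/
def blEquiv (k : ℕ) : BL k ≃ Σ i : Fin (k + 1), List.Vector Bool i where
  toFun l := ⟨⟨l.1.length, Nat.lt_succ_of_le l.2⟩, ⟨l.1, rfl⟩⟩
  invFun p := ⟨p.2.1, by rw [p.2.2]; exact Nat.le_of_lt_succ p.1.2⟩
  left_inv _ := rfl
  right_inv := by
    rintro ⟨⟨i, hi⟩, ⟨l, hl⟩⟩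
    simp only at hl
    subst hl
    rfl

instance (k : ℕ) : Fintype (BL k) := Fintype.ofEquiv _ (blEquiv k).symm

theorem card_BL_le (k : ℕ) : Fintype.card (BL k) ≤ 2 ^ (2 * k + 1) := by
  rw [Fintype.card_congr (blEquiv k), Fintype.card_sigma]
  simp only [card_vector, Fintype.card_bool]
  calc ∑ i : Fin (k + 1), 2 ^ (i : ℕ) ≤ ∑ _i : Fin (k + 1), 2 ^ k :=
        Finset.sum_le_sum fun i _ => Nat.pow_le_pow_right (by norm_num) (by omega)
    _ = (k + 1) * 2 ^ k := by simp
    _ ≤ 2 ^ (k + 1) * 2 ^ k := Nat.mul_le_mul_right _ Nat.lt_two_pow_self.le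
    _ = 2 ^ (2 * k + 1) := by rw [← pow_add]; congr 1; omega

/-- The list, cut to length `k`. -/
def mkBL (k : ℕ) (l : List Bool) : BL k := ⟨l.take k, by simp⟩

theorem mkBL_val {k : ℕ} {l : List Bool} (h : l.length ≤ k) : (mkBL k l).1 = l := by
  simp [mkBL, h]

theorem mkBL_self {k : ℕ} (l : BL k) : mkBL k l.1 = l := Subtype.ext (mkBL_val l.2)

theorem mkBL_inj {k : ℕ} {l l' : List Bool} (h : l.length ≤ k) (h' : l'.length ≤ k)
    (he : mkBL k l = mkBL k l') : l = l' := by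
  rw [← mkBL_val h, he, mkBL_val h']

variable {B : Type} [Fintype B] [DecidableEq B]

/-- The work qubits for evaluating one formula of depth `D` for each qubit in `B`: binary trees in
which the qubits of `B` are copied, and the nodes of the formulas. -/
abbrev Scr (B : Type) (L D : ℕ) : Type := (B × BL (L + D)) ⊕ (B × BL D)

/-- The basis state with value `x` on the base qubits, and work qubits zero. -/
noncomputable def ketz {S : Type} [Fintype S] [DecidableEq S] (x : B → Bool) : QState (B ⊕ S) :=
  ket (Sum.elim x fun _ => false)

/-- Formulas of depth `D` that do not read the targets `T` are added to all the targets in depth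
`O(D + log |B|)`. Every variable is copied to the nodes of a binary tree of height `L + D`, and the
leaf `l` of the formula for `t` reads the copy with the address `code t ++ l`, where `code` embeds
`B` into the bit strings of length `L`; so different formulas share no qubits. The roots of the
formulas are added to the targets, and everything else is uncomputed. -/
theorem exists_xor (L D : ℕ) (hcard : Fintype.card B ≤ 2 ^ L) (T : Set B)
    (f : B → (B → Bool) → Bool) (hf : ∀ t ∈ T, Cplx Tᶜ D (f t)) :
    ∃ c : Circuit (B ⊕ Scr B L D), c.depth ≤ 32 * L + 48 * D + 40 ∧
      ∀ x x' : B → Bool, (∀ t ∈ T, x' t = (x t ^^ f t x)) → (∀ t ∉ T, x' t = x t) →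
        c.run (ketz x) = ketz x' := by
  classical
  obtain ⟨code₀⟩ : Nonempty (B ↪ (Fin L → Bool)) :=
    Function.Embedding.nonempty_of_card_le (by simpa using hcard)
  let code : B → List Bool := fun t => List.ofFn (code₀ t)
  have hlen : ∀ t, (code t).length = L := fun t => by simp [code]
  have hinj : ∀ t u, code t = code u → t = u := fun t u h =>
    code₀.injective (List.ofFn_injective h)
  have hfam : ∀ t : B, ∃ (F : List Bool → (B → Bool) → Bool) (op : List Bool → Bool → Bool → Bool)
      (v : List Bool → B), t ∈ T → F [] = f t ∧
      (∀ l, l.length = D → v l ∈ Tᶜ ∧ ∀ x, F l x = x (v l)) ∧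
      (∀ l, l.length < D → ∀ x, F l x = op l (F (l ++ [false]) x) (F (l ++ [true]) x)) ∧
      ∀ l, l.length ≤ D → ∀ x x', (∀ u ∈ Tᶜ, x u = x' u) → F l x = F l x' := by
    intro t
    by_cases ht : t ∈ T
    · obtain ⟨F, op, v, h⟩ := (hf t ht).exists_family
      exact ⟨F, op, v, fun _ => h⟩
    · exact ⟨fun _ _ => false, fun _ _ _ => false, fun _ => t, fun h => absurd h ht⟩
  choose F op v hF using hfam
  -- `cp b l` is the copy of `b` at the node `l`, `nd t l` is the node `l` of the formula for `t`
  let cp : B → List Bool → B ⊕ Scr B L D := fun b l => Sum.inr (Sum.inl (b, mkBL _ l))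
  let nd : B → List Bool → B ⊕ Scr B L D := fun b l => Sum.inr (Sum.inr (b, mkBL _ l))
  -- two levels for each level of a tree of copies, as a node copies itself to one child at a time;
  -- then one level for each level of the formulas, from their leaves to their roots
  let lev : B ⊕ Scr B L D → ℕ := fun q => match q with
    | .inl _ => 0
    | .inr (.inl (b, l)) =>
        if b ∈ T then 0 else 2 * l.1.length + if l.1.getLast? = some false then 0 else 1
    | .inr (.inr (t, l)) => if t ∈ T then 2 * (L + D) + 2 + (D - l.1.length) else 0
  let src : Bool → B ⊕ Scr B L D → B ⊕ Scr B L D := fun β q => match q with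
    | .inl b => .inl b
    | .inr (.inl (b, l)) => if l.1 = [] then .inl b else cp b l.1.dropLast
    | .inr (.inr (t, l)) => if l.1.length = D then cp (v t l.1) (code t ++ l.1)
        else nd t (l.1 ++ [β])
  let gate : B ⊕ Scr B L D → Bool → Bool → Bool := fun q => match q with
    | .inl _ => fun a _ => a
    | .inr (.inl _) => fun a _ => a
    | .inr (.inr (t, l)) => if l.1.length = D then fun a _ => a else op t l.1
  -- the values of all qubits after the evaluation of the formulas for the inputs `x`
  let y : (B → Bool) → B ⊕ Scr B L D → Bool := fun x q => match q with
    | .inl b => x b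
    | .inr (.inl (b, _)) => if b ∈ T then false else x b
    | .inr (.inr (t, l)) => if t ∈ T then F t l.1 x else false
  have hlast : ∀ l : List Bool, l ≠ [] → l.dropLast.length + 1 = l.length := by
    intro l hl
    have := List.length_pos_iff.2 hl
    rw [List.length_dropLast]; omega
  have hlt : ∀ β q, 0 < lev q → lev (src β q) < lev q := by
    rintro β (b | ⟨b, l, hl⟩ | ⟨t, l, hl⟩) hq
    · simp [lev] at hq
    · by_cases hb : b ∈ T
      · simp [lev, hb] at hq
      · by_cases h0 : l = []
        · simp [lev, src, h0, hb]
        · have h1 := hlast l h0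
          have h2 : l.dropLast.length ≤ L + D := by omega
          simp only [lev, src, h0, hb, cp, if_false, mkBL_val h2]
          split_ifs <;> omega
    · by_cases hb : t ∈ T
      · by_cases h0 : l.length = D
        · have h3 : (code t ++ l).length ≤ L + D := by simp [hlen, h0]
          simp only [lev, src, h0, hb, cp, if_true, mkBL_val h3, List.length_append, hlen]
          split_ifs <;> omega
        · have h3 : (l ++ [β]).length ≤ D := by simp; omega
          simp only [lev, src, h0, hb, nd, if_true, if_false, mkBL_val h3, List.length_append,
            List.length_singleton]
          omega
      · simp [lev, hb] at hq
  have hdis : ∀ q r, 0 < lev q → lev q = lev r → q ≠ r →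
      Disjoint ({src false q, src true q, q} : Set (B ⊕ Scr B L D)) {src false r, src true r, r} := by
    rintro (b | ⟨b, l, hl⟩ | ⟨t, l, hl⟩) (c | ⟨c, m, hm⟩ | ⟨u, m, hm⟩) h0 h1 hne
    · simp [lev] at h0
    · simp [lev] at h0
    · simp [lev] at h0
    · simp only [lev] at h0 h1; omega
    · have hb : b ∉ T := fun h => by simp [lev, h] at h0
      have hc : c ∉ T := fun h => by rw [h1] at h0; simp [lev, h] at h0
      simp only [lev, hb, hc, if_false] at h1
      have hlm : l.length = m.length := by split_ifs at h1 <;> omega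
      obtain rfl | ⟨l, x, rfl⟩ := l.eq_nil_or_concat'
      · obtain rfl : m = [] := List.length_eq_zero_iff.1 hlm.symm
        have hbc : b ≠ c := by rintro rfl; exact hne rfl
        simp [src, Set.disjoint_left, hbc]
      · obtain rfl | ⟨m, z, rfl⟩ := m.eq_nil_or_concat'
        · simp at hlm
        · simp only [List.length_append, List.length_singleton] at hlm hl hm h1
          have hxz : x = z := by
            cases x <;> cases z <;> simp at h1 ⊢ <;> omega
          subst hxz
          have hself : b = c → l ≠ m := by rintro rfl rfl; exact hne rfl
          have h2 : ∀ l' m' : List Bool, l'.length ≤ L + D → m'.length ≤ L + D →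
              (mkBL (L + D) l' = mkBL (L + D) m' ↔ l' = m') := fun l' m' h h' =>
            ⟨mkBL_inj h h', congrArg _⟩
          have h3 : ∀ (l' m' : List Bool) (h : l'.length ≤ L + D), m'.length ≤ L + D →
              ((⟨l', h⟩ : BL (L + D)) = mkBL (L + D) m' ↔ l' = m') := fun l' m' h h' =>
            ⟨fun e => by rw [← mkBL_val h', ← e], by rintro rfl; exact (mkBL_self ⟨l', h⟩).symm⟩
          simp only [src, Set.disjoint_left, cp, List.append_eq_nil_iff, List.cons_ne_nil,
            and_false, if_false, List.dropLast_concat, Set.insert_idem, Set.mem_insert_iff,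
            Set.mem_singleton_iff]
          rintro q (rfl | rfl) hq <;>
            simp only [Sum.inr.injEq, Sum.inl.injEq, Prod.mk.injEq] at hq
          · rcases hq with (hq | hq)
            · exact hself hq.1 ((h2 l m (by omega) (by omega)).1 hq.2)
            · have := (h3 (m ++ [x]) l (by simpa using hm) (by omega)).1 hq.2.symm
              have := congrArg List.length this
              simp at this; omega
          · rcases hq with (hq | hq)
            · have := congrArg List.length
                ((h3 (l ++ [x]) m (by simpa using hl) (by omega)).1 hq.2)
              simp at this; omega
            · exact hself hq.1 (List.append_cancel_right (congrArg Subtype.val hq.2))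
    · have hb : b ∉ T := fun h => by simp [lev, h] at h0
      have hc : u ∈ T := by by_contra h; rw [h1] at h0; simp [lev, h] at h0
      simp only [lev, hb, hc, if_false, if_true] at h1
      split_ifs at h1 <;> omega
    · simp only [lev] at h0 h1; omega
    · have hb : c ∉ T := fun h => by rw [h1] at h0; simp [lev, h] at h0
      have hc : t ∈ T := by by_contra h; simp [lev, h] at h0
      simp only [lev, hb, hc, if_false, if_true] at h1
      split_ifs at h1 <;> omega
    · have hb : t ∈ T := by by_contra h; simp [lev, h] at h0
      have hc : u ∈ T := by by_contra h; rw [h1] at h0; simp [lev, h] at h0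
      simp only [lev, hb, hc, if_true] at h1
      have hlm : l.length = m.length := by omega
      have hself : t = u → l ≠ m := by rintro rfl rfl; exact hne rfl
      by_cases hD : l.length = D
      · have hDm : m.length = D := by omega
        have hl' : (code t ++ l).length ≤ L + D := by simp [hlen, hD]
        have hm' : (code u ++ m).length ≤ L + D := by simp [hlen, hDm]
        have hcode : code t ++ l ≠ code u ++ m := fun h => by
          obtain ⟨h1, h2⟩ := List.append_inj h (by rw [hlen, hlen])
          exact hself (hinj _ _ h1) h2
        simp only [src, Set.disjoint_left, cp, hD, hDm, if_true, Set.insert_idem,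
          Set.mem_insert_iff, Set.mem_singleton_iff]
        rintro q (rfl | rfl) hq <;> simp at hq
        · exact hcode (mkBL_inj hl' hm' hq.2)
        · exact hself hq.1 hq.2
      · have hDm : m.length ≠ D := by omega
        have hl' : ∀ β, (l ++ [β]).length ≤ D := by intro β; simp; omega
        have hm' : ∀ β, (m ++ [β]).length ≤ D := by intro β; simp; omega
        have hch : ∀ β β', t = u → mkBL D (l ++ [β]) ≠ mkBL D (m ++ [β']) := by
          intro β β' htu h
          exact hself htu (List.append_inj' (mkBL_inj (hl' β) (hm' β') h) rfl).1
        have h4 : ∀ β, mkBL D (l ++ [β]) ≠ ⟨m, hm⟩ := by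
          intro β h
          have := congrArg (fun z => z.1.length) h
          simp only [mkBL_val (hl' β)] at this
          simp at this; omega
        have h5 : ∀ β, ⟨l, hl⟩ ≠ mkBL D (m ++ [β]) := by
          intro β h
          have := congrArg (fun z => z.1.length) h
          simp only [mkBL_val (hm' β)] at this
          simp at this; omega
        have h6 : t = u → (⟨l, hl⟩ : BL D) ≠ ⟨m, hm⟩ := fun h h' =>
          hself h (congrArg Subtype.val h')
        simp only [src, Set.disjoint_left, nd, hD, hDm, if_false,
          Set.mem_insert_iff, Set.mem_singleton_iff]
        rintro q (rfl | rfl | rfl) hq <;>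
          simp only [Sum.inr.injEq, Prod.mk.injEq] at hq <;>
          rcases hq with (hq | hq | hq) <;>
          first | exact hch _ _ hq.1 hq.2 | exact h4 _ hq.2 | exact h5 _ hq.2 | exact h6 hq.1 hq.2
  have hy : ∀ x q, 0 < lev q → y x q = gate q (y x (src false q)) (y x (src true q)) := by
    rintro x (b | ⟨b, l, hl⟩ | ⟨t, l, hl⟩) hq
    · simp [lev] at hq
    · by_cases hb : b ∈ T
      · simp [lev, hb] at hq
      · by_cases h0 : l = [] <;> simp [y, gate, src, h0, hb, cp]
    · by_cases hb : t ∈ T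
      · by_cases h0 : l.length = D
        · have h1 := (hF t hb).2.1 l h0
          have h2 : v t l ∉ T := h1.1
          simp [y, gate, src, h0, hb, cp, h1.2, h2]
        · have h3 : ∀ β, (l ++ [β]).length ≤ D := by intro β; simp; omega
          have h1 := (hF t hb).2.2.1 l (by omega) x
          simp only [y, gate, src, h0, hb, nd, if_true, if_false, mkBL_val (h3 _)]
          exact h1
      · simp [lev, hb] at hq
  obtain ⟨⟨c₁, hd₁, hr₁⟩, c₂, hd₂, hr₂⟩ := exists_eval lev gate (src false) (src true)
    (hlt false) (hlt true) hdis (2 * (L + D) + 2 + D)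
  have hlev : ∀ q, lev q ≤ 2 * (L + D) + 2 + D := by
    rintro (b | ⟨b, l, hl⟩ | ⟨t, l, hl⟩) <;> simp only [lev] <;> (try split_ifs) <;> omega
  simp only [hlev, decide_true, Bool.true_and] at hr₁ hr₂
  have hinit : ∀ x, (ketz x : QState (B ⊕ Scr B L D)) = ket fun q => decide (lev q = 0) && y x q := by
    intro x
    unfold ketz
    congr 1
    ext (b | ⟨b, l, hl⟩ | ⟨t, l, hl⟩)
    · simp [lev, y]
    · by_cases hb : b ∈ T
      · simp [y, hb]
      · have : lev (Sum.inr (Sum.inl (b, ⟨l, hl⟩))) ≠ 0 := by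
          by_cases h0 : l = []
          · simp [lev, h0, hb]
          · simp [lev, h0, hb]
        simp [this]
    · by_cases hb : t ∈ T
      · simp [lev, hb]
      · simp [y, hb]
  obtain ⟨c, hd, hr⟩ := exists_stepMap
    (fun q : B ⊕ Scr B L D => match q with
      | .inl t => decide (t ∈ T)
      | .inr _ => false)
    (fun _ a _ => a)
    (fun q => match q with
      | .inl t => nd t []
      | .inr w => .inr w)
    (fun q => match q with
      | .inl t => nd t []
      | .inr w => .inr w)
    (by rintro (t | w) h <;> simp [nd] at h ⊢) (by rintro (t | w) h <;> simp [nd] at h ⊢)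
    (by
      rintro (t | w) (u | w') h h' hne
      · simp only [Set.disjoint_left, nd]
        rintro q (rfl | rfl | rfl) <;> simp at hne ⊢ <;> simpa using hne
      all_goals simp at h h')
  refine ⟨c₁ ++ (c ++ c₂), ?_, fun x x' hT hT' => ?_⟩
  · simp only [Circuit.depth_append]; omega
  · rw [Circuit.run_append, Circuit.run_append, hinit, hr₁ (y x) (hy x), hr, hinit,
      ← hr₂ (y x') (hy x')]
    congr 2
    ext (b | ⟨b, l, hl⟩ | ⟨t, l, hl⟩)
    · by_cases hb : b ∈ T
      · have : F b [] x = f b x := by rw [(hF b hb).1]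
        simp [stepMap, y, hb, nd, mkBL, this, hT b hb]
      · simp [stepMap, y, hb, hT' b hb]
    · by_cases hb : b ∈ T
      · simp [stepMap, y, hb]
      · simp [stepMap, y, hb, hT' b hb]
    · by_cases hb : t ∈ T
      · have := (hF t hb).2.2.2 l hl x x' (fun u hu => (hT' u hu).symm)
        simp [stepMap, y, hb, this]
      · simp [stepMap, y, hb]

end XorCircuit

/-! ### Descending a binary tree -/

section Node

variable {Q : Type} [Fintype Q] [DecidableEq Q]

theorem sum_bitStr_succ {M : Type*} [AddCommMonoid M] {d : ℕ} (g : BitStr (d + 1) → M) :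
    ∑ k, g k = ∑ b : Bool, ∑ k : BitStr d, g (Fin.cons b k) := by
  rw [← (Fin.consEquiv fun _ => Bool).sum_comp, Fintype.sum_prod_type]
  rfl

/-- The angle `∑ τ i` over the bits `w i` that are set. -/
def angleOf {m : ℕ} (τ : Fin m → ℝ) (w : Fin m → Bool) : ℝ := ∑ i, if w i then τ i else 0

/-- A rotation whose angle is given by the bits `r`, controlled by `e`: each bit contributes a doubly
controlled rotation. -/
theorem exists_ctrl_rot {m : ℕ} (τ : Fin m → ℝ) {e t : Q} (het : e ≠ t) (r : Fin m → Q)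
    (hre : ∀ i, r i ≠ e) (hrt : ∀ i, r i ≠ t) :
    ∃ c : Circuit Q, c.depth ≤ 5 * m ∧ Within ({e, t} ∪ Set.range r) c ∧
      (∀ x, x e = false → c.run (ket x) = ket x) ∧
      ∀ x, x e = true → c.run (ket x) = ∑ s : Bool,
        rotMat (angleOf τ fun i => x (r i)) s (x t) • ket (Function.update x t s) := by
  have key : ∀ l : List (Fin m), ∃ c : Circuit Q, c.depth ≤ 5 * l.length ∧
      Within ({e, t} ∪ Set.range r) c ∧ (∀ x, x e = false → c.run (ket x) = ket x) ∧
      ∀ x, x e = true → c.run (ket x) = ∑ s : Bool,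
        rotMat (l.map fun i => if x (r i) then τ i else 0).sum s (x t) •
          ket (Function.update x t s) := by
    intro l
    induction l with
    | nil =>
      refine ⟨[], by simp [Circuit.depth], within_nil _, fun _ _ => rfl, fun x _ => ?_⟩
      have hx : ∀ s, x t = s → Function.update x t s = x := by rintro _ rfl; simp
      cases h : x t <;> simp [rotMat, Circuit.run_nil, hx _ h]
    | cons i l ih =>
      obtain ⟨c, hd, hw, h0, h1⟩ := ih
      obtain ⟨c', hd', hw', h'⟩ := exists_ctrl_ctrl (hre i).symm het (hrt i)
        ⟨rotMat (τ i / 2), rotMat_mem _⟩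
      refine ⟨c' ++ c, ?_, (hw'.mono ?_).append hw, fun x hx => ?_, fun x hx => ?_⟩
      · rw [Circuit.depth_append, List.length_cons]; omega
      · rintro q (rfl | rfl | rfl) <;> simp
      · rw [Circuit.run_append, h', hx]
        simpa using h0 x hx
      · rw [Circuit.run_append, h', hx]
        simp only [rotMat_mul, add_halves, Bool.true_and, List.map_cons, List.sum_cons]
        by_cases hi : x (r i) = true
        · have hu : ∀ s, c.run (ket (Function.update x t s)) = ∑ s' : Bool,
              rotMat (l.map fun i => if x (r i) then τ i else 0).sum s' s •
                ket (Function.update x t s') := by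
            intro s
            rw [h1 _ (by simp [het, hx])]
            simp [Function.update_of_ne (hrt _)]
          simp only [hi, if_true, Circuit.run_sum, Circuit.run_smul, hu]
          rw [add_comm (τ i), ← rotMat_mul]
          simp only [Matrix.mul_apply, Fintype.sum_bool]
          module
        · simp only [hi]
          rw [if_neg (by simp), h1 x hx]
          simp
  obtain ⟨c, hd, hw, h0, h1⟩ := key (List.finRange m)
  refine ⟨c, by simpa using hd, hw, h0, fun x hx => ?_⟩
  rw [h1 x hx, angleOf, ← List.ofFn_eq_map, List.sum_ofFn]

/-- A phase given by the bits `r`, which the bit `e` gets if it is set. -/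
theorem exists_ctrl_phase {m : ℕ} (τ : Fin m → ℝ) {e : Q} (r : Fin m → Q)
    (hre : ∀ i, r i ≠ e) :
    ∃ c : Circuit Q, c.depth ≤ m ∧ Within ({e} ∪ Set.range r) c ∧
      ∀ x, c.run (ket x) = (if x e then
        Complex.exp ((angleOf τ fun i => x (r i) : ℝ) * Complex.I) else 1) • ket x := by
  have key : ∀ l : List (Fin m), ∃ c : Circuit Q, c.depth ≤ l.length ∧
      Within ({e} ∪ Set.range r) c ∧ ∀ x, c.run (ket x) = (if x e then
        Complex.exp (((l.map fun i => if x (r i) then τ i else 0).sum : ℝ) * Complex.I) else 1) •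
          ket x := by
    intro l
    induction l with
    | nil =>
      refine ⟨[], by simp [Circuit.depth], within_nil _, fun x => ?_⟩
      simp [Circuit.run_nil]
    | cons i l ih =>
      obtain ⟨c, hd, hw, h1⟩ := ih
      refine ⟨single (.two e (r i) (hre i).symm (ctrl ⟨phaseMat (τ i), phaseMat_mem _⟩)) ++ c, ?_,
        (within_single ?_).append hw, fun x => ?_⟩
      · rw [Circuit.depth_append, List.length_cons, depth_single]; omega
      · rintro q (rfl | rfl) <;> simp
      · rw [Circuit.run_append, run_single, apply_ctrl_ket]
        have hx : ∀ s, x (r i) = s → Function.update x (r i) s = x := by rintro _ rfl; simp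
        cases he : x e
        · simp [h1, he]
        · cases hi : x (r i)
          · simp [phaseMat, hx _ hi, h1, he, hi]
          · simp [phaseMat, hx _ hi, h1, he, hi, Circuit.run_smul, smul_smul, ← Complex.exp_add,
              add_mul]
  obtain ⟨c, hd, hw, h1⟩ := key (List.finRange m)
  refine ⟨c, by simpa using hd, hw, fun x => ?_⟩
  rw [h1 x, angleOf, ← List.ofFn_eq_map, List.sum_ofFn]

/-- The step at one node of the tree. If the bit `e` of the node is set, the excitation is shared
between its children `e₀` and `e₁`: the rotation with the angle given by the bits `r` acts on `e₁`,
then `e₀` becomes the complement of `e₁`, and gets the phase given by the bits `p`. -/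
theorem exists_node {m : ℕ} (τ : Fin m → ℝ) {e e₀ e₁ : Q} (h0 : e ≠ e₀) (h1 : e ≠ e₁)
    (h01 : e₀ ≠ e₁) (r p : Fin m → Q) (hr : ∀ i, r i ≠ e) (hr0 : ∀ i, r i ≠ e₀)
    (hr1 : ∀ i, r i ≠ e₁) (hp0 : ∀ i, p i ≠ e₀) (hp1 : ∀ i, p i ≠ e₁) :
    ∃ c : Circuit Q, c.depth ≤ 6 * m + 8 ∧
      Within ({e, e₀, e₁} ∪ Set.range r ∪ Set.range p) c ∧
      (∀ x, x e = false → x e₀ = false → c.run (ket x) = ket x) ∧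
      ∀ x, x e = true → x e₀ = false → x e₁ = false → c.run (ket x) =
        ((Real.cos (angleOf τ fun i => x (r i)) : ℂ) *
            Complex.exp ((angleOf τ fun i => x (p i) : ℝ) * Complex.I)) •
              ket (Function.update x e₀ true) +
          (Real.sin (angleOf τ fun i => x (r i)) : ℂ) • ket (Function.update x e₁ true) := by
  obtain ⟨c₁, hd₁, hw₁, hz₁, hr₁⟩ := exists_ctrl_rot τ h1 r hr hr1
  obtain ⟨c₂, hd₂, hw₂, hr₂⟩ := exists_op h0 h01.symm (fun a b => a && !b)
  obtain ⟨c₃, hd₃, hw₃, hr₃⟩ := exists_ctrl_phase τ p hp0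
  refine ⟨c₁ ++ (c₂ ++ c₃), ?_, (hw₁.mono ?_).append ((hw₂.mono ?_).append (hw₃.mono ?_)),
    fun x hx hx0 => ?_, fun x hx hx0 hx1 => ?_⟩
  · simp only [Circuit.depth_append]; omega
  · rintro q ((rfl | rfl) | hq)
    · simp
    · simp
    · exact Or.inl (Or.inr hq)
  · rintro q (rfl | rfl | rfl) <;> simp
  · rintro q (rfl | hq)
    · simp
    · exact Or.inr hq
  · simp [Circuit.run_append, hz₁ x hx, hr₂, hx, flip_false, hr₃, hx0]
  · have hu : Function.update x e₁ false = x := by rw [← hx1]; simp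
    simp only [Circuit.run_append, hr₁ x hx, Fintype.sum_bool, hx1, Circuit.run_add,
      Circuit.run_smul, hr₂, hu]
    simp [flip, h1, h01, hx, hx0, hr₃, rotMat, hp0]
    have hu2 : Function.update (Function.update x e₁ true) e₀ false = Function.update x e₁ true := by
      rw [Function.update_eq_self_iff]; simp [h01, hx0]
    rw [hu2, smul_smul, add_comm]

end Node

section Levels

/-- The amplitude of the leaf `k` and the flag `s` in a tree of height `d` with the amplitudes
`u v b` for going from the node `v` to its child `b`. -/
def amp : (d : ℕ) → (List Bool → Bool → ℂ) → BitStr d → Bool → ℂ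
  | 0, u, _, s => u [] s
  | d + 1, u, k, s => u [] (k 0) * amp d (fun l => u (k 0 :: l)) (Fin.tail k) s

variable {Q : Type} [Fintype Q] [DecidableEq Q]

/-- The assignment `x`, with the bits of all the nodes on the path `y` from the root set. -/
noncomputable def pathSet (pw : List Bool → Q) (x : Q → Bool) (y : List Bool) : Q → Bool :=
  open Classical in fun q => decide (∃ l, l <+: y ∧ q = pw l) || x q

/-- The amplitudes `(cos θ e^{iφ}, sin θ)` of the two children of a node. -/
noncomputable def nodeVec (θ φ : ℝ) : Bool → ℂ
  | false => (Real.cos θ : ℂ) * Complex.exp (φ * Complex.I)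
  | true => (Real.sin θ : ℂ)

/-- The amplitudes at the nodes, given by the bits `rw` and `ph` of the angles. -/
noncomputable def nodeAmp {m : ℕ} (τ : Fin m → ℝ) (rw ph : List Bool → Fin m → Q) (x : Q → Bool)
    (v : List Bool) : Bool → ℂ :=
  nodeVec (angleOf τ fun i => x (rw v i)) (angleOf τ fun i => x (ph v i))

theorem foldl_run_of_fixed {ι : Type*} (c : ι → Circuit Q) (l : List ι) (ψ : QState Q)
    (h : ∀ i ∈ l, (c i).run ψ = ψ) : l.foldl (fun φ i => (c i).run φ) ψ = ψ := by
  induction l with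
  | nil => rfl
  | cons i l ih =>
    simp only [List.mem_cons, forall_eq_or_imp] at h
    rw [List.foldl_cons, h.1, ih h.2]

variable {n m : ℕ} (τ : Fin m → ℝ) (pw : List Bool → Q) (rw ph : List Bool → Fin m → Q)

/-- The steps at all the nodes of level `l` at the same time. -/
theorem exists_level
    (hpw : ∀ v w, v.length ≤ n + 1 → w.length ≤ n + 1 → pw v = pw w → v = w)
    (hrp : ∀ v w i, rw v i ≠ pw w) (hpp : ∀ v w i, ph v i ≠ pw w) (hrph : ∀ v w i j, rw v i ≠ ph w j)
    (hrw : ∀ v w i j, v.length ≤ n → w.length ≤ n → rw v i = rw w j → v = w)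
    (hph : ∀ v w i j, v.length ≤ n → w.length ≤ n → ph v i = ph w j → v = w)
    (l : ℕ) (hl : l ≤ n) :
    ∃ c : Circuit Q, c.depth ≤ 6 * m + 8 ∧ ∀ x : Q → Bool, (∀ v, x (pw v) = false) →
      ∀ y : List Bool, y.length = l → c.run (ket (pathSet pw x y)) =
        ∑ b : Bool, nodeAmp τ rw ph x y b • ket (pathSet pw x (y ++ [b])) := by
  have hval : ∀ (x : Q → Bool), (∀ v, x (pw v) = false) → ∀ y v : List Bool, y.length ≤ n + 1 →
      v.length ≤ n + 1 → (pathSet pw x y (pw v) = true ↔ v <+: y) := by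
    intro x hx y v hy hv
    simp only [pathSet, hx, Bool.or_false, decide_eq_true_iff]
    refine ⟨?_, fun h => ⟨v, h, rfl⟩⟩
    rintro ⟨w, hw, he⟩
    rwa [hpw v w hv (hw.length_le.trans hy) he]
  have hvalf : ∀ (x : Q → Bool), (∀ v, x (pw v) = false) → ∀ y v : List Bool, y.length ≤ n + 1 →
      v.length ≤ n + 1 → ¬ v <+: y → pathSet pw x y (pw v) = false := by
    intro x hx y v hy hv h
    rw [← Bool.not_eq_true, hval x hx y v hy hv]; exact h
  have hne : ∀ (v : List Bool) (b : Bool), v.length ≤ n → pw v ≠ pw (v ++ [b]) := by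
    intro v b hv h
    have := congrArg List.length (hpw _ _ (by omega) (by simpa using hv) h)
    simp at this
  have hne' : ∀ (v : List Bool), v.length ≤ n → pw (v ++ [false]) ≠ pw (v ++ [true]) := by
    intro v hv h
    have := hpw _ _ (by simpa using hv) (by simpa using hv) h
    simp at this
  have hex : ∀ k : BitStr l, _ := fun k =>
    have hk : (List.ofFn k).length ≤ n := by simpa using hl
    exists_node τ (hne (List.ofFn k) false hk) (hne (List.ofFn k) true hk)
      (hne' (List.ofFn k) hk) (rw (List.ofFn k)) (ph (List.ofFn k)) (hrp _ _) (hrp _ _) (hrp _ _)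
      (hpp _ _) (hpp _ _)
  choose c hd hw hz hr using hex
  let S : BitStr l → Set Q := fun k =>
    {pw (List.ofFn k), pw (List.ofFn k ++ [false]), pw (List.ofFn k ++ [true])} ∪
      Set.range (rw (List.ofFn k)) ∪ Set.range (ph (List.ofFn k))
  have hS : ∀ k k', k ≠ k' → Disjoint (S k) (S k') := by
    intro k k' hkk
    have hk : (List.ofFn k).length = l := by simp
    have hk' : (List.ofFn k').length = l := by simp
    have hv : List.ofFn k ≠ List.ofFn k' := fun h => hkk (List.ofFn_injective h)
    simp only [S]
    generalize List.ofFn k = v at *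
    generalize List.ofFn k' = w at *
    have hc : ∀ b b', pw (v ++ [b]) ≠ pw (w ++ [b']) := by
      intro b b' h
      have := hpw _ _ (by simp; omega) (by simp; omega) h
      exact hv (List.append_inj' this rfl).1
    have hc1 : ∀ b, pw v ≠ pw (w ++ [b]) := by
      intro b h
      have := congrArg List.length (hpw _ _ (by omega) (by simp; omega) h)
      simp at this; omega
    have hc2 : ∀ b, pw (v ++ [b]) ≠ pw w := by
      intro b h
      have := congrArg List.length (hpw _ _ (by simp; omega) (by omega) h)
      simp at this; omega
    have hc3 : pw v ≠ pw w := fun h => hv (hpw _ _ (by omega) (by omega) h)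
    have hr' : ∀ i j, rw w i ≠ rw v j := fun i j h => hv (hrw _ _ _ _ (by omega) (by omega) h).symm
    have hp' : ∀ i j, ph w i ≠ ph v j := fun i j h => hv (hph _ _ _ _ (by omega) (by omega) h).symm
    rw [Set.disjoint_left]
    rintro q (((rfl | rfl | rfl) | ⟨i, rfl⟩) | ⟨i, rfl⟩) <;>
      simp [hc, hc1, hc2, hc3, hr', hp', hrp, hpp, hrph,
        (hrph _ _ _ _).symm]
  obtain ⟨C, hCd, -, hCr⟩ := exists_par (Finset.univ : Finset (BitStr l)).toList S c (6 * m + 8)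
    ((Finset.nodup_toList _).pairwise_of_forall_ne fun k _ k' _ h => hS k k' h)
    (fun k _ => hw k) (fun k _ => hd k)
  refine ⟨C, hCd, fun x hx y hy => ?_⟩
  obtain ⟨k, rfl⟩ : ∃ k : BitStr l, List.ofFn k = y :=
    ⟨fun i => y.get (i.cast hy.symm), by subst hy; simp⟩
  rw [hCr]
  have hy' : (List.ofFn k).length ≤ n + 1 := by omega
  -- the steps at the nodes off the path do nothing
  have hoff : ∀ k' ≠ k, ∀ y', (y' = List.ofFn k ∨ ∃ b, y' = List.ofFn k ++ [b]) →
      (c k').run (ket (pathSet pw x y')) = ket (pathSet pw x y') := by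
    intro k' hk' y' hy'
    have hlen : (List.ofFn k').length = (List.ofFn k).length := by simp
    have hyl : y'.length ≤ n + 1 := by
      rcases hy' with rfl | ⟨b, rfl⟩
      · omega
      · simpa using hl
    have hnp : ∀ w, List.ofFn k' <+: w → ¬ w <+: y' := by
      intro w hw hwy
      have h2 : List.ofFn k <+: y' := by
        rcases hy' with rfl | ⟨b, rfl⟩
        · exact List.prefix_rfl
        · exact List.prefix_append _ _
      have h3 := List.prefix_of_prefix_length_le (hw.trans hwy) h2 hlen.le
      exact hk' (List.ofFn_injective (h3.eq_of_length hlen))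
    exact hz k' _ (hvalf x hx _ _ hyl (by omega) (hnp _ List.prefix_rfl))
      (hvalf x hx _ _ hyl (by simpa using hl) (hnp _ (List.prefix_append _ _)))
  have hupd : ∀ b, Function.update (pathSet pw x (List.ofFn k)) (pw (List.ofFn k ++ [b])) true =
      pathSet pw x (List.ofFn k ++ [b]) := by
    intro b
    ext q
    by_cases hq : q = pw (List.ofFn k ++ [b])
    · subst hq
      rw [Function.update_self, eq_comm, hval x hx _ _ (by simpa using hl) (by simpa using hl)]
    · rw [Function.update_of_ne hq]
      simp only [pathSet]
      congr 2
      rw [eq_iff_iff]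
      constructor
      · rintro ⟨v, hv, rfl⟩; exact ⟨v, hv.trans (List.prefix_append _ _), rfl⟩
      · rintro ⟨v, hv, rfl⟩
        rcases List.prefix_concat_iff.1 hv with rfl | hv
        · exact absurd rfl hq
        · exact ⟨v, hv, rfl⟩
  have hrwx : ∀ i, pathSet pw x (List.ofFn k) (rw (List.ofFn k) i) = x (rw (List.ofFn k) i) := by
    intro i; simp [pathSet, hrp]
  have hphx : ∀ i, pathSet pw x (List.ofFn k) (ph (List.ofFn k) i) = x (ph (List.ofFn k) i) := by
    intro i; simp [pathSet, hpp]
  have hon : (c k).run (ket (pathSet pw x (List.ofFn k))) = ∑ b : Bool,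
      nodeAmp τ rw ph x (List.ofFn k) b • ket (pathSet pw x (List.ofFn k ++ [b])) := by
    have hnot : ∀ b, ¬ List.ofFn k ++ [b] <+: List.ofFn k := by
      intro b h; have := h.length_le; simp at this
    rw [hr k _ ((hval x hx _ _ hy' hy').2 List.prefix_rfl)
      (hvalf x hx _ _ hy' (by simpa using hl) (hnot _))
      (hvalf x hx _ _ hy' (by simpa using hl) (hnot _))]
    simp only [hrwx, hphx, hupd, Fintype.sum_bool, nodeAmp, nodeVec]
    rw [add_comm]
  obtain ⟨l₁, l₂, hsplit⟩ := List.append_of_mem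
    (show k ∈ (Finset.univ : Finset (BitStr l)).toList by simp)
  have hnd := Finset.nodup_toList (Finset.univ : Finset (BitStr l))
  rw [hsplit] at hnd ⊢
  have hnd1 : ∀ k' ∈ l₁, k' ≠ k := by
    rintro k' hk' rfl
    exact (List.nodup_append.1 hnd).2.2 k' hk' k' (by simp) rfl
  have hnd2 : ∀ k' ∈ l₂, k' ≠ k := by
    rintro k' hk' rfl
    exact (List.nodup_cons.1 (List.nodup_append.1 hnd).2.1).1 hk'
  rw [List.foldl_append, foldl_run_of_fixed c l₁ _ fun k' hk' => hoff k' (hnd1 k' hk') _ (Or.inl rfl),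
    List.foldl_cons, hon]
  refine foldl_run_of_fixed c l₂ _ fun k' hk' => ?_
  simp only [Circuit.run_sum, Circuit.run_smul]
  refine Finset.sum_congr rfl fun b _ => ?_
  rw [hoff k' (hnd2 k' hk') _ (Or.inr ⟨b, rfl⟩)]

/-- The descent through the levels of the tree, from level `n - d` to the leaves and the flag. -/
theorem exists_descent
    (hpw : ∀ v w, v.length ≤ n + 1 → w.length ≤ n + 1 → pw v = pw w → v = w)
    (hrp : ∀ v w i, rw v i ≠ pw w) (hpp : ∀ v w i, ph v i ≠ pw w) (hrph : ∀ v w i j, rw v i ≠ ph w j)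
    (hrw : ∀ v w i j, v.length ≤ n → w.length ≤ n → rw v i = rw w j → v = w)
    (hph : ∀ v w i j, v.length ≤ n → w.length ≤ n → ph v i = ph w j → v = w)
    (d : ℕ) (hd : d ≤ n) :
    ∃ c : Circuit Q, c.depth ≤ (d + 1) * (6 * m + 8) ∧ ∀ x : Q → Bool, (∀ v, x (pw v) = false) →
      ∀ y : List Bool, y.length + d = n → c.run (ket (pathSet pw x y)) =
        ∑ k : BitStr d, ∑ s : Bool, amp d (fun l => nodeAmp τ rw ph x (y ++ l)) k s •
          ket (pathSet pw x (y ++ (List.ofFn k ++ [s]))) := by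
  induction d with
  | zero =>
    obtain ⟨c, hc, hr⟩ := exists_level τ pw rw ph hpw hrp hpp hrph hrw hph n le_rfl
    refine ⟨c, by omega, fun x hx y hy => ?_⟩
    rw [hr x hx y hy]
    simp [amp]
  | succ d ih =>
    obtain ⟨c₁, hc₁, hr₁⟩ := exists_level τ pw rw ph hpw hrp hpp hrph hrw hph (n - (d + 1))
      (by omega)
    obtain ⟨c₂, hc₂, hr₂⟩ := ih (by omega)
    refine ⟨c₁ ++ c₂, ?_, fun x hx y hy => ?_⟩
    · rw [Circuit.depth_append, add_mul (d + 1) 1]; omega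
    · rw [Circuit.run_append, hr₁ x hx y (by omega), Circuit.run_sum, sum_bitStr_succ]
      refine Finset.sum_congr rfl fun b _ => ?_
      rw [Circuit.run_smul, hr₂ x hx _ (by simp; omega), Finset.smul_sum]
      refine Finset.sum_congr rfl fun k _ => ?_
      rw [Finset.smul_sum]
      refine Finset.sum_congr rfl fun s _ => ?_
      rw [smul_smul]
      simp [amp, List.ofFn_succ]

end Levels

/-! ### State preparation with Boolean functions as angles -/

section Prepare

/-- The qubits of the state preparation circuit, up to the work qubits of Boolean formulas: besides
the registers and the memory, `m` bits for each of the two angles at every node of a tree of height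
`n`, and one bit for each node that marks the path to it (the leaves having two children, for the
two values of the flag). -/
inductive BW (n b m : ℕ) : Type
  | row (i : Fin n)
  | col (i : Fin n)
  | flag
  | mem (w : MemBit n b)
  | rot (v : BL n) (i : Fin m)
  | phase (v : BL n) (i : Fin m)
  | path (v : BL (n + 1))

/-- The qubits for angles and paths. -/
abbrev Extra (n m : ℕ) : Type := (BL n × Fin m) ⊕ ((BL n × Fin m) ⊕ BL (n + 1))

/-- The qubits `BW n b m` as a sum of types. -/
def bwEquiv (n b m : ℕ) :
    BW n b m ≃ Fin n ⊕ (Fin n ⊕ (Unit ⊕ (MemBit n b ⊕ Extra n m))) where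
  toFun
    | .row i => .inl i
    | .col i => .inr (.inl i)
    | .flag => .inr (.inr (.inl ()))
    | .mem w => .inr (.inr (.inr (.inl w)))
    | .rot v i => .inr (.inr (.inr (.inr (.inl (v, i)))))
    | .phase v i => .inr (.inr (.inr (.inr (.inr (.inl (v, i))))))
    | .path v => .inr (.inr (.inr (.inr (.inr (.inr v)))))
  invFun
    | .inl i => .row i
    | .inr (.inl i) => .col i
    | .inr (.inr (.inl ())) => .flag
    | .inr (.inr (.inr (.inl w))) => .mem w
    | .inr (.inr (.inr (.inr (.inl (v, i))))) => .rot v i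
    | .inr (.inr (.inr (.inr (.inr (.inl (v, i)))))) => .phase v i
    | .inr (.inr (.inr (.inr (.inr (.inr v))))) => .path v
  left_inv := by rintro (_ | _ | _ | _ | _ | _ | _) <;> rfl
  right_inv := by rintro (_ | _ | _ | _ | ⟨_, _⟩ | ⟨_, _⟩ | _) <;> rfl

instance (n b m : ℕ) : Fintype (BW n b m) := Fintype.ofEquiv _ (bwEquiv n b m).symm

noncomputable instance (n b m : ℕ) : DecidableEq (BW n b m) := Classical.decEq _

variable {n b m : ℕ}

/-- The assignment with the given contents of the registers. -/
def bst (J k : BitStr n) (s : Bool) (M : MemBit n b → Bool) (R P : BL n → Fin m → Bool)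
    (Y : BL (n + 1) → Bool) : BW n b m → Bool
  | .row i => J i
  | .col i => k i
  | .flag => s
  | .mem w => M w
  | .rot v i => R v i
  | .phase v i => P v i
  | .path v => Y v

theorem ofFn_snoc_eq (y : BitStr (n + 1)) :
    List.ofFn y = List.ofFn (fun i : Fin n => y i.castSucc) ++ [y (Fin.last n)] := by
  rw [List.ofFn_succ', List.concat_eq_append]

theorem amp_congr {d : ℕ} {u u' : List Bool → Bool → ℂ}
    (h : ∀ v, v.length ≤ d → u v = u' v) (k : BitStr d) (s : Bool) :
    amp d u k s = amp d u' k s := by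
  induction d generalizing u u' with
  | zero => simp [amp, h]
  | succ d ih =>
    simp only [amp]
    rw [h [] (by simp), ih fun v hv => h (k 0 :: v) (by simpa using hv)]

/-- State preparation for a given way of computing the bits of the angles at a node `v`: they are
functions of the six words of memory that belong to the row `J` and to the places `cells v`. The
angles are computed and the root is marked, the tree is descended, the leaf is read off, and the path
and the angles are cleared. -/
theorem exists_prepare (L : ℕ) (hL : Fintype.card (BW n b m) ≤ 2 ^ L) (τ : Fin m → ℝ)
    (cells : List Bool → Bool × Fin 3 → Cell n)
    (gr gp : List Bool → Fin m → ((Bool × Fin 3) × WordBit n b → Bool) → Bool) :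
    ∃ c : Circuit (BW n b m ⊕ Scr (BW n b m) L (1 + 2 * (6 * (n + 2 * b + 4)) + 2 * n)),
      c.depth ≤ 4 * (32 * L + 48 * (1 + 2 * (6 * (n + 2 * b + 4)) + 2 * n) + 40) +
        (n + 1) * (6 * m + 8) ∧
      ∀ (M : MemBit n b → Bool) (J : BitStr n),
        c.run (ketz (bst J (fun _ => false) false M (fun _ _ => false) (fun _ _ => false)
          fun _ => false)) =
        ∑ k : BitStr n, ∑ s : Bool, amp n (fun v => nodeVec
            (angleOf τ fun i => gr v i fun p => M (J, cells v p.1, p.2))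
            (angleOf τ fun i => gp v i fun p => M (J, cells v p.1, p.2))) k s •
          ketz (bst J k s M (fun _ _ => false) (fun _ _ => false) fun _ => false) := by
  classical
  set D := 1 + 2 * (6 * (n + 2 * b + 4)) + 2 * n with hD
  -- the Boolean functions that compute the bits of the angles
  have hw : Fintype.card ((Bool × Fin 3) × WordBit n b) = 6 * (n + 2 * b + 4) := by
    simp; ring
  have hcplx : ∀ (T : Set (BW n b m)) (_ : ∀ w, .mem w ∉ T) (_ : ∀ i, .row i ∉ T)
      (g : ((Bool × Fin 3) × WordBit n b → Bool) → Bool) (c : Bool × Fin 3 → Cell n), Cplx Tᶜ D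
        fun x => g fun p => x (.mem (fun i => x (.row i), c p.1, p.2)) := by
    intro T hm hr g c
    refine Cplx.muxFin (fun i => BW.row i) hr
      (fun J x => g fun p => x (.mem (J, c p.1, p.2))) fun J => ?_
    rw [← hw]
    exact Cplx.ofFintype (v := .mem (J, c (false, 0), .inl ())) (hm _)
      (fun p : (Bool × Fin 3) × WordBit n b => BW.mem (J, c p.1, p.2)) (fun p => hm _) g
  let fang : BW n b m → (BW n b m → Bool) → Bool := fun t x => match t with
    | .rot v i => gr v.1 i fun p => x (.mem (fun i => x (.row i), cells v.1 p.1, p.2))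
    | .phase v i => gp v.1 i fun p => x (.mem (fun i => x (.row i), cells v.1 p.1, p.2))
    | _ => true
  obtain ⟨c₁, hd₁, hr₁⟩ := exists_xor L D hL
    {t : BW n b m | match t with
      | .rot _ _ => True
      | .phase _ _ => True
      | .path v => v.1 = []
      | _ => False} fang (by
        rintro (_ | _ | _ | _ | _ | _ | _) ht
        · exact ht.elim
        · exact ht.elim
        · exact ht.elim
        · exact ht.elim
        · exact hcplx _ (by exact fun _ h => h) (by exact fun _ h => h) _ _
        · exact hcplx _ (by exact fun _ h => h) (by exact fun _ h => h) _ _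
        · refine (Cplx.const (v := .flag) (fun h => h) true).mono (d := 0 + 1) ?_
          omega)
  obtain ⟨c₅, hd₅, hr₅⟩ := exists_xor L D hL
    {t : BW n b m | match t with
      | .rot _ _ => True
      | .phase _ _ => True
      | _ => False} fang (by
        rintro (_ | _ | _ | _ | _ | _ | _) ht
        · exact ht.elim
        · exact ht.elim
        · exact ht.elim
        · exact ht.elim
        · exact hcplx _ (by exact fun _ h => h) (by exact fun _ h => h) _ _
        · exact hcplx _ (by exact fun _ h => h) (by exact fun _ h => h) _ _
        · exact ht.elim)
  -- the leaf is read off from the path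
  obtain ⟨c₃, hd₃, hr₃⟩ := exists_xor L D hL
    {t : BW n b m | match t with
      | .col _ => True
      | .flag => True
      | _ => False}
    (fun t x => match t with
      | .col i => decide (∃ y : BitStr (n + 1),
          (y i.castSucc && x (.path (mkBL _ (List.ofFn y)))) = true)
      | _ => decide (∃ y : BitStr (n + 1),
          (y (Fin.last n) && x (.path (mkBL _ (List.ofFn y)))) = true)) (by
        have h : ∀ (T : Set (BW n b m)) (_ : ∀ v, .path v ∉ T) (i : Fin (n + 1)), Cplx Tᶜ D
            fun x => decide (∃ y : BitStr (n + 1),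
              (y i && x (.path (mkBL _ (List.ofFn y)))) = true) := by
          intro T hT i
          refine (Cplx.exists (d := 1) (fun y x => (y i && x (BW.path (mkBL _ (List.ofFn y)))))
            fun y => ?_).mono (by omega : 1 + (n + 1) ≤ D)
          exact Cplx.op (fun a _ => y i && a) (Cplx.var (hT _)) (Cplx.var (hT (mkBL _ [])))
        rintro (_ | _ | _ | _ | _ | _ | _) ht
        · exact ht.elim
        · exact h _ (by exact fun _ h => h) _
        · exact h _ (by exact fun _ h => h) _
        all_goals exact ht.elim)
  -- the path is a function of the leaf
  obtain ⟨c₄, hd₄, hr₄⟩ := exists_xor L D hL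
    {t : BW n b m | match t with
      | .path _ => True
      | _ => False}
    (fun t x => match t with
      | .path v => decide (v.1 <+: List.ofFn (fun i => x (.col i)) ++ [x .flag])
      | _ => false) (by
        rintro (_ | _ | _ | _ | _ | _ | v) ht
        · exact ht.elim
        · exact ht.elim
        · exact ht.elim
        · exact ht.elim
        · exact ht.elim
        · exact ht.elim
        · refine (Cplx.ofFintype (v := BW.flag) (fun h => h)
            (fun i : Fin n ⊕ Unit => match i with
              | .inl i => BW.col i
              | .inr _ => BW.flag) (by rintro (i | i) <;> exact fun h => h)
            (fun y => decide (v.1 <+: List.ofFn (fun i => y (.inl i)) ++ [y (.inr ())]))).mono ?_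
          simp
          omega)
  let pw : List Bool → BW n b m ⊕ Scr (BW n b m) L D := fun l => .inl (.path (mkBL _ l))
  let rw' : List Bool → Fin m → BW n b m ⊕ Scr (BW n b m) L D := fun l i =>
    .inl (.rot (mkBL _ l) i)
  let ph : List Bool → Fin m → BW n b m ⊕ Scr (BW n b m) L D := fun l i =>
    .inl (.phase (mkBL _ l) i)
  obtain ⟨c₂, hd₂, hr₂⟩ := exists_descent (n := n) τ pw rw' ph
    (fun v w hv hw h => by
      simp only [pw, Sum.inl.injEq, BW.path.injEq] at h
      exact mkBL_inj hv hw h)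
    (fun _ _ _ h => by simp [pw, rw'] at h)
    (fun _ _ _ h => by simp [pw, ph] at h)
    (fun _ _ _ _ h => by simp [rw', ph] at h)
    (fun v w _ _ hv hw h => by
      simp only [rw', Sum.inl.injEq, BW.rot.injEq] at h
      exact mkBL_inj hv hw h.1)
    (fun v w _ _ hv hw h => by
      simp only [ph, Sum.inl.injEq, BW.phase.injEq] at h
      exact mkBL_inj hv hw h.1) n le_rfl
  refine ⟨c₁ ++ (c₂ ++ (c₃ ++ (c₄ ++ c₅))), ?_, fun M J => ?_⟩
  · simp only [Circuit.depth_append]; omega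
  · let R : BL n → Fin m → Bool := fun v i => gr v.1 i fun p => M (J, cells v.1 p.1, p.2)
    let P : BL n → Fin m → Bool := fun v i => gp v.1 i fun p => M (J, cells v.1 p.1, p.2)
    let X : BW n b m ⊕ Scr (BW n b m) L D → Bool :=
      Sum.elim (bst J (fun _ => false) false M R P fun _ => false) fun _ => false
    have hpath : ∀ y : List Bool, y.length ≤ n + 1 → ket (pathSet pw X y) =
        ketz (bst J (fun _ => false) false M R P fun v => decide (v.1 <+: y)) := by
      intro y hy
      unfold ketz
      congr 1
      ext ((_ | _ | _ | _ | _ | _ | v) | w)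
      all_goals try simp [pathSet, X, bst, pw]
      constructor
      · rintro ⟨l, hl, rfl⟩
        rwa [mkBL_val (hl.length_le.trans hy)]
      · intro h
        exact ⟨v.1, h, (mkBL_self v).symm⟩
    have s₁ : c₁.run (ketz (bst J (fun _ => false) false M (fun _ _ => false) (fun _ _ => false)
        fun _ => false)) = ket (pathSet pw X []) := by
      rw [hpath [] (by simp)]
      apply hr₁
      · rintro (_ | _ | _ | _ | _ | _ | v) ht
        · exact ht.elim
        · exact ht.elim
        · exact ht.elim
        · exact ht.elim
        · simp [bst, fang, R]
        · simp [bst, fang, P]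
        · have hv : v.1 = [] := ht
          simp [bst, fang, hv]
      · rintro (_ | _ | _ | _ | _ | _ | v) ht
        · rfl
        · rfl
        · rfl
        · rfl
        · exact absurd trivial ht
        · exact absurd trivial ht
        · have hv : v.1 ≠ [] := ht
          simp [bst, hv]
    rw [Circuit.run_append, s₁, Circuit.run_append, hr₂ X (fun v => rfl) [] (by simp),
      Circuit.run_sum]
    refine Finset.sum_congr rfl fun k _ => ?_
    rw [Circuit.run_sum]
    refine Finset.sum_congr rfl fun s _ => ?_
    rw [Circuit.run_smul]
    have hamp : amp n (fun l => nodeAmp τ rw' ph X ([] ++ l)) k s = amp n (fun v => nodeVec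
            (angleOf τ fun i => gr v i fun p => M (J, cells v p.1, p.2))
            (angleOf τ fun i => gp v i fun p => M (J, cells v p.1, p.2))) k s := by
      apply amp_congr
      intro v hv
      simp [nodeAmp, X, rw', ph, bst, R, P, mkBL_val hv]
    have hlen : (List.ofFn k ++ [s]).length ≤ n + 1 := by simp
    rw [hamp, List.nil_append, hpath _ hlen, Circuit.run_append, Circuit.run_append]
    have hsnoc : ∀ y : BitStr (n + 1), List.ofFn y <+: List.ofFn k ++ [s] ↔
        y = Fin.snoc k s := by
      intro y
      have e : List.ofFn k ++ [s] = List.ofFn (Fin.snoc k s : BitStr (n + 1)) := by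
        rw [ofFn_snoc_eq]; simp
      rw [e]
      exact ⟨fun h => List.ofFn_injective (h.eq_of_length (by simp)), fun h => by rw [h]⟩
    have s₃ : c₃.run (ketz (bst J (fun _ => false) false M R P
        fun v => decide (v.1 <+: List.ofFn k ++ [s]))) =
          ketz (bst J k s M R P fun v => decide (v.1 <+: List.ofFn k ++ [s])) := by
      have hex : ∀ i, decide (∃ y : BitStr (n + 1), (y i && (bst J (fun _ => false) false M R P
          fun v => decide (v.1 <+: List.ofFn k ++ [s])) (.path (mkBL _ (List.ofFn y)))) = true) =
            (Fin.snoc k s : BitStr (n + 1)) i := by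
        intro i
        rw [Bool.eq_iff_iff, decide_eq_true_iff]
        constructor
        · rintro ⟨y, hy⟩
          rw [Bool.and_eq_true] at hy
          have h2 : decide ((mkBL (n + 1) (List.ofFn y)).1 <+: List.ofFn k ++ [s]) = true := hy.2
          rw [decide_eq_true_iff, mkBL_val (by simp), hsnoc] at h2
          rw [← h2]
          exact hy.1
        · intro h
          refine ⟨Fin.snoc k s, ?_⟩
          rw [h, Bool.true_and]
          change decide ((mkBL (n + 1) (List.ofFn _)).1 <+: List.ofFn k ++ [s]) = true
          rw [decide_eq_true_iff, mkBL_val (by simp), hsnoc]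
      apply hr₃
      · rintro (_ | i | _ | _ | _ | _ | v) ht
        · exact ht.elim
        · exact (by simp : k i = (false ^^ (Fin.snoc k s : BitStr (n + 1)) i.castSucc)).trans
            (congrArg _ (hex _).symm)
        · exact (by simp : s = (false ^^ (Fin.snoc k s : BitStr (n + 1)) (Fin.last n))).trans
            (congrArg _ (hex _).symm)
        all_goals exact ht.elim
      · rintro (_ | _ | _ | _ | _ | _ | v) ht
        · rfl
        · exact absurd trivial ht
        · exact absurd trivial ht
        all_goals rfl
    have s₄ : c₄.run (ketz (bst J k s M R P fun v => decide (v.1 <+: List.ofFn k ++ [s]))) =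
        ketz (bst J k s M R P fun _ => false) := by
      apply hr₄
      · rintro (_ | _ | _ | _ | _ | _ | v) ht
        · exact ht.elim
        · exact ht.elim
        · exact ht.elim
        · exact ht.elim
        · exact ht.elim
        · exact ht.elim
        · exact (Bool.xor_self _).symm
      · rintro (_ | _ | _ | _ | _ | _ | v) ht
        all_goals first | rfl | exact absurd trivial ht
    have s₅ : c₅.run (ketz (bst J k s M R P fun _ => false)) =
        ketz (bst J k s M (fun _ _ => false) (fun _ _ => false) fun _ => false) := by
      apply hr₅
      · rintro (_ | _ | _ | _ | _ | _ | v) ht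
        · exact ht.elim
        · exact ht.elim
        · exact ht.elim
        · exact ht.elim
        · simp [bst, fang, R]
        · simp [bst, fang, P]
        · exact ht.elim
      · rintro (_ | _ | _ | _ | _ | _ | v) ht
        all_goals first | rfl | exact absurd trivial ht
    rw [s₃, s₄, s₅]

end Prepare

/-! ### Floating point numbers and rounded angles -/

section Words

/-- A real number with the given word: some number that is held in this word, and zero for the word
with all bits zero. -/
noncomputable def dec (n b : ℕ) (w : WordBit n b → Bool) : ℝ :=
  open Classical in
  if w = fun _ => false then 0 else if h : ∃ x, word n b x = w then h.choose else 0

/-- The real number that is read from the word holding `x`. -/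
noncomputable def stored (n b : ℕ) (x : ℝ) : ℝ := dec n b (word n b x)

/-- The exponent of `x` fits into the word. -/
def Fits (n b : ℕ) (x : ℝ) : Prop :=
  x ≠ 0 ∧ -2 ^ (n + b + 2) ≤ Int.log 2 |x| ∧ Int.log 2 |x| < 2 ^ (n + b + 2)

theorem word_of_not_fits {n b : ℕ} {x : ℝ} (h : ¬ Fits n b x) : word n b x = fun _ => false := by
  unfold word
  apply if_pos
  simp only [Fits, ne_eq, not_and_or, not_not, not_le, not_lt] at h
  exact h

theorem word_of_fits {n b : ℕ} {x : ℝ} (h : Fits n b x) :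
    word n b x = Sum.elim (fun _ : Unit => decide (x < 0))
      (Sum.elim
        (fun i : Fin b => Nat.testBit ⌊|x| * (2 : ℝ) ^ ((b : ℤ) - 1 - Int.log 2 |x|)⌋₊ i)
        (fun i : Fin (n + b + 3) => Nat.testBit (Int.log 2 |x| + 2 ^ (n + b + 2)).toNat i)) := by
  unfold word
  apply if_neg
  simp only [not_or, not_lt, not_le]
  exact h

/-- The scaled absolute value, whose integral part is the mantissa, is in `[2 ^ (b - 1), 2 ^ b)`. -/
theorem mantissa_bounds {x : ℝ} (hx : x ≠ 0) {b : ℕ} (hb : 1 ≤ b) :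
    (2 : ℝ) ^ (b - 1) ≤ |x| * (2 : ℝ) ^ ((b : ℤ) - 1 - Int.log 2 |x|) ∧
      |x| * (2 : ℝ) ^ ((b : ℤ) - 1 - Int.log 2 |x|) < 2 ^ b := by
  have h0 : 0 < |x| := abs_pos.2 hx
  have h1 := Int.zpow_log_le_self (b := 2) one_lt_two h0
  have h2 := Int.lt_zpow_succ_log_self (b := 2) one_lt_two |x|
  push_cast at h1 h2
  have h3 : (0 : ℝ) < (2 : ℝ) ^ ((b : ℤ) - 1 - Int.log 2 |x|) := by positivity
  constructor
  · calc (2 : ℝ) ^ (b - 1) = 2 ^ (Int.log 2 |x|) * (2 : ℝ) ^ ((b : ℤ) - 1 - Int.log 2 |x|) := by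
          rw [← zpow_add₀ two_ne_zero, ← zpow_natCast]; congr 1; omega
      _ ≤ _ := mul_le_mul_of_nonneg_right h1 h3.le
  · calc _ < 2 ^ (Int.log 2 |x| + 1) * (2 : ℝ) ^ ((b : ℤ) - 1 - Int.log 2 |x|) :=
          mul_lt_mul_of_pos_right h2 h3
      _ = 2 ^ b := by
          rw [← zpow_add₀ two_ne_zero, ← zpow_natCast]; congr 1; omega

theorem eq_of_testBit_fin {m k j : ℕ} (hk : k < 2 ^ m) (hj : j < 2 ^ m)
    (h : ∀ i : Fin m, k.testBit i = j.testBit i) : k = j := by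
  apply Nat.eq_of_testBit_eq
  intro i
  by_cases hi : i < m
  · exact h ⟨i, hi⟩
  · have h2 : 2 ^ m ≤ 2 ^ i := Nat.pow_le_pow_right (by norm_num) (by omega)
    rw [Nat.testBit_eq_false_of_lt (by omega), Nat.testBit_eq_false_of_lt (by omega)]

theorem word_ne_zero {n b : ℕ} (hb : 1 ≤ b) {x : ℝ} (h : Fits n b x) :
    word n b x ≠ fun _ => false := by
  intro hw
  rw [word_of_fits h] at hw
  obtain ⟨h1, h2⟩ := mantissa_bounds h.1 hb
  have h3 : 2 ^ (b - 1) ≤ ⌊|x| * (2 : ℝ) ^ ((b : ℤ) - 1 - Int.log 2 |x|)⌋₊ :=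
    Nat.le_floor (by exact_mod_cast h1)
  have h4 : ⌊|x| * (2 : ℝ) ^ ((b : ℤ) - 1 - Int.log 2 |x|)⌋₊ < 2 ^ b :=
    (Nat.floor_lt (by positivity)).2 (by exact_mod_cast h2)
  have h5 := eq_of_testBit_fin h4 (Nat.two_pow_pos b) (j := 0) fun i => by
    have := congrFun hw (.inr (.inl i))
    simpa using this
  have := Nat.two_pow_pos (b - 1)
  omega

/-- Numbers with the same word have the same sign, and differ by a relative error of at most
`2 ^ (1 - b)`. -/
theorem word_eq_imp_close {n b : ℕ} (hb : 1 ≤ b) {x y : ℝ} (hx : Fits n b x) (hy : Fits n b y)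
    (h : word n b x = word n b y) :
    (x < 0 ↔ y < 0) ∧ |x - y| ≤ 2 * ((2 : ℝ) ^ b)⁻¹ * |x| := by
  rw [word_of_fits hx, word_of_fits hy] at h
  have hs : x < 0 ↔ y < 0 := by
    have := congrFun h (.inl ())
    simpa using this
  obtain ⟨-, hx1, hx2⟩ := id hx
  obtain ⟨-, hy1, hy2⟩ := id hy
  have he : Int.log 2 |x| = Int.log 2 |y| := by
    have hlt : n + b + 2 < n + b + 3 := by omega
    have hp : (2 : ℤ) ^ (n + b + 3) = 2 * 2 ^ (n + b + 2) := by ring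
    have hpn : (2 : ℕ) ^ (n + b + 3) = 2 * 2 ^ (n + b + 2) := by ring
    have hc : ((2 ^ (n + b + 2) : ℕ) : ℤ) = 2 ^ (n + b + 2) := by push_cast; rfl
    have := eq_of_testBit_fin (m := n + b + 3) (k := (Int.log 2 |x| + 2 ^ (n + b + 2)).toNat)
      (j := (Int.log 2 |y| + 2 ^ (n + b + 2)).toNat) (by omega) (by omega) fun i => by
        have := congrFun h (.inr (.inr i))
        simpa using this
    omega
  obtain ⟨h1, h2⟩ := mantissa_bounds hx.1 hb
  obtain ⟨k1, k2⟩ := mantissa_bounds hy.1 hb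
  have hm : ⌊|x| * (2 : ℝ) ^ ((b : ℤ) - 1 - Int.log 2 |x|)⌋₊ =
      ⌊|y| * (2 : ℝ) ^ ((b : ℤ) - 1 - Int.log 2 |y|)⌋₊ :=
    eq_of_testBit_fin (m := b) ((Nat.floor_lt (by positivity)).2 (by exact_mod_cast h2))
      ((Nat.floor_lt (by positivity)).2 (by exact_mod_cast k2)) fun i =>
        congrFun h (.inr (.inl i))
  refine ⟨hs, ?_⟩
  rw [he] at hm h1 h2
  set c : ℝ := (2 : ℝ) ^ ((b : ℤ) - 1 - Int.log 2 |y|) with hc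
  have hcpos : 0 < c := by positivity
  have f1 := Nat.floor_le (a := |x| * c) (by positivity)
  have f2 := Nat.lt_floor_add_one (|x| * c)
  have f3 := Nat.floor_le (a := |y| * c) (by positivity)
  have f4 := Nat.lt_floor_add_one (|y| * c)
  rw [hm] at f1 f2
  have habs : |(|x| - |y|)| * c ≤ 1 := by
    rw [← abs_of_pos hcpos, ← abs_mul, sub_mul, abs_le]
    constructor <;> linarith
  have hxy : |x - y| = |(|x| - |y|)| := by
    rcases lt_or_ge x 0 with hx0 | hx0
    · have hy0 := hs.1 hx0
      rw [abs_of_neg hx0, abs_of_neg hy0, abs_sub_comm]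
      congr 1; ring
    · have hy0 : 0 ≤ y := not_lt.1 fun h => absurd (hs.2 h) (not_lt.2 hx0)
      rw [abs_of_nonneg hx0, abs_of_nonneg hy0]
  rw [hxy]
  have hb2 : (2 : ℝ) ^ b = 2 * 2 ^ (b - 1) := by
    rw [← pow_succ']; congr 1; omega
  have hpos : (0 : ℝ) < 2 ^ (b - 1) := by positivity
  rw [hb2, mul_inv, ← mul_assoc, mul_inv_cancel₀ two_ne_zero, one_mul]
  rw [← mul_le_mul_iff_left₀ hcpos]
  refine habs.trans ?_
  rw [mul_assoc, inv_mul_eq_div, le_div_iff₀ hpos, one_mul]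
  exact h1

theorem stored_zero (n b : ℕ) : stored n b 0 = 0 := by
  rw [stored, word_of_not_fits (by simp [Fits]), dec, if_pos rfl]

theorem stored_of_fits {n b : ℕ} (hb : 1 ≤ b) {x : ℝ} (h : Fits n b x) :
    (x < 0 ↔ stored n b x < 0) ∧ |x - stored n b x| ≤ 2 * ((2 : ℝ) ^ b)⁻¹ * |x| := by
  have hex : ∃ y, word n b y = word n b x := ⟨x, rfl⟩
  have hs : stored n b x = hex.choose := by
    rw [stored, dec, if_neg (word_ne_zero hb h), dif_pos hex]
  rw [hs]
  refine word_eq_imp_close hb h ?_ hex.choose_spec.symm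
  by_contra hn
  have := word_of_not_fits hn
  rw [hex.choose_spec] at this
  exact word_ne_zero hb h this

theorem stored_ne_zero {n b : ℕ} (hb : 1 ≤ b) {x : ℝ} (h : Fits n b x) : stored n b x ≠ 0 := by
  have hex : ∃ y, word n b y = word n b x := ⟨x, rfl⟩
  have hs : stored n b x = hex.choose := by
    rw [stored, dec, if_neg (word_ne_zero hb h), dif_pos hex]
  rw [hs]
  intro h0
  have := hex.choose_spec
  rw [h0, word_of_not_fits (by simp [Fits])] at this
  exact word_ne_zero hb h this.symm

theorem fits_iff {n b : ℕ} {x : ℝ} : Fits n b x ↔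
    (2 : ℝ) ^ (-2 ^ (n + b + 2) : ℤ) ≤ |x| ∧ |x| < (2 : ℝ) ^ (2 ^ (n + b + 2) : ℤ) := by
  have hpos : (0 : ℝ) < (2 : ℝ) ^ (-2 ^ (n + b + 2) : ℤ) := by positivity
  by_cases hx : x = 0
  · subst hx
    simp [Fits]
  · have h0 : 0 < |x| := abs_pos.2 hx
    have h1 := Int.zpow_le_iff_le_log (b := 2) one_lt_two (x := -2 ^ (n + b + 2)) h0
    have h2 := Int.lt_zpow_iff_log_lt (b := 2) one_lt_two (x := 2 ^ (n + b + 2)) h0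
    push_cast at h1 h2
    rw [Fits, h1, h2]
    simp [hx]

/-- Reading a number that is not too large: a relative error of `2 ^ (1 - b)`, and an absolute error
that comes from numbers held as zero. -/
theorem abs_sub_stored_le {n b : ℕ} (hb : 1 ≤ b) {x : ℝ}
    (hx : |x| < (2 : ℝ) ^ (2 ^ (n + b + 2) : ℤ)) :
    |x - stored n b x| ≤ 2 * ((2 : ℝ) ^ b)⁻¹ * |x| + (2 : ℝ) ^ (-2 ^ (n + b + 2) : ℤ) := by
  by_cases h : Fits n b x
  · exact (stored_of_fits hb h).2.trans (le_add_of_nonneg_right (by positivity))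
  · rw [stored, word_of_not_fits h, dec, if_pos rfl, sub_zero]
    rw [fits_iff, not_and_or, not_le] at h
    rcases h with h | h
    · exact h.le.trans (le_add_of_nonneg_left (by positivity))
    · exact absurd hx h

theorem stored_nonneg {n b : ℕ} (hb : 1 ≤ b) {x : ℝ} (hx : 0 ≤ x) : 0 ≤ stored n b x := by
  by_cases h : Fits n b x
  · exact not_lt.1 fun h' => absurd ((stored_of_fits hb h).1.2 h') (not_lt.2 hx)
  · rw [stored, word_of_not_fits h, dec, if_pos rfl]

/-- A number in range, or more generally zero or of an exponent that fits, is read without underflow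
and with its sign. -/
theorem stored_of_zero_or_fits {n b : ℕ} (hb : 1 ≤ b) {x : ℝ} (h : x = 0 ∨ Fits n b x) :
    (x < 0 ↔ stored n b x < 0) ∧ (x = 0 ↔ stored n b x = 0) ∧
      |x - stored n b x| ≤ 2 * ((2 : ℝ) ^ b)⁻¹ * |x| := by
  rcases h with rfl | h
  · simp [stored_zero]
  · obtain ⟨h1, h2⟩ := stored_of_fits hb h
    exact ⟨h1, iff_of_false h.1 (stored_ne_zero hb h), h2⟩

end Words

section Angles

/-- The binary digits of an angle, with `b` digits after the point. -/
noncomputable def angleBit (b : ℕ) (θ : ℝ) (i : ℕ) : Bool := ⌊θ * 2 ^ b⌋₊.testBit i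

/-- The angle rounded down to `b` binary digits after the point. -/
noncomputable def quant (b : ℕ) (θ : ℝ) : ℝ := ⌊θ * 2 ^ b⌋₊ / 2 ^ b

theorem sum_testBit (m k : ℕ) (hk : k < 2 ^ m) :
    ∑ i : Fin m, (if k.testBit i then (2 : ℝ) ^ (i : ℕ) else 0) = k := by
  induction m generalizing k with
  | zero => simp at hk; simp [hk]
  | succ m ih =>
    rw [Fin.sum_univ_succ]
    have h := ih (k / 2) (by rw [pow_succ] at hk; omega)
    simp only [Fin.val_succ, Nat.testBit_succ, Fin.val_zero, pow_zero]
    have h2 : ∀ i : Fin m, (if (k / 2).testBit i then (2 : ℝ) ^ ((i : ℕ) + 1) else 0) =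
        2 * (if (k / 2).testBit i then (2 : ℝ) ^ (i : ℕ) else 0) := by
      intro i; split_ifs <;> ring
    rw [Finset.sum_congr rfl fun i _ => h2 i, ← Finset.mul_sum, h, Nat.testBit_zero]
    have h3 : k = 2 * (k / 2) + k % 2 := by omega
    rcases Nat.mod_two_eq_zero_or_one k with h4 | h4
    · rw [h4] at h3 ⊢
      simp only [zero_ne_one, decide_false, Bool.false_eq_true, if_false]
      rw [zero_add]
      exact_mod_cast h3.symm
    · rw [h4] at h3 ⊢
      simp only [decide_true, if_true]
      rw [add_comm]
      exact_mod_cast h3.symm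

theorem angleOf_angleBit (b : ℕ) {θ : ℝ} (h8 : θ < 8) :
    angleOf (m := b + 3) (fun i => 2 ^ (i : ℕ) / 2 ^ b) (fun i => angleBit b θ i) = quant b θ := by
  have hlt : ⌊θ * 2 ^ b⌋₊ < 2 ^ (b + 3) := by
    rw [Nat.floor_lt' (by positivity)]
    push_cast
    rw [pow_add, mul_comm]
    gcongr
    norm_num
    exact h8
  rw [quant, ← sum_testBit (b + 3) _ hlt, Finset.sum_div, angleOf]
  refine Finset.sum_congr rfl fun i _ => ?_
  unfold angleBit
  split_ifs <;> simp

theorem abs_sub_quant_le (b : ℕ) {θ : ℝ} (h0 : 0 ≤ θ) : |θ - quant b θ| ≤ ((2 : ℝ) ^ b)⁻¹ := by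
  have hp : (0 : ℝ) < 2 ^ b := by positivity
  have h1 := Nat.floor_le (a := θ * 2 ^ b) (by positivity)
  have h2 := Nat.lt_floor_add_one (θ * 2 ^ b)
  have h3 : θ - quant b θ = (θ * 2 ^ b - ⌊θ * 2 ^ b⌋₊) / 2 ^ b := by
    rw [quant, sub_div, mul_div_cancel_right₀ _ hp.ne']
  rw [h3, abs_div, abs_of_pos hp, div_le_iff₀ hp, inv_mul_cancel₀ hp.ne', abs_le]
  constructor <;> linarith

theorem norm_exp_sub_exp_le (φ ψ : ℝ) :
    ‖Complex.exp (φ * Complex.I) - Complex.exp (ψ * Complex.I)‖ ≤ |φ - ψ| := by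
  have h : Complex.exp (φ * Complex.I) - Complex.exp (ψ * Complex.I) =
      Complex.exp (ψ * Complex.I) * (Complex.exp (Complex.I * ((φ - ψ : ℝ) : ℂ)) - 1) := by
    rw [mul_sub, ← Complex.exp_add, mul_one]
    congr 2
    push_cast
    ring
  rw [h, norm_mul, Complex.norm_exp_ofReal_mul_I, one_mul]
  exact Real.norm_exp_I_mul_ofReal_sub_one_le

/-- The proportion of the weight `W₀` in `W₀ + W₁`, and `q` if both are zero. -/
noncomputable def ratio (q W₀ W₁ : ℝ) : ℝ := if W₀ + W₁ = 0 then q else W₀ / (W₀ + W₁)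

/-- The angle of the rotation that shares an amplitude in the proportion `W₀` to `W₁` of the squared
absolute values. -/
noncomputable def ang (q W₀ W₁ : ℝ) : ℝ := Real.arccos √(ratio q W₀ W₁)

theorem ratio_mem {q W₀ W₁ : ℝ} (hq : 0 ≤ q ∧ q ≤ 1) (h₀ : 0 ≤ W₀) (h₁ : 0 ≤ W₁) :
    0 ≤ ratio q W₀ W₁ ∧ ratio q W₀ W₁ ≤ 1 := by
  unfold ratio
  split_ifs with h
  · exact hq
  · exact ⟨by positivity, div_le_one_of_le₀ (by linarith) (by linarith)⟩

theorem cos_ang {q W₀ W₁ : ℝ} (hq : 0 ≤ q ∧ q ≤ 1) (h₀ : 0 ≤ W₀) (h₁ : 0 ≤ W₁) :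
    Real.cos (ang q W₀ W₁) = √(ratio q W₀ W₁) := by
  obtain ⟨h, h'⟩ := ratio_mem hq h₀ h₁
  exact Real.cos_arccos (by linarith [Real.sqrt_nonneg (ratio q W₀ W₁)]) (Real.sqrt_le_one.2 h')

theorem sin_ang {q W₀ W₁ : ℝ} (hq : 0 ≤ q ∧ q ≤ 1) (h₀ : 0 ≤ W₀) (h₁ : 0 ≤ W₁) :
    Real.sin (ang q W₀ W₁) = √(1 - ratio q W₀ W₁) := by
  obtain ⟨h, h'⟩ := ratio_mem hq h₀ h₁
  rw [ang, Real.sin_arccos, Real.sq_sqrt h]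

theorem sqrt_mul_cos_ang {q W₀ W₁ : ℝ} (hq : 0 ≤ q ∧ q ≤ 1) (h₀ : 0 ≤ W₀) (h₁ : 0 ≤ W₁) :
    √(W₀ + W₁) * Real.cos (ang q W₀ W₁) = √W₀ := by
  rw [cos_ang hq h₀ h₁, ← Real.sqrt_mul (by positivity), ratio]
  split_ifs with h
  · rw [h, show W₀ = 0 by linarith, zero_mul]
  · rw [mul_div_cancel₀ _ h]

theorem sqrt_mul_sin_ang {q W₀ W₁ : ℝ} (hq : 0 ≤ q ∧ q ≤ 1) (h₀ : 0 ≤ W₀) (h₁ : 0 ≤ W₁) :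
    √(W₀ + W₁) * Real.sin (ang q W₀ W₁) = √W₁ := by
  rw [sin_ang hq h₀ h₁, ← Real.sqrt_mul (by positivity), ratio]
  split_ifs with h
  · rw [h, show W₁ = 0 by linarith, zero_mul]
  · congr 1; field_simp; ring

theorem abs_sqrt_sub_sqrt_le {W W' c ε : ℝ} (hW : 0 ≤ W) (hW' : 0 ≤ W') (hc : 0 ≤ c) (hε : 0 ≤ ε)
    (h : |W - W'| ≤ c * W + ε) : |√W - √W'| ≤ c * √W + √ε := by
  by_contra hn
  rw [not_le] at hn
  have h1 : |√W - √W'| * (√W + √W') = |W - W'| := by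
    rw [← abs_of_nonneg (by positivity : 0 ≤ √W + √W'), ← abs_mul]
    congr 1
    nlinarith [Real.sq_sqrt hW, Real.sq_sqrt hW']
  have h2 : |√W - √W'| ≤ √W + √W' :=
    abs_le.2 ⟨by linarith [Real.sqrt_nonneg W, Real.sqrt_nonneg W'],
      by linarith [Real.sqrt_nonneg W, Real.sqrt_nonneg W']⟩
  have h3 := Real.sqrt_nonneg W
  have h4 := Real.sqrt_nonneg W'
  have h5 := Real.sqrt_nonneg ε
  have h6 := Real.sq_sqrt hW
  have h7 := Real.sq_sqrt hε
  have h8 : 0 < √W + √W' := by nlinarith [mul_nonneg hc h3]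
  have h9 : (c * √W + √ε) * (√W + √W') < |√W - √W'| * (√W + √W') :=
    mul_lt_mul_of_pos_right hn h8
  have h10 : √ε ≤ √W + √W' := by nlinarith [mul_nonneg hc h3]
  nlinarith [mul_nonneg hc (mul_nonneg h3 h4), mul_le_mul_of_nonneg_left h10 h5]

/-- Weights with a small error give an angle with a small error. -/
theorem abs_cos_ang_sub_le {q W₀ W₁ W₀' W₁' δ ε : ℝ} (hq : 0 ≤ q ∧ q ≤ 1) (h₀ : 0 ≤ W₀)
    (h₁ : 0 ≤ W₁) (h₀' : 0 ≤ W₀') (h₁' : 0 ≤ W₁') (hδ : 0 ≤ δ) (hε : 0 ≤ ε)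
    (hpos : 0 < W₀ + W₁) (hsmall : ε ≤ δ ^ 2 * (W₀ + W₁))
    (e₀ : |W₀ - W₀'| ≤ 2 * δ * W₀ + ε) (e₁ : |W₁ - W₁'| ≤ 2 * δ * W₁ + ε) :
    |Real.cos (ang q W₀ W₁) - Real.cos (ang q W₀' W₁')| ≤ 7 * δ ∧
      |Real.sin (ang q W₀ W₁) - Real.sin (ang q W₀' W₁')| ≤ 7 * δ := by
  set S := W₀ + W₁ with hS
  set S' := W₀' + W₁' with hS'
  have hS'0 : 0 ≤ S' := by positivity
  have hR : 0 < √S := Real.sqrt_pos.2 hpos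
  have hsε : √ε ≤ δ * √S := by
    rw [← Real.sqrt_sq hδ, ← Real.sqrt_mul (sq_nonneg δ)]
    exact Real.sqrt_le_sqrt hsmall
  have hs4ε : √(2 * ε) ≤ 2 * (δ * √S) := by
    rw [Real.sqrt_mul (by norm_num)]
    have h2 : √2 ≤ 2 := by rw [Real.sqrt_le_left (by norm_num)]; norm_num
    exact mul_le_mul h2 hsε (Real.sqrt_nonneg _) (by norm_num)
  have hSS : |√S - √S'| ≤ 4 * δ * √S := by
    have := abs_sqrt_sub_sqrt_le hpos.le hS'0 (by positivity : 0 ≤ 2 * δ)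
      (by positivity : 0 ≤ 2 * ε) (by
        have h1 : S - S' = (W₀ - W₀') + (W₁ - W₁') := by rw [hS, hS']; ring
        rw [h1]
        refine (abs_add_le _ _).trans ?_
        rw [hS]; linarith)
    linarith
  have key : ∀ W W' : ℝ, 0 ≤ W → 0 ≤ W' → W ≤ S → W' ≤ S' → S' ≠ 0 →
      |W - W'| ≤ 2 * δ * W + ε → |√(W / S) - √(W' / S')| ≤ 7 * δ := by
    intro W W' hW hW' hWS hWS' hne e
    have hR' : 0 < √S' := Real.sqrt_pos.2 (lt_of_le_of_ne hS'0 (Ne.symm hne))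
    have h1 := abs_sqrt_sub_sqrt_le hW hW' (by positivity : 0 ≤ 2 * δ) hε e
    have h2 : √W ≤ √S := Real.sqrt_le_sqrt hWS
    have h3 : |√W - √W'| ≤ 3 * δ * √S := by nlinarith
    rw [Real.sqrt_div hW, Real.sqrt_div hW']
    have h4 : √W' / √S' ≤ 1 := div_le_one_of_le₀ (Real.sqrt_le_sqrt hWS') hR'.le
    have h5 : √W / √S - √W' / √S' = (√W - √W') / √S + √W' / √S' * ((√S' - √S) / √S) := by
      field_simp; ring
    rw [h5]
    refine (abs_add_le _ _).trans ?_
    rw [abs_mul, abs_div, abs_div (√S' - √S), abs_of_pos hR, abs_of_nonneg (by positivity :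
      0 ≤ √W' / √S'), abs_sub_comm (√S')]
    have h6 : |√W - √W'| / √S ≤ 3 * δ := (div_le_iff₀ hR).2 h3
    have h7 : |√S - √S'| / √S ≤ 4 * δ := (div_le_iff₀ hR).2 hSS
    have h8 : √W' / √S' * (|√S - √S'| / √S) ≤ 1 * (4 * δ) :=
      mul_le_mul h4 h7 (by positivity) (by norm_num)
    linarith
  rw [cos_ang hq h₀ h₁, cos_ang hq h₀' h₁', sin_ang hq h₀ h₁, sin_ang hq h₀' h₁']
  by_cases hz : S' = 0
  · have h1 : 1 ≤ 4 * δ := by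
      rw [hz, Real.sqrt_zero, sub_zero, abs_of_pos hR] at hSS
      nlinarith
    have h2 : ∀ x y : ℝ, x ≤ 1 → y ≤ 1 → |√x - √y| ≤ 7 * δ := by
      intro x y hx hy
      have := Real.sqrt_nonneg x
      have := Real.sqrt_nonneg y
      have := Real.sqrt_le_one.2 hx
      have := Real.sqrt_le_one.2 hy
      rw [abs_le]; constructor <;> linarith
    obtain ⟨r1, r2⟩ := ratio_mem hq h₀ h₁
    obtain ⟨r3, r4⟩ := ratio_mem hq h₀' h₁'
    exact ⟨h2 _ _ r2 r4, h2 _ _ (by linarith) (by linarith)⟩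
  · have hr : ratio q W₀ W₁ = W₀ / S := if_neg hpos.ne'
    have hr' : ratio q W₀' W₁' = W₀' / S' := if_neg hz
    have hr1 : 1 - W₀ / S = W₁ / S := by
      rw [eq_div_iff hpos.ne', sub_mul, div_mul_cancel₀ _ hpos.ne', hS]; ring
    have hr1' : 1 - W₀' / S' = W₁' / S' := by
      rw [eq_div_iff hz, sub_mul, div_mul_cancel₀ _ hz, hS']; ring
    rw [hr, hr', hr1, hr1']
    exact ⟨key _ _ h₀ h₀' (by linarith) (by linarith) hz e₀,
      key _ _ h₁ h₁' (by linarith) (by linarith) hz e₁⟩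

/-- Halving the argument of a nonzero complex number is continuous as long as the imaginary part
does not change its sign. -/
theorem norm_half_phase_sub_le {z z' : ℂ} (hz : z ≠ 0) (hz' : z' ≠ 0) (hs : z.im < 0 ↔ z'.im < 0) :
    ‖Complex.exp ((-(z.arg / 2) : ℝ) * Complex.I) - Complex.exp ((-(z'.arg / 2) : ℝ) * Complex.I)‖ ≤
      2 * ‖z - z'‖ / ‖z‖ := by
  set p := Complex.exp ((-(z.arg / 2) : ℝ) * Complex.I) with hp
  set p' := Complex.exp ((-(z'.arg / 2) : ℝ) * Complex.I) with hp'
  have hn : 0 < ‖z‖ := norm_pos_iff.2 hz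
  have hn' : 0 < ‖z'‖ := norm_pos_iff.2 hz'
  have hsq : ∀ w : ℂ, w ≠ 0 → Complex.exp ((-(w.arg / 2) : ℝ) * Complex.I) ^ 2 =
      star (w / ‖w‖) := by
    intro w hw
    have hw' : (‖w‖ : ℂ) ≠ 0 := by simpa using hw
    have h1 : w / ‖w‖ = Complex.exp (w.arg * Complex.I) := by
      rw [div_eq_iff hw', mul_comm, Complex.norm_mul_exp_arg_mul_I]
    rw [h1, Complex.star_def, ← Complex.exp_conj, ← Complex.exp_nat_mul]
    congr 1
    simp
    ring
  have hmul : ‖p - p'‖ * ‖p + p'‖ = ‖z / ‖z‖ - z' / ‖z'‖‖ := by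
    rw [← norm_mul, ← norm_star (z / ‖z‖ - z' / ‖z'‖), star_sub, ← hsq z hz, ← hsq z' hz']
    congr 1
    ring
  have hle : ‖z / ‖z‖ - z' / ‖z'‖‖ ≤ 2 * ‖z - z'‖ / ‖z‖ := by
    have h1 : z / ‖z‖ - z' / ‖z'‖ = (z - z') / ‖z‖ + z' / ‖z'‖ * ((‖z'‖ - ‖z‖ : ℝ) / ‖z‖) := by
      have a1 : (‖z‖ : ℂ) ≠ 0 := by simpa using hz
      have a2 : (‖z'‖ : ℂ) ≠ 0 := by simpa using hz'
      push_cast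
      field_simp
      ring
    rw [h1]
    refine (norm_add_le _ _).trans ?_
    rw [norm_mul, norm_div, norm_div, norm_div, Complex.norm_real, Complex.norm_real,
      Complex.norm_real, norm_norm, norm_norm, div_self hn'.ne', one_mul, ← add_div]
    gcongr
    have := abs_norm_sub_norm_le z' z
    rw [Real.norm_eq_abs, norm_sub_rev z z']
    linarith [norm_sub_rev z z']
  have hge : 1 ≤ ‖p + p'‖ := by
    have harg : |z.arg - z'.arg| ≤ Real.pi := by
      have hπ := Real.pi_pos
      have a1 := Complex.arg_le_pi z
      have a2 := Complex.neg_pi_lt_arg z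
      have a3 := Complex.arg_le_pi z'
      have a4 := Complex.neg_pi_lt_arg z'
      by_cases h : z.im < 0
      · have b1 := Complex.arg_neg_iff.2 h
        have b2 := Complex.arg_neg_iff.2 (hs.1 h)
        rw [abs_le]; constructor <;> linarith
      · have b1 := Complex.arg_nonneg_iff.2 (not_lt.1 h)
        have b2 := Complex.arg_nonneg_iff.2 (not_lt.1 fun h' => h (hs.2 h'))
        rw [abs_le]; constructor <;> linarith
    have hcos : 0 ≤ Real.cos ((z.arg - z'.arg) / 2) := by
      have := abs_le.1 harg
      exact Real.cos_nonneg_of_mem_Icc ⟨by linarith, by linarith⟩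
    have h2 : ‖p + p'‖ ^ 2 = 2 + 2 * Real.cos ((z.arg - z'.arg) / 2) := by
      rw [← Complex.normSq_eq_norm_sq, Complex.normSq_apply, hp, hp', Complex.add_re,
        Complex.add_im, Complex.exp_ofReal_mul_I_re, Complex.exp_ofReal_mul_I_re,
        Complex.exp_ofReal_mul_I_im, Complex.exp_ofReal_mul_I_im, sub_div, Real.cos_sub]
      simp only [Real.cos_neg, Real.sin_neg]
      nlinarith [Real.sin_sq_add_cos_sq (z.arg / 2), Real.sin_sq_add_cos_sq (z'.arg / 2)]
    nlinarith [norm_nonneg (p + p')]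
  calc ‖p - p'‖ = ‖p - p'‖ * 1 := (mul_one _).symm
    _ ≤ ‖p - p'‖ * ‖p + p'‖ := mul_le_mul_of_nonneg_left hge (norm_nonneg _)
    _ ≤ _ := hmul.trans_le hle

end Angles

/-! ### Amplitudes of a tree -/

section Trees

/-- The place in a tree of height `d + 1` that is the place `c` of its left or right subtree. -/
def subCell {d : ℕ} (β : Bool) (c : Cell d) : Cell (d + 1) :=
  Sum.inr (cond β (Sum.inr c) (Sum.inl c))

/-- The places at the root of a tree: three in a leaf, two (the first one occurring twice) in an
inner node. -/
def headCell : (d : ℕ) → Fin 3 → Cell d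
  | 0, j => j
  | _ + 1, j => Sum.inl (if j = 1 then 1 else 0)

/-- The places that determine the angles at the node with address `v`: those of its two children,
or those of the node itself if it is a leaf. -/
def cellsAt : (d : ℕ) → List Bool → Bool × Fin 3 → Cell d
  | 0, _, p => headCell 0 p.2
  | d + 1, [], p => subCell p.1 (headCell d p.2)
  | d + 1, γ :: v, p => subCell γ (cellsAt d v p)

/-- The total weight of a tree of height `d` whose root holds `r`. -/
noncomputable def headWeight : ℕ → (Fin 3 → ℝ) → ℝ
  | 0, r => √(r 0 ^ 2 + r 1 ^ 2) + r 2
  | _ + 1, r => r 0 + r 1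

/-- The rotation angle at a node of height `d`, where `r` is read at the places `cellsAt`. The
amplitude is shared equally if both weights are zero, and goes to the flag `1` at a leaf of weight
zero. -/
noncomputable def rotAngle : ℕ → (Bool → Fin 3 → ℝ) → ℝ
  | 0, r => ang 0 √(r false 0 ^ 2 + r false 1 ^ 2) (r false 2)
  | d + 1, r => ang (1 / 2) (headWeight d (r false)) (headWeight d (r true))

/-- The phase at a node, which is minus half the argument of `z` at a leaf holding `star z`, made
positive by adding `2 π`. -/
noncomputable def phaseAngle : ℕ → (Bool → Fin 3 → ℝ) → ℝ
  | 0, r => 2 * Real.pi - (⟨r false 0, -r false 1⟩ : ℂ).arg / 2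
  | _ + 1, _ => 0

/-- The numbers read at the node with address `v` from the contents `τ` of a tree. -/
def reads (d : ℕ) (τ : Cell d → ℝ) (v : List Bool) (β : Bool) (j : Fin 3) : ℝ :=
  τ (cellsAt d v (β, j))

/-- The amplitudes at the node with address `v`, with the angles rounded by `ρ`. -/
noncomputable def treeVec (ρ : ℝ → ℝ) (d : ℕ) (τ : Cell d → ℝ) (v : List Bool) : Bool → ℂ :=
  nodeVec (ρ (rotAngle (d - v.length) (reads d τ v))) (ρ (phaseAngle (d - v.length) (reads d τ v)))

theorem treeVec_cons (ρ : ℝ → ℝ) (d : ℕ) (τ : Cell (d + 1) → ℝ) (γ : Bool) (v : List Bool) :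
    treeVec ρ (d + 1) τ (γ :: v) = treeVec ρ d (fun c => τ (subCell γ c)) v := by
  simp only [treeVec, List.length_cons, Nat.add_sub_add_right]
  rfl

/-- The leaves of the left or right subtree. -/
def subLeaves {d : ℕ} (f : BitStr (d + 1) → ℂ × ℝ) (γ : Bool) : BitStr d → ℂ × ℝ :=
  fun y => f (Fin.cons γ y)

theorem entry_build_subCell {d : ℕ} (f : BitStr (d + 1) → ℂ × ℝ) (γ : Bool) :
    (fun c => (RowTree.build (d + 1) f).entry (subCell γ c)) =
      (RowTree.build d (subLeaves f γ)).entry := by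
  cases γ <;> rfl

/-- The numbers at the root of a tree. -/
def heads {d : ℕ} (T : RowTree d) (j : Fin 3) : ℝ := T.entry (headCell d j)

theorem reads_nil_succ {d : ℕ} (f : BitStr (d + 1) → ℂ × ℝ) (β : Bool) :
    reads (d + 1) (RowTree.build (d + 1) f).entry [] β = heads (RowTree.build d (subLeaves f β)) := by
  funext j
  exact congrFun (entry_build_subCell f β) (headCell d j)

theorem heads_zero (f : BitStr 0 → ℂ × ℝ) :
    heads (RowTree.build 0 f) 0 = (f Fin.elim0).1.re ∧
    heads (RowTree.build 0 f) 1 = (f Fin.elim0).1.im ∧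
    heads (RowTree.build 0 f) 2 = (f Fin.elim0).2 := ⟨rfl, rfl, rfl⟩

theorem heads_succ {d : ℕ} (f : BitStr (d + 1) → ℂ × ℝ) :
    heads (RowTree.build (d + 1) f) 0 = (RowTree.build (d + 1) f).weight.1 ∧
    heads (RowTree.build (d + 1) f) 1 = (RowTree.build (d + 1) f).weight.2 := ⟨rfl, rfl⟩

theorem norm_eq_sqrt (z : ℂ) : ‖z‖ = √(z.re ^ 2 + z.im ^ 2) := by
  rw [← Real.sqrt_sq (norm_nonneg z), ← Complex.normSq_eq_norm_sq, Complex.normSq_apply]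
  congr 1; ring

/-- The weights at the root of a tree are the sums over its leaves. -/
theorem weight_build {d : ℕ} (f : BitStr d → ℂ × ℝ) :
    (RowTree.build d f).weight = (∑ k, ‖(f k).1‖, ∑ k, (f k).2) := by
  induction d with
  | zero =>
    simp only [RowTree.build, RowTree.weight, Fintype.sum_unique]
    exact congrArg (fun y => (‖(f y).1‖, (f y).2)) (Subsingleton.elim _ _)
  | succ d ih =>
    have h1 := ih (subLeaves f false)
    have h2 := ih (subLeaves f true)
    rw [sum_bitStr_succ, sum_bitStr_succ, Fintype.sum_bool, Fintype.sum_bool]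
    change ((RowTree.build d (subLeaves f false)).weight.1 +
      (RowTree.build d (subLeaves f true)).weight.1, (RowTree.build d (subLeaves f false)).weight.2 +
      (RowTree.build d (subLeaves f true)).weight.2) = _
    rw [h1, h2, add_comm, add_comm (∑ k, (subLeaves f false k).2)]
    rfl

theorem headWeight_heads {d : ℕ} (f : BitStr d → ℂ × ℝ) :
    headWeight d (heads (RowTree.build d f)) = ∑ k, ‖(f k).1‖ + ∑ k, (f k).2 := by
  have h := weight_build f
  cases d with
  | zero =>
    obtain ⟨h1, h2, h3⟩ := heads_zero f
    have h4 : (f Fin.elim0).2 = ∑ k, (f k).2 := congrArg Prod.snd h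
    have h5 : ‖(f Fin.elim0).1‖ = ∑ k, ‖(f k).1‖ := congrArg Prod.fst h
    rw [headWeight, h1, h2, h3, ← norm_eq_sqrt, h4, h5]
  | succ d =>
    rw [headWeight, (heads_succ f).1, (heads_succ f).2, h]

/-- The amplitudes that the exact angles give: the square roots of the weights, with the phases of
the leaves. -/
theorem sqrt_mul_amp {d : ℕ} (f : BitStr d → ℂ × ℝ) (hf : ∀ k, 0 ≤ (f k).2) (k : BitStr d)
    (s : Bool) :
    (√(∑ k, ‖(f k).1‖ + ∑ k, (f k).2) : ℂ) * amp d (treeVec id d (RowTree.build d f).entry) k s =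
      if s then (√(f k).2 : ℂ) else rootConj (star (f k).1) := by
  induction d with
  | zero =>
    obtain ⟨h1, h2, h3⟩ := heads_zero f
    have hk : k = Fin.elim0 := Subsingleton.elim _ _
    have h6 : ∀ β, reads 0 (RowTree.build 0 f).entry [] β = heads (RowTree.build 0 f) := fun β => rfl
    have h4 : (f k).2 = ∑ k, (f k).2 := by rw [hk]; exact congrArg Prod.snd (weight_build f)
    have h5 : ‖(f k).1‖ = ∑ k, ‖(f k).1‖ := by rw [hk]; exact congrArg Prod.fst (weight_build f)
    rw [← h4, ← h5]
    simp only [amp, treeVec, List.length_nil, Nat.sub_zero, rotAngle, phaseAngle, id, h6, h1, h2, h3,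
      ← norm_eq_sqrt]
    rw [← hk]
    have hq : (0 : ℝ) ≤ 0 ∧ (0 : ℝ) ≤ 1 := by norm_num
    cases s
    · simp only [nodeVec, Bool.false_eq_true, if_false]
      rw [← mul_assoc, ← Complex.ofReal_mul, sqrt_mul_cos_ang hq (norm_nonneg _) (hf k), rootConj,
        norm_star]
      congr 1
      have h7 : (⟨(f k).1.re, -(f k).1.im⟩ : ℂ) = star (f k).1 := by
        apply Complex.ext <;> simp
      rw [h7]
      have h8 : (((2 * Real.pi - (star (f k).1).arg / 2 : ℝ) : ℂ)) * Complex.I =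
          ((-((star (f k).1).arg / 2) : ℝ) : ℂ) * Complex.I + 2 * Real.pi * Complex.I := by
        push_cast; ring
      rw [h8, Complex.exp_add, Complex.exp_two_pi_mul_I, mul_one]
    · simp only [nodeVec, if_true]
      rw [← Complex.ofReal_mul, sqrt_mul_sin_ang hq (norm_nonneg _) (hf k)]
  | succ d ih =>
    have hrec := ih (subLeaves f (k 0)) (fun _ => hf _) (Fin.tail k)
    have hsub : subLeaves f (k 0) (Fin.tail k) = f k := by
      rw [subLeaves, Fin.cons_self_tail]
    rw [hsub] at hrec
    rw [← hrec]
    simp only [amp, treeVec_cons, entry_build_subCell]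
    rw [← mul_assoc]
    congr 1
    set w : Bool → ℝ := fun β =>
      ∑ y, ‖(subLeaves f β y).1‖ + ∑ y, (subLeaves f β y).2 with hw
    have hw0 : ∀ β, 0 ≤ w β := fun β =>
      add_nonneg (Finset.sum_nonneg fun _ _ => norm_nonneg _) (Finset.sum_nonneg fun _ _ => hf _)
    have htot : ∑ k, ‖(f k).1‖ + ∑ k, (f k).2 = w false + w true := by
      rw [sum_bitStr_succ, sum_bitStr_succ, Fintype.sum_bool, Fintype.sum_bool, hw]
      simp only [subLeaves]
      ring
    have hq : (0 : ℝ) ≤ 1 / 2 ∧ (1 / 2 : ℝ) ≤ 1 := by norm_num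
    rw [htot]
    simp only [treeVec, List.length_nil, Nat.sub_zero, rotAngle, phaseAngle, id, reads_nil_succ,
      headWeight_heads]
    change (√(w false + w true) : ℂ) * nodeVec (ang (1 / 2) (w false) (w true)) 0 (k 0) =
      (√(w (k 0)) : ℂ)
    cases k 0
    · rw [nodeVec, Complex.ofReal_zero, zero_mul, Complex.exp_zero, mul_one, ← Complex.ofReal_mul,
        sqrt_mul_cos_ang hq (hw0 _) (hw0 _)]
    · rw [nodeVec, ← Complex.ofReal_mul, sqrt_mul_sin_ang hq (hw0 _) (hw0 _)]

end Trees

section AmplitudeError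

theorem sum_nodeVec (θ φ : ℝ) : ∑ s, ‖nodeVec θ φ s‖ ^ 2 = 1 := by
  rw [Fintype.sum_bool, nodeVec, nodeVec, norm_mul, Complex.norm_exp_ofReal_mul_I, mul_one,
    Complex.norm_real, Complex.norm_real, Real.norm_eq_abs, Real.norm_eq_abs, sq_abs, sq_abs]
  exact Real.sin_sq_add_cos_sq θ

theorem sum_amp_sq {d : ℕ} {u : List Bool → Bool → ℂ} (hu : ∀ v, ∑ s, ‖u v s‖ ^ 2 = 1) :
    ∑ k, ∑ s, ‖amp d u k s‖ ^ 2 = 1 := by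
  induction d generalizing u with
  | zero => simpa [amp] using hu []
  | succ d ih =>
    rw [sum_bitStr_succ, ← hu []]
    refine Finset.sum_congr rfl fun β _ => ?_
    rw [← mul_one (‖u [] β‖ ^ 2), ← ih (u := fun v => u (β :: v)) fun v => hu _]
    simp only [Finset.mul_sum, amp, Fin.cons_zero, Fin.tail_cons, norm_mul, mul_pow]

/-- The errors at the levels of the tree add up. -/
theorem sum_amp_sub_sq_le {d : ℕ} {u u' : List Bool → Bool → ℂ} {κ : ℝ}
    (hu : ∀ v, ∑ s, ‖u v s‖ ^ 2 = 1) (hu' : ∀ v, ∑ s, ‖u' v s‖ ^ 2 = 1)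
    (h : ∀ v, v.length ≤ d → ∀ s, ‖u v s - u' v s‖ ≤ κ) :
    ∑ k, ∑ s, ‖amp d u k s - amp d u' k s‖ ^ 2 ≤ (d + 1) ^ 2 * (2 * κ ^ 2) := by
  have hnode : ∀ v, v.length ≤ d → ∑ s, ‖u v s - u' v s‖ ^ 2 ≤ 2 * κ ^ 2 := by
    intro v hv
    rw [Fintype.sum_bool]
    have h1 := pow_le_pow_left₀ (norm_nonneg _) (h v hv true) 2
    have h2 := pow_le_pow_left₀ (norm_nonneg _) (h v hv false) 2
    linarith
  induction d generalizing u u' with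
  | zero => simpa [amp] using hnode [] (by simp)
  | succ d ih =>
    set a : Bool → BitStr d → Bool → ℂ := fun β => amp d fun v => u (β :: v) with ha
    set a' : Bool → BitStr d → Bool → ℂ := fun β => amp d fun v => u' (β :: v) with ha'
    have e1 : ∀ β, ∑ k, ∑ s, ‖a β k s - a' β k s‖ ^ 2 ≤ (d + 1) ^ 2 * (2 * κ ^ 2) := fun β =>
      ih (fun v => hu _) (fun v => hu' _) (fun v hv => h _ (by simpa using hv))
        (fun v hv => hnode _ (by simpa using hv))
    have e2 : ∀ β, ∑ k, ∑ s, ‖a' β k s‖ ^ 2 = 1 := fun β => sum_amp_sq fun v => hu' _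
    have hd : (0 : ℝ) < d + 1 := by positivity
    -- the weights `1 + 1 / (d + 1)` and `1 + (d + 1)` make the squares of the errors add up
    have hpt : ∀ β k s, ‖amp (d + 1) u (Fin.cons β k) s - amp (d + 1) u' (Fin.cons β k) s‖ ^ 2 ≤
        (1 + 1 / ((d : ℝ) + 1)) * (‖u [] β‖ ^ 2 * ‖a β k s - a' β k s‖ ^ 2) +
          (1 + ((d : ℝ) + 1)) * (‖u [] β - u' [] β‖ ^ 2 * ‖a' β k s‖ ^ 2) := by
      intro β k s
      have h1 : amp (d + 1) u (Fin.cons β k) s - amp (d + 1) u' (Fin.cons β k) s =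
          u [] β * (a β k s - a' β k s) + (u [] β - u' [] β) * a' β k s := by
        simp only [amp, Fin.cons_zero, Fin.tail_cons, ha, ha']
        ring
      rw [h1]
      have h2 := norm_add_le (u [] β * (a β k s - a' β k s)) ((u [] β - u' [] β) * a' β k s)
      rw [norm_mul, norm_mul] at h2
      set X := ‖u [] β‖ * ‖a β k s - a' β k s‖
      set Y := ‖u [] β - u' [] β‖ * ‖a' β k s‖
      have h3 := pow_le_pow_left₀ (norm_nonneg _) h2 2
      refine h3.trans ?_
      rw [← mul_pow, ← mul_pow]
      have h4 : 0 ≤ (X - ((d : ℝ) + 1) * Y) ^ 2 / ((d : ℝ) + 1) := by positivity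
      have h5 : (1 + 1 / ((d : ℝ) + 1)) * X ^ 2 + (1 + ((d : ℝ) + 1)) * Y ^ 2 - (X + Y) ^ 2 =
          (X - ((d : ℝ) + 1) * Y) ^ 2 / ((d : ℝ) + 1) := by field_simp; ring
      linarith
    calc ∑ k, ∑ s, ‖amp (d + 1) u k s - amp (d + 1) u' k s‖ ^ 2
        = ∑ β, ∑ k, ∑ s,
            ‖amp (d + 1) u (Fin.cons β k) s - amp (d + 1) u' (Fin.cons β k) s‖ ^ 2 :=
          sum_bitStr_succ _
      _ ≤ ∑ β, ∑ k, ∑ s,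
          ((1 + 1 / ((d : ℝ) + 1)) * (‖u [] β‖ ^ 2 * ‖a β k s - a' β k s‖ ^ 2) +
            (1 + ((d : ℝ) + 1)) * (‖u [] β - u' [] β‖ ^ 2 * ‖a' β k s‖ ^ 2)) :=
          Finset.sum_le_sum fun β _ => Finset.sum_le_sum fun k _ => Finset.sum_le_sum fun s _ =>
            hpt β k s
      _ = ∑ β, ((1 + 1 / ((d : ℝ) + 1)) * (‖u [] β‖ ^ 2 * ∑ k, ∑ s, ‖a β k s - a' β k s‖ ^ 2) +
            (1 + ((d : ℝ) + 1)) * (‖u [] β - u' [] β‖ ^ 2 * ∑ k, ∑ s, ‖a' β k s‖ ^ 2)) := by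
          simp only [Finset.mul_sum, Finset.sum_add_distrib]
      _ ≤ ∑ β, ((1 + 1 / ((d : ℝ) + 1)) * (‖u [] β‖ ^ 2 * ((d + 1) ^ 2 * (2 * κ ^ 2))) +
            (1 + ((d : ℝ) + 1)) * (‖u [] β - u' [] β‖ ^ 2 * 1)) := by
          refine Finset.sum_le_sum fun β _ => ?_
          rw [e2 β]
          have := e1 β
          gcongr
      _ = (1 + 1 / ((d : ℝ) + 1)) * ((d + 1) ^ 2 * (2 * κ ^ 2)) +
            (1 + ((d : ℝ) + 1)) * ∑ β, ‖u [] β - u' [] β‖ ^ 2 := by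
          rw [Finset.sum_add_distrib, ← Finset.mul_sum, ← Finset.sum_mul, hu, one_mul,
            ← Finset.mul_sum]
          simp only [mul_one]
      _ ≤ (1 + 1 / ((d : ℝ) + 1)) * ((d + 1) ^ 2 * (2 * κ ^ 2)) +
            (1 + ((d : ℝ) + 1)) * (2 * κ ^ 2) := by
          have := hnode [] (by simp)
          gcongr
      _ = ((d + 1 : ℕ) + 1) ^ 2 * (2 * κ ^ 2) := by
          push_cast; field_simp; ring

end AmplitudeError

/-! ### The error at a node -/

section NodeError

variable {n b : ℕ}

theorem InRange.zero_or_fits {x : ℝ} (h : InRange n b x) : x = 0 ∨ Fits n b x := by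
  rcases h with h | ⟨h1, h2⟩
  · exact Or.inl h
  · refine Or.inr (fits_iff.2 ⟨le_trans ?_ h1, h2.trans_le ?_⟩) <;>
    · refine zpow_le_zpow_right₀ (by norm_num) ?_
      have h4 : (2 : ℤ) ^ (n + b + 2) = 4 * 2 ^ (n + b) := by ring
      have : (0 : ℤ) < 2 ^ (n + b) := by positivity
      omega

/-- Numbers that underflow are negligible compared with the entries of the matrix. -/
theorem underflow_le (n b : ℕ) : (2 : ℝ) ^ (-2 ^ (n + b + 2) : ℤ) ≤
    (2 * ((2 : ℝ) ^ b)⁻¹) ^ 2 * (2 : ℝ) ^ (-(2 ^ (n + b)) : ℤ) := by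
  have h1 : (2 * ((2 : ℝ) ^ b)⁻¹) ^ 2 * (2 : ℝ) ^ (-(2 ^ (n + b)) : ℤ) =
      (2 : ℝ) ^ (2 - 2 * (b : ℤ) - 2 ^ (n + b)) := by
    have e : 2 * ((2 : ℝ) ^ b)⁻¹ = (2 : ℝ) ^ (1 - (b : ℤ)) := by
      rw [zpow_sub₀ two_ne_zero, zpow_one, zpow_natCast, div_eq_mul_inv]
    rw [e, ← zpow_natCast _ 2, ← zpow_mul, ← zpow_add₀ two_ne_zero]
    congr 1
    push_cast
    ring
  rw [h1]
  refine zpow_le_zpow_right₀ (by norm_num) ?_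
  have h4 : (2 : ℤ) ^ (n + b + 2) = 4 * 2 ^ (n + b) := by ring
  have h5 : (2 : ℤ) ^ b ≤ 2 ^ (n + b) := pow_le_pow_right₀ (by norm_num) (by omega)
  have h6 : (b : ℤ) + 1 ≤ 2 ^ b := by exact_mod_cast @Nat.lt_two_pow_self b
  omega

/-- The complex number that is read from the words holding its real and imaginary parts. -/
noncomputable def storedC (n b : ℕ) (z : ℂ) : ℂ := ⟨stored n b z.re, stored n b z.im⟩

theorem norm_sub_storedC_le (hb : 1 ≤ b) {z : ℂ} (hr : InRange n b z.re) (hi : InRange n b z.im) :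
    ‖z - storedC n b z‖ ≤ 2 * (2 * ((2 : ℝ) ^ b)⁻¹) * ‖z‖ := by
  have h1 := (stored_of_zero_or_fits hb hr.zero_or_fits).2.2
  have h2 := (stored_of_zero_or_fits hb hi.zero_or_fits).2.2
  have h3 : (0 : ℝ) ≤ 2 * ((2 : ℝ) ^ b)⁻¹ := by positivity
  have h4 := mul_le_mul_of_nonneg_left (Complex.abs_re_le_norm z) h3
  have h5 := mul_le_mul_of_nonneg_left (Complex.abs_im_le_norm z) h3
  have h6 := Complex.norm_le_abs_re_add_abs_im (z - storedC n b z)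
  simp only [storedC, Complex.sub_re, Complex.sub_im] at h6
  unfold storedC
  linarith

theorem storedC_zero : storedC n b 0 = 0 := by
  apply Complex.ext <;> simp [storedC, stored_zero]

theorem storedC_ne_zero (hb : 1 ≤ b) {z : ℂ} (hr : InRange n b z.re) (hi : InRange n b z.im)
    (hz : z ≠ 0) : storedC n b z ≠ 0 := by
  intro h
  apply hz
  apply Complex.ext
  · exact (stored_of_zero_or_fits hb hr.zero_or_fits).2.1.2 (congrArg Complex.re h)
  · exact (stored_of_zero_or_fits hb hi.zero_or_fits).2.1.2 (congrArg Complex.im h)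

theorem le_norm_of_inRange {z : ℂ} (hr : InRange n b z.re) (hi : InRange n b z.im) (hz : z ≠ 0) :
    (2 : ℝ) ^ (-(2 ^ (n + b)) : ℤ) ≤ ‖z‖ := by
  rcases hr with hr | hr
  · rcases hi with hi | hi
    · exact absurd (Complex.ext hr hi) hz
    · exact hi.1.trans (Complex.abs_im_le_norm z)
  · exact hr.1.trans (Complex.abs_re_le_norm z)

theorem norm_le_of_inRange {z : ℂ} (hr : InRange n b z.re) (hi : InRange n b z.im) :
    ‖z‖ ≤ 2 * (2 : ℝ) ^ (2 ^ (n + b) : ℤ) := by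
  have h : ∀ x, InRange n b x → |x| ≤ (2 : ℝ) ^ (2 ^ (n + b) : ℤ) := by
    rintro x (rfl | hx)
    · rw [abs_zero]; positivity
    · exact hx.2.le
  linarith [Complex.norm_le_abs_re_add_abs_im z, h _ hr, h _ hi]

/-- The data of a subtree of height `d`: entries in range, and equal real numbers at all leaves,
without overflow. -/
structure GoodLeaves (n b d : ℕ) (t : ℝ) (f : BitStr d → ℂ × ℝ) : Prop where
  height : d ≤ n
  re : ∀ k, InRange n b (f k).1.re
  im : ∀ k, InRange n b (f k).1.im
  snd : ∀ k, (f k).2 = t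
  nonneg : 0 ≤ t
  lt : 2 ^ d * t < (2 : ℝ) ^ (2 ^ (n + b + 2) : ℤ)

theorem GoodLeaves.sub {d : ℕ} {t : ℝ} {f : BitStr (d + 1) → ℂ × ℝ}
    (h : GoodLeaves n b (d + 1) t f) (γ : Bool) : GoodLeaves n b d t (subLeaves f γ) where
  height := by have := h.height; omega
  re _ := h.re _
  im _ := h.im _
  snd _ := h.snd _
  nonneg := h.nonneg
  lt := by
    refine lt_of_le_of_lt ?_ h.lt
    have := h.nonneg
    gcongr
    · norm_num
    · omega

theorem GoodLeaves.sum_snd {d : ℕ} {t : ℝ} {f : BitStr d → ℂ × ℝ} (h : GoodLeaves n b d t f) :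
    ∑ k, (f k).2 = 2 ^ d * t := by
  simp [h.snd]

theorem GoodLeaves.sum_norm {d : ℕ} {t : ℝ} {f : BitStr d → ℂ × ℝ} (h : GoodLeaves n b d t f) :
    ∑ k, ‖(f k).1‖ = 0 ∨ (2 : ℝ) ^ (-(2 ^ (n + b)) : ℤ) ≤ ∑ k, ‖(f k).1‖ := by
  by_cases h0 : ∀ k, (f k).1 = 0
  · left; simp [h0]
  · right
    push Not at h0
    obtain ⟨k, hk⟩ := h0
    exact (le_norm_of_inRange (h.re k) (h.im k) hk).trans
      (Finset.single_le_sum (f := fun k => ‖(f k).1‖) (fun _ _ => norm_nonneg _) (Finset.mem_univ k))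

theorem pow_lt_overflow {m : ℕ} (hm : m ≤ 2 * n + 1) (hb : 1 ≤ b) :
    (2 : ℝ) ^ m * (2 : ℝ) ^ (2 ^ (n + b) : ℤ) < (2 : ℝ) ^ (2 ^ (n + b + 2) : ℤ) := by
  rw [← zpow_natCast, ← zpow_add₀ two_ne_zero]
  refine zpow_lt_zpow_right₀ (by norm_num) ?_
  have h4 : (2 : ℤ) ^ (n + b + 2) = 4 * 2 ^ (n + b) := by ring
  have h5 : (2 : ℤ) ^ (n + 1) ≤ 2 ^ (n + b) := pow_le_pow_right₀ (by norm_num) (by omega)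
  have h6 : (n + 1 : ℤ) + 1 ≤ 2 ^ (n + 1) := by exact_mod_cast @Nat.lt_two_pow_self (n + 1)
  have : (m : ℤ) ≤ 2 * n + 1 := by exact_mod_cast hm
  omega

theorem GoodLeaves.sum_norm_lt {d : ℕ} {t : ℝ} {f : BitStr d → ℂ × ℝ} (h : GoodLeaves n b d t f)
    (hb : 1 ≤ b) : ∑ k, ‖(f k).1‖ < (2 : ℝ) ^ (2 ^ (n + b + 2) : ℤ) := by
  have h1 : ∑ k, ‖(f k).1‖ ≤ ∑ _k : BitStr d, 2 * (2 : ℝ) ^ (2 ^ (n + b) : ℤ) :=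
    Finset.sum_le_sum fun k _ => norm_le_of_inRange (h.re k) (h.im k)
  refine h1.trans_lt ?_
  have h2 := h.height
  have h3 : ∑ _k : BitStr d, 2 * (2 : ℝ) ^ (2 ^ (n + b) : ℤ) =
      2 ^ (d + 1) * (2 : ℝ) ^ (2 ^ (n + b) : ℤ) := by
    simp; ring
  rw [h3]
  exact pow_lt_overflow (by omega) hb

/-- The weight of a subtree that is computed from the words in memory. -/
theorem GoodLeaves.headWeight_stored {d : ℕ} {t : ℝ} {f : BitStr d → ℂ × ℝ}
    (h : GoodLeaves n b d t f) (hb : 1 ≤ b) :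
    0 ≤ headWeight d (fun j => stored n b (heads (RowTree.build d f) j)) ∧
    (∑ k, ‖(f k).1‖ = 0 →
      headWeight d (fun j => stored n b (heads (RowTree.build d f) j)) = stored n b (2 ^ d * t)) ∧
    |(∑ k, ‖(f k).1‖ + 2 ^ d * t) -
        headWeight d (fun j => stored n b (heads (RowTree.build d f) j))| ≤
      2 * (2 * ((2 : ℝ) ^ b)⁻¹) * (∑ k, ‖(f k).1‖ + 2 ^ d * t) +
        (2 : ℝ) ^ (-2 ^ (n + b + 2) : ℤ) := by
  have ht0 : 0 ≤ 2 ^ d * t := by have := h.nonneg; positivity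
  have ht := abs_sub_stored_le hb (n := n) (x := 2 ^ d * t) (by
    rw [abs_of_nonneg ht0]; exact h.lt)
  rw [abs_of_nonneg ht0] at ht
  have hδ : (0 : ℝ) ≤ 2 * ((2 : ℝ) ^ b)⁻¹ := by positivity
  have hP0 : 0 ≤ ∑ k, ‖(f k).1‖ := Finset.sum_nonneg fun _ _ => norm_nonneg _
  have hw := weight_build f
  rw [h.sum_snd] at hw
  -- both for a leaf and an inner node, the weight is read as a sum of two numbers
  obtain ⟨x, hx, hx0, hxz, hxe⟩ : ∃ x : ℝ,
      headWeight d (fun j => stored n b (heads (RowTree.build d f) j)) = x + stored n b (2 ^ d * t) ∧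
      0 ≤ x ∧ (∑ k, ‖(f k).1‖ = 0 → x = 0) ∧
      |∑ k, ‖(f k).1‖ - x| ≤ 2 * (2 * ((2 : ℝ) ^ b)⁻¹) * ∑ k, ‖(f k).1‖ := by
    cases d with
    | zero =>
      obtain ⟨h1, h2, h3⟩ := heads_zero f
      have h4 : (f Fin.elim0).2 = 2 ^ 0 * t := congrArg Prod.snd hw
      have h5 : ‖(f Fin.elim0).1‖ = ∑ k, ‖(f k).1‖ := congrArg Prod.fst hw
      refine ⟨‖storedC n b (f Fin.elim0).1‖, ?_, norm_nonneg _, fun h0 => ?_, ?_⟩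
      · rw [headWeight, h1, h2, h3, h4, norm_eq_sqrt]
        rfl
      · rw [← h5, norm_eq_zero] at h0
        rw [h0, storedC_zero, norm_zero]
      · rw [← h5]
        exact (abs_norm_sub_norm_le _ _).trans (norm_sub_storedC_le hb (h.re _) (h.im _))
    | succ d =>
      refine ⟨stored n b (∑ k, ‖(f k).1‖), ?_, stored_nonneg hb hP0, fun h0 => ?_, ?_⟩
      · rw [headWeight, (heads_succ f).1, (heads_succ f).2, hw]
      · rw [h0, stored_zero]
      · have hz : ∑ k, ‖(f k).1‖ = 0 ∨ Fits n b (∑ k, ‖(f k).1‖) := by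
          refine h.sum_norm.imp_right fun hle => fits_iff.2 ?_
          rw [abs_of_nonneg hP0]
          refine ⟨le_trans ?_ hle, h.sum_norm_lt hb⟩
          refine zpow_le_zpow_right₀ (by norm_num) ?_
          have h4 : (2 : ℤ) ^ (n + b + 2) = 4 * 2 ^ (n + b) := by ring
          have : (0 : ℤ) < 2 ^ (n + b) := by positivity
          omega
        have := (stored_of_zero_or_fits hb hz).2.2
        rw [abs_of_nonneg hP0] at this
        nlinarith [mul_nonneg hδ hP0]
  rw [hx]
  refine ⟨add_nonneg hx0 (stored_nonneg hb ht0), fun h0 => by rw [hxz h0, zero_add], ?_⟩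
  have h1 : (∑ k, ‖(f k).1‖ + 2 ^ d * t) - (x + stored n b (2 ^ d * t)) =
      (∑ k, ‖(f k).1‖ - x) + (2 ^ d * t - stored n b (2 ^ d * t)) := by ring
  rw [h1]
  refine (abs_add_le _ _).trans ?_
  have := mul_nonneg hδ ht0
  linarith

theorem norm_nodeVec_sub_le {θ θ' φ φ' A B : ℝ} (hc : |Real.cos θ - Real.cos θ'| ≤ A)
    (hs : |Real.sin θ - Real.sin θ'| ≤ A)
    (he : ‖Complex.exp (φ * Complex.I) - Complex.exp (φ' * Complex.I)‖ ≤ B) (s : Bool) :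
    ‖nodeVec θ φ s - nodeVec θ' φ' s‖ ≤ A + B := by
  have hB : 0 ≤ B := (norm_nonneg _).trans he
  cases s
  · have h1 : nodeVec θ φ false - nodeVec θ' φ' false =
        ((Real.cos θ - Real.cos θ' : ℝ) : ℂ) * Complex.exp (φ * Complex.I) +
          (Real.cos θ' : ℂ) * (Complex.exp (φ * Complex.I) - Complex.exp (φ' * Complex.I)) := by
      rw [nodeVec, nodeVec, Complex.ofReal_sub]
      ring
    rw [h1]
    refine (norm_add_le _ _).trans ?_
    rw [norm_mul, norm_mul, Complex.norm_exp_ofReal_mul_I, mul_one, Complex.norm_real,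
      Complex.norm_real, Real.norm_eq_abs, Real.norm_eq_abs]
    have := mul_le_mul (Real.abs_cos_le_one θ') he (norm_nonneg _) zero_le_one
    linarith
  · rw [nodeVec, nodeVec, ← Complex.ofReal_sub, Complex.norm_real, Real.norm_eq_abs]
    linarith

/-- The angles at a node that are computed from the words in memory, and rounded, give amplitudes
with an error of order `2 ^ (-b)`. -/
theorem GoodLeaves.norm_treeVec_sub_le {d : ℕ} {t : ℝ} {f : BitStr d → ℂ × ℝ}
    (h : GoodLeaves n b d t f) (hb : 1 ≤ b) (v : List Bool) (hv : v.length ≤ d) (s : Bool) :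
    ‖treeVec id d (RowTree.build d f).entry v s -
      treeVec (quant b) d (fun c => stored n b ((RowTree.build d f).entry c)) v s‖ ≤
        24 * ((2 : ℝ) ^ b)⁻¹ := by
  have hδ : (0 : ℝ) ≤ 2 * ((2 : ℝ) ^ b)⁻¹ := by positivity
  have hε : (0 : ℝ) ≤ (2 : ℝ) ^ (-2 ^ (n + b + 2) : ℤ) := by positivity
  have hμ : (0 : ℝ) < (2 : ℝ) ^ (-(2 ^ (n + b)) : ℤ) := by positivity
  have hsm := underflow_le n b
  -- it suffices to compare the angles before rounding
  have key : ∀ θ θ' φ φ' : ℝ, 0 ≤ θ' → 0 ≤ φ' →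
      (|Real.cos θ - Real.cos θ'| ≤ 7 * (2 * ((2 : ℝ) ^ b)⁻¹) ∧
        |Real.sin θ - Real.sin θ'| ≤ 7 * (2 * ((2 : ℝ) ^ b)⁻¹)) →
      ‖Complex.exp (φ * Complex.I) - Complex.exp (φ' * Complex.I)‖ ≤
        4 * (2 * ((2 : ℝ) ^ b)⁻¹) →
      ‖nodeVec (id θ) (id φ) s - nodeVec (quant b θ') (quant b φ') s‖ ≤ 24 * ((2 : ℝ) ^ b)⁻¹ := by
    intro θ θ' φ φ' hθ' hφ' hcs he
    have q1 := abs_sub_quant_le b hθ'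
    have q2 := abs_sub_quant_le b hφ'
    have c1 := Real.abs_cos_sub_cos_le θ' (quant b θ')
    have c2 := Real.abs_sin_sub_sin_le θ' (quant b θ')
    have c3 := norm_exp_sub_exp_le φ' (quant b φ')
    have r1 := abs_sub_le (Real.cos θ) (Real.cos θ') (Real.cos (quant b θ'))
    have r2 := abs_sub_le (Real.sin θ) (Real.sin θ') (Real.sin (quant b θ'))
    have r3 := norm_sub_le_norm_sub_add_norm_sub (Complex.exp (φ * Complex.I))
      (Complex.exp (φ' * Complex.I)) (Complex.exp (quant b φ' * Complex.I))
    refine (norm_nodeVec_sub_le (A := 15 * ((2 : ℝ) ^ b)⁻¹) (B := 9 * ((2 : ℝ) ^ b)⁻¹) ?_ ?_ ?_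
      s).trans (by linarith)
    · simp only [id]; linarith [hcs.1]
    · simp only [id]; linarith [hcs.2]
    · simp only [id]; linarith
  induction d generalizing v with
  | zero =>
    obtain rfl : v = [] := List.length_eq_zero_iff.1 (by omega)
    obtain ⟨h1, h2, h3⟩ := heads_zero f
    have h6 : ∀ β, reads 0 (RowTree.build 0 f).entry [] β = heads (RowTree.build 0 f) := fun β => rfl
    have h6' : ∀ β, reads 0 (fun c => stored n b ((RowTree.build 0 f).entry c)) [] β =
      fun j => stored n b (heads (RowTree.build 0 f) j) := fun β => rfl
    simp only [treeVec, List.length_nil, Nat.sub_zero, rotAngle, phaseAngle, h6, h6', h1, h2, h3,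
      ← norm_eq_sqrt]
    set a := (f Fin.elim0).1 with ha
    have hsn : (f Fin.elim0).2 = t := h.snd _
    rw [hsn]
    have hst : √(stored n b a.re ^ 2 + stored n b a.im ^ 2) = ‖storedC n b a‖ := by
      rw [norm_eq_sqrt]; rfl
    rw [hst]
    have hre : InRange n b a.re := h.re _
    have him : InRange n b a.im := h.im _
    refine key _ _ _ _ (Real.arccos_nonneg _) ?_ ?_ ?_
    · have := Complex.arg_le_pi ⟨stored n b a.re, -stored n b a.im⟩
      have := Real.pi_pos
      linarith
    · by_cases h0 : a = 0
      · have hr : ∀ W, ratio 0 0 W = 0 := by intro W; unfold ratio; split_ifs <;> simp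
        rw [h0, storedC_zero, norm_zero, ang, ang, hr, hr]
        simp
      · have hq : (0 : ℝ) ≤ 0 ∧ (0 : ℝ) ≤ 1 := by norm_num
        have hle := le_norm_of_inRange hre him h0
        have ht := abs_sub_stored_le hb (n := n) (x := t) (by
          rw [abs_of_nonneg h.nonneg]; simpa using h.lt)
        rw [abs_of_nonneg h.nonneg] at ht
        refine abs_cos_ang_sub_le hq (norm_nonneg _) h.nonneg (norm_nonneg _)
          (stored_nonneg hb h.nonneg) hδ hε (by linarith [h.nonneg]) ?_ ?_ ?_
        · refine hsm.trans (mul_le_mul_of_nonneg_left ?_ (sq_nonneg _))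
          linarith [h.nonneg]
        · refine ((abs_norm_sub_norm_le _ _).trans (norm_sub_storedC_le hb hre him)).trans ?_
          linarith
        · have := mul_nonneg hδ h.nonneg
          linarith
    · have hshift : ∀ x : ℝ, Complex.exp ((2 * Real.pi - x : ℝ) * Complex.I) =
          Complex.exp ((-x : ℝ) * Complex.I) := by
        intro x
        have : ((2 * Real.pi - x : ℝ) : ℂ) * Complex.I =
            ((-x : ℝ) : ℂ) * Complex.I + 2 * Real.pi * Complex.I := by push_cast; ring
        rw [this, Complex.exp_add, Complex.exp_two_pi_mul_I, mul_one]
      rw [hshift, hshift]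
      have e1 : (⟨a.re, -a.im⟩ : ℂ) = star a := by apply Complex.ext <;> simp
      have e2 : (⟨stored n b a.re, -stored n b a.im⟩ : ℂ) = star (storedC n b a) := by
        apply Complex.ext <;> simp [storedC]
      rw [e1, e2]
      by_cases h0 : a = 0
      · rw [h0, storedC_zero]
        simp
      · obtain ⟨s1, s2, -⟩ := stored_of_zero_or_fits hb him.zero_or_fits
        have hn := norm_sub_storedC_le hb hre him
        have hpos : 0 < ‖a‖ := norm_pos_iff.2 h0
        refine (norm_half_phase_sub_le (by simpa using h0)
          (by simpa using storedC_ne_zero hb hre him h0) ?_).trans ?_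
        · simp only [Complex.star_def, Complex.conj_im, storedC, neg_lt_zero]
          constructor
          · intro hlt
            refine lt_of_le_of_ne (stored_nonneg hb hlt.le) fun h' => hlt.ne' (s2.2 h'.symm)
          · intro hlt
            refine lt_of_le_of_ne (not_lt.1 fun h' => ?_) fun h' => hlt.ne' (s2.1 h'.symm)
            exact absurd (s1.1 h') (not_lt.2 hlt.le)
        · rw [← star_sub, norm_star, norm_star, div_le_iff₀ hpos]
          linarith
  | succ d ih =>
    cases v with
    | cons γ v =>
      rw [treeVec_cons, treeVec_cons, entry_build_subCell]
      have hsub : (fun c => stored n b ((RowTree.build (d + 1) f).entry (subCell γ c))) =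
          fun c => stored n b ((RowTree.build d (subLeaves f γ)).entry c) :=
        funext fun c => congrArg (stored n b) (congrFun (entry_build_subCell f γ) c)
      rw [hsub]
      exact ih (h.sub γ) v (by simpa using hv)
    | nil =>
      have h6' : ∀ β, reads (d + 1) (fun c => stored n b ((RowTree.build (d + 1) f).entry c)) [] β =
          fun j => stored n b (heads (RowTree.build d (subLeaves f β)) j) := fun β =>
        funext fun j => congrArg (stored n b) (congrFun (reads_nil_succ f β) j)
      simp only [treeVec, List.length_nil, Nat.sub_zero, rotAngle, phaseAngle, reads_nil_succ, h6',
        headWeight_heads, (h.sub _).sum_snd]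
      obtain ⟨w0, z0, e0⟩ := (h.sub false).headWeight_stored hb
      obtain ⟨w1, z1, e1⟩ := (h.sub true).headWeight_stored hb
      have hq : (0 : ℝ) ≤ 1 / 2 ∧ (1 / 2 : ℝ) ≤ 1 := by norm_num
      have ht0 : 0 ≤ 2 ^ d * t := by have := h.nonneg; positivity
      have hP : ∀ β, 0 ≤ ∑ k, ‖(subLeaves f β k).1‖ := fun β =>
        Finset.sum_nonneg fun _ _ => norm_nonneg _
      refine key _ _ _ _ (Real.arccos_nonneg _) le_rfl ?_ (by simp)
      by_cases h0 : ∑ k, ‖(subLeaves f false k).1‖ = 0 ∧ ∑ k, ‖(subLeaves f true k).1‖ = 0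
      · -- two subtrees without entries have the same weight, before and after storing it
        have hr : ∀ W, ratio (1 / 2) W W = 1 / 2 := by
          intro W
          unfold ratio
          split_ifs with h
          · rfl
          · rw [← two_mul] at h ⊢
            rw [div_eq_div_iff h two_ne_zero]
            ring
        rw [z0 h0.1, z1 h0.2, h0.1, h0.2, ang, ang, hr, hr]
        simp
      · have hle : (2 : ℝ) ^ (-(2 ^ (n + b)) : ℤ) ≤
            ∑ k, ‖(subLeaves f false k).1‖ + ∑ k, ‖(subLeaves f true k).1‖ := by
          rcases (h.sub false).sum_norm with h1 | h1
          · rcases (h.sub true).sum_norm with h2 | h2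
            · exact absurd ⟨h1, h2⟩ h0
            · linarith [hP false]
          · linarith [hP true]
        refine abs_cos_ang_sub_le hq (add_nonneg (hP _) ht0) (add_nonneg (hP _) ht0) w0 w1 hδ hε
          (by linarith) ?_ e0 e1
        refine hsm.trans (mul_le_mul_of_nonneg_left ?_ (sq_nonneg _))
        linarith

end NodeError

/-! ### Counting qubits -/

section Size

theorem card_cell_le (n : ℕ) : Fintype.card (Cell n) + 2 ≤ 5 * 2 ^ n := by
  induction n with
  | zero => exact le_of_eq (congrArg (· + 2) (Fintype.card_fin 3))
  | succ d ih =>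
    have h : Fintype.card (Cell (d + 1)) = 2 + (Fintype.card (Cell d) + Fintype.card (Cell d)) := by
      change Fintype.card (Fin 2 ⊕ (Cell d ⊕ Cell d)) = _
      rw [Fintype.card_sum, Fintype.card_sum, Fintype.card_fin]
    rw [h, pow_succ]
    omega

theorem card_memBit_le (n b : ℕ) :
    Fintype.card (MemBit n b) ≤ 5 * (2 ^ n) ^ 2 * (n + 2 * b + 4) := by
  have h : Fintype.card (MemBit n b) = 2 ^ n * (Fintype.card (Cell n) * (n + 2 * b + 4)) := by
    rw [Fintype.card_prod, Fintype.card_prod]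
    simp
    omega
  rw [h]
  have := card_cell_le n
  calc 2 ^ n * (Fintype.card (Cell n) * (n + 2 * b + 4))
      ≤ 2 ^ n * ((5 * 2 ^ n) * (n + 2 * b + 4)) := by gcongr; omega
    _ = _ := by ring

theorem card_BW_le (n b : ℕ) : Fintype.card (BW n b (b + 3)) ≤ 2 ^ (4 * n + 2 * b + 12) := by
  have h1 : Fintype.card (BW n b (b + 3)) = n + (n + (1 + (Fintype.card (MemBit n b) +
      (Fintype.card (BL n) * (b + 3) + (Fintype.card (BL n) * (b + 3) +
        Fintype.card (BL (n + 1))))))) := by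
    rw [Fintype.card_congr (bwEquiv n b (b + 3))]
    simp only [Fintype.card_sum, Fintype.card_fin, Fintype.card_prod (BL n), Fintype.card_unit]
  have h2 := card_memBit_le n b
  have h3 := card_BL_le n
  have h4 := card_BL_le (n + 1)
  have hn := @Nat.lt_two_pow_self n
  have hb := @Nat.lt_two_pow_self b
  have e1 : Fintype.card (BL n) * (b + 3) ≤ 2 ^ (2 * n + 1) * (b + 3) := by gcongr
  rw [h1]
  have e2 : (2 : ℕ) ^ (2 * n + 1) = 2 * (2 ^ n) ^ 2 := by ring
  have e3 : (2 : ℕ) ^ (2 * (n + 1) + 1) = 8 * (2 ^ n) ^ 2 := by ring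
  have e4 : (2 : ℕ) ^ (4 * n + 2 * b + 12) = 4096 * ((2 ^ n) ^ 4 * (2 ^ b) ^ 2) := by ring
  rw [e2] at e1
  rw [e3] at h4
  rw [e4]
  generalize 2 ^ n = N at *
  generalize 2 ^ b = B at *
  have f1 : 1 ≤ N := by omega
  have f2 : 1 ≤ B := by omega
  have g1 : N ^ 2 * (n + 2 * b + 4) ≤ N ^ 2 * (7 * (N ^ 2 * B ^ 2)) := by
    gcongr
    have k1 : n ≤ N ^ 2 * B ^ 2 := by
      calc n ≤ N * 1 := by omega
        _ ≤ N ^ 2 * B ^ 2 := Nat.mul_le_mul (Nat.le_self_pow two_ne_zero N) (Nat.one_le_pow _ _ f2)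
    have k2 : b ≤ N ^ 2 * B ^ 2 := by
      calc b ≤ 1 * B := by omega
        _ ≤ N ^ 2 * B ^ 2 := Nat.mul_le_mul (Nat.one_le_pow _ _ f1) (Nat.le_self_pow two_ne_zero B)
    have k3 : 1 ≤ N ^ 2 * B ^ 2 := Nat.mul_pos (by positivity) (by positivity)
    omega
  have g2 : N ^ 2 * (b + 3) ≤ N ^ 2 * (n + 2 * b + 4) := Nat.mul_le_mul_left _ (by omega)
  have g3 : N ^ 2 * 1 ≤ N ^ 2 * (n + 2 * b + 4) := by gcongr; omega
  have g4 : n ≤ N ^ 2 * 1 := by nlinarith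
  have g5 : N ^ 2 * (7 * (N ^ 2 * B ^ 2)) = 7 * (N ^ 4 * B ^ 2) := by ring
  have g6 : 5 * N ^ 2 * (n + 2 * b + 4) = 5 * (N ^ 2 * (n + 2 * b + 4)) := by ring
  have g7 : 2 * N ^ 2 * (b + 3) = 2 * (N ^ 2 * (b + 3)) := by ring
  have g8 : 1 ≤ N ^ 2 := Nat.one_le_pow _ _ f1
  omega

end Size

/-! ### Norms and the target state -/

section Matrices

variable {n b : ℕ}

theorem rowSum_nonneg (H : Mat n) (j : BitStr n) : 0 ≤ rowSum H j :=
  Finset.sum_nonneg fun _ _ => norm_nonneg _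

theorem rowSum_le_Lam (H : Mat n) (j : BitStr n) : rowSum H j ≤ Lam H :=
  (le_ciSup (Set.finite_range _).bddAbove j).trans (le_max_left _ _)

theorem Lam_pos {H : Mat n} (hH : H ≠ 0) : 0 < Lam H := by
  obtain ⟨j, k, hjk⟩ : ∃ j k, H j k ≠ 0 := by
    by_contra! h
    exact hH (Matrix.ext h)
  refine lt_of_lt_of_le ?_ (rowSum_le_Lam H j)
  exact Finset.sum_pos' (fun _ _ => norm_nonneg _) ⟨k, Finset.mem_univ _, norm_pos_iff.2 hjk⟩

theorem specNorm_le (H : Mat n) : specNorm H ≤ ∑ j, rowSum H j := by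
  refine ContinuousLinearMap.opNorm_le_bound _ (Finset.sum_nonneg fun j _ => rowSum_nonneg H j) ?_
  intro x
  have h1 : Matrix.toEuclideanCLM (𝕜 := ℂ) H x = ∑ j, EuclideanSpace.single j (∑ k, H j k * x k) := by
    ext i
    rw [Matrix.ofLp_toEuclideanCLM]
    simp [Matrix.mulVec, dotProduct, Finset.sum_apply, Pi.single_apply]
  rw [h1, Finset.sum_mul]
  refine (norm_sum_le _ _).trans (Finset.sum_le_sum fun j _ => ?_)
  rw [PiLp.norm_single, rowSum, Finset.sum_mul]
  refine (norm_sum_le _ _).trans (Finset.sum_le_sum fun k _ => ?_)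
  rw [norm_mul]
  exact mul_le_mul_of_nonneg_left (PiLp.norm_apply_le x k) (norm_nonneg _)

theorem Lam_lt {H : Mat n} (hb : 1 ≤ b) (hs : Storable b H) :
    Lam H < (2 : ℝ) ^ (2 ^ (n + b + 2) : ℤ) := by
  have h1 : ∀ j, rowSum H j ≤ 2 ^ n * (2 * (2 : ℝ) ^ (2 ^ (n + b) : ℤ)) := by
    intro j
    refine (Finset.sum_le_sum fun k _ => norm_le_of_inRange (hs j k).1 (hs j k).2).trans ?_
    simp
  have h2 : ∑ j, rowSum H j ≤ 2 ^ n * (2 ^ n * (2 * (2 : ℝ) ^ (2 ^ (n + b) : ℤ))) := by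
    refine (Finset.sum_le_sum fun j _ => h1 j).trans ?_
    simp
  have h3 : oneNorm H ≤ ∑ j, rowSum H j :=
    ciSup_le fun j => Finset.single_le_sum (f := rowSum H) (fun j _ => rowSum_nonneg H j)
      (Finset.mem_univ j)
  have h4 : Lam H ≤ ∑ j, rowSum H j := max_le h3 (specNorm_le H)
  refine (h4.trans h2).trans_lt ?_
  have := pow_lt_overflow (n := n) (m := 2 * n + 1) le_rfl hb
  refine lt_of_eq_of_lt ?_ this
  ring

/-- The leaves of the tree of a row. -/
noncomputable def rowLeaves (H : Mat n) (j k : BitStr n) : ℂ × ℝ :=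
  (star (H j k), (Lam H - rowSum H j) / 2 ^ n)

theorem goodLeaves_rowLeaves {H : Mat n} (hb : 1 ≤ b) (hs : Storable b H) (j : BitStr n) :
    GoodLeaves n b n ((Lam H - rowSum H j) / 2 ^ n) (rowLeaves H j) where
  height := le_rfl
  re k := (hs j k).1
  im k := by
    have := (hs j k).2
    simpa [rowLeaves, InRange] using this
  snd _ := rfl
  nonneg := div_nonneg (sub_nonneg.2 (rowSum_le_Lam H j)) (by positivity)
  lt := by
    rw [mul_div_cancel₀ _ (by positivity)]
    exact (sub_le_self _ (rowSum_nonneg H j)).trans_lt (Lam_lt hb hs)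

/-- The amplitudes of the target state are the products of the amplitudes on the paths of the tree
with the exact angles. -/
theorem targetState_eq {H : Mat n} (a : ℕ) (hH : H ≠ 0) (j : BitStr n) :
    targetState b a H j =
      ∑ k, ∑ s, amp n (treeVec id n (rowTree H j).entry) k s • regKet b a H j k s := by
  have hL := Lam_pos hH
  have hnn : ∀ k, 0 ≤ (rowLeaves H j k).2 := fun k =>
    div_nonneg (sub_nonneg.2 (rowSum_le_Lam H j)) (by positivity)
  have hsum : ∑ k, ‖(rowLeaves H j k).1‖ + ∑ k, (rowLeaves H j k).2 = Lam H := by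
    have h1 : ∑ k, ‖(rowLeaves H j k).1‖ = rowSum H j :=
      Finset.sum_congr rfl fun k _ => norm_star _
    have h2 : ∑ k, (rowLeaves H j k).2 = Lam H - rowSum H j := by
      simp only [rowLeaves, Finset.sum_const, Finset.card_univ, Fintype.card_fun,
        Fintype.card_fin, Fintype.card_bool, nsmul_eq_mul]
      push_cast
      field_simp
    rw [h1, h2]; ring
  have hamp := sqrt_mul_amp (rowLeaves H j) hnn
  rw [hsum] at hamp
  have hL0 : (√(Lam H) : ℂ) ≠ 0 := by
    exact_mod_cast (Real.sqrt_pos.2 hL).ne'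
  rw [targetState, Finset.smul_sum]
  refine Finset.sum_congr rfl fun k _ => ?_
  have h0 := hamp k false
  have h1 := hamp k true
  rw [if_neg (by simp)] at h0
  rw [if_pos rfl] at h1
  have e0 : amp n (treeVec id n (rowTree H j).entry) k false =
      1 / (√(Lam H) : ℂ) * rootConj (H j k) := by
    rw [← star_star (H j k)]
    rw [eq_comm, div_mul_eq_mul_div, one_mul, div_eq_iff hL0, mul_comm]
    exact h0.symm
  have e1 : amp n (treeVec id n (rowTree H j).entry) k true =
      1 / (√(Lam H) : ℂ) * (√((Lam H - rowSum H j) / 2 ^ n) : ℂ) := by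
    rw [eq_comm, div_mul_eq_mul_div, one_mul, div_eq_iff hL0, mul_comm]
    exact h1.symm
  rw [Fintype.sum_bool, e0, e1, smul_add, smul_smul, smul_smul]
  exact add_comm _ _

end Matrices

/-! ### Square roots -/

section Roots

theorem root_sq (z : ℂ) : root z ^ 2 = z := by
  have h : (√‖z‖ : ℂ) ^ 2 = ‖z‖ := by
    exact_mod_cast Real.sq_sqrt (norm_nonneg z)
  rw [root, mul_pow, h, ← Complex.exp_nat_mul]
  conv_rhs => rw [← Complex.norm_mul_exp_arg_mul_I z]
  congr 2
  push_cast; ring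

theorem rootConj_eq_star_root (z : ℂ) : rootConj z = star (root z) := by
  rw [root, rootConj, Complex.star_def, map_mul, Complex.conj_ofReal, ← Complex.exp_conj, map_mul,
    Complex.conj_ofReal, Complex.conj_I]
  congr 2
  push_cast; ring

theorem root_mul_star_rootConj (z : ℂ) : root z * star (rootConj z) = z := by
  rw [rootConj_eq_star_root, star_star, ← sq, root_sq]

theorem rootConj_sq (z : ℂ) : rootConj z ^ 2 = star z := by
  rw [rootConj_eq_star_root, ← star_pow, root_sq]

end Roots

/-! ### The circuit and its error -/

section Assembly

variable {n b : ℕ}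

/-- The qubits of the state preparation circuit, with the work qubits `S`, as those of the quantum
computer with access to the memory. -/
noncomputable def wireEquiv (n b m : ℕ) (S : Type) [Fintype S] :
    BW n b m ⊕ S ≃ Wire n b (Fintype.card (Extra n m ⊕ S)) :=
  (Equiv.sumCongr (bwEquiv n b m) (Equiv.refl S)).trans <|
  (Equiv.sumAssoc _ _ _).trans <| Equiv.sumCongr (Equiv.refl _) <|
  (Equiv.sumAssoc _ _ _).trans <| Equiv.sumCongr (Equiv.refl _) <|
  (Equiv.sumAssoc _ _ _).trans <| Equiv.sumCongr (Equiv.refl _) <|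
  (Equiv.sumAssoc _ _ _).trans <| Equiv.sumCongr (Equiv.refl _) (Fintype.equivFin _)

theorem relabelState_bst {m : ℕ} {S : Type} [Fintype S] [DecidableEq S] (H : Mat n)
    (j k : BitStr n) (s : Bool) :
    relabelState (wireEquiv n b m S) (ketz (bst j k s (memory b H) (fun _ _ => false)
      (fun _ _ => false) fun _ => false)) = regKet b _ H j k s := by
  rw [ketz, relabelState_ket, regKet]
  congr 1
  rw [eq_comm, Equiv.eq_comp_symm]
  funext q
  rcases q with (_ | _ | _ | _ | _ | _ | _) | _ <;> rfl

theorem ang_lt (q W₀ W₁ : ℝ) : ang q W₀ W₁ < 8 := by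
  have := Real.arccos_le_pi √(ratio q W₀ W₁)
  have := Real.pi_lt_d2
  unfold ang
  linarith

theorem rotAngle_lt (h : ℕ) (r : Bool → Fin 3 → ℝ) : rotAngle h r < 8 := by
  cases h <;> exact ang_lt _ _ _

theorem phaseAngle_lt (h : ℕ) (r : Bool → Fin 3 → ℝ) : phaseAngle h r < 8 := by
  cases h
  · have := Complex.neg_pi_lt_arg ⟨r false 0, -r false 1⟩
    have := Real.pi_lt_d2
    simp only [phaseAngle]
    linarith
  · norm_num [phaseAngle]

theorem norm_sq_sum_regKet (a : ℕ) (H : Mat n) (c : BitStr n → BitStr n → Bool → ℂ) :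
    ‖∑ j, ∑ k, ∑ s, c j k s • regKet b a H j k s‖ ^ 2 = ∑ j, ∑ k, ∑ s, ‖c j k s‖ ^ 2 := by
  have hinj : Function.Injective fun p : BitStr n × BitStr n × Bool =>
      (Sum.elim p.1 (Sum.elim p.2.1 (Sum.elim (fun _ => p.2.2)
        (Sum.elim (memory b H) fun _ => false))) : Wire n b a → Bool) := by
    rintro ⟨j, k, s⟩ ⟨j', k', s'⟩ h
    have h1 : j = j' := funext fun i => congrFun h (.inl i)
    have h2 : k = k' := funext fun i => congrFun h (.inr (.inl i))
    have h3 : s = s' := congrFun h (.inr (.inr (.inl ())))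
    rw [h1, h2, h3]
  have ho := (EuclideanSpace.orthonormal_single (𝕜 := ℂ) (ι := Wire n b a → Bool)).comp _ hinj
  have h := ho.inner_sum (fun p => c p.1 p.2.1 p.2.2) (fun p => c p.1 p.2.1 p.2.2) Finset.univ
  rw [inner_self_eq_norm_sq_to_K] at h
  simp only [Fintype.sum_prod_type, RCLike.conj_mul] at h
  exact_mod_cast h

/-- One circuit for all matrices that prepares the state with the amplitudes computed from the words
in memory. -/
theorem exists_prepare_stored (n b : ℕ) :
    ∃ (a : ℕ) (c : Circuit (Wire n b a)),
      c.depth ≤ 4 * (32 * (4 * n + 2 * b + 12) + 48 * (1 + 2 * (6 * (n + 2 * b + 4)) + 2 * n) + 40) +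
        (n + 1) * (6 * (b + 3) + 8) ∧
      ∀ (H : Mat n) (j : BitStr n), c.run (inputState b a H j) = ∑ k, ∑ s,
        amp n (treeVec (quant b) n fun c => stored n b ((rowTree H j).entry c)) k s •
          regKet b a H j k s := by
  classical
  obtain ⟨c, hd, hc⟩ := exists_prepare (n := n) (b := b) (m := b + 3) (4 * n + 2 * b + 12)
    (card_BW_le n b) (fun i => 2 ^ (i : ℕ) / 2 ^ b) (cellsAt n)
    (fun v i w => angleBit b (rotAngle (n - v.length)
      fun β j => dec n b fun x => w ((β, j), x)) i)
    (fun v i w => angleBit b (phaseAngle (n - v.length)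
      fun β j => dec n b fun x => w ((β, j), x)) i)
  refine ⟨_, c.relabel (wireEquiv n b (b + 3) _), (Circuit.depth_relabel _ c).trans_le hd,
    fun H j => ?_⟩
  rw [inputState, ← relabelState_bst, Circuit.run_relabel, hc]
  change relabelLin (wireEquiv n b (b + 3) _) _ = _
  simp only [map_sum, map_smul]
  refine Finset.sum_congr rfl fun k _ => Finset.sum_congr rfl fun s _ => ?_
  congr 1
  · congr 1
    funext v
    rw [angleOf_angleBit b (rotAngle_lt _ _), angleOf_angleBit b (phaseAngle_lt _ _)]
    rfl
  · exact relabelState_bst H j k s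

/-- The error in the amplitudes bounds the error in the states, for superpositions of rows as well,
since the images of different rows are orthogonal. -/
theorem norm_sum_sub_le {H : Mat n} (hb : 1 ≤ b) (hs : Storable b H) (hH : H ≠ 0) (a : ℕ)
    (α : EuclideanSpace ℂ (BitStr n)) :
    ‖∑ j, α j • (∑ k, ∑ s,
        amp n (treeVec (quant b) n fun c => stored n b ((rowTree H j).entry c)) k s •
          regKet b a H j k s) - ∑ j, α j • targetState b a H j‖ ≤
      (n + 1) * (48 * ((2 : ℝ) ^ b)⁻¹) * ‖α‖ := by
  set u : BitStr n → List Bool → Bool → ℂ := fun j => treeVec id n (rowTree H j).entry with hu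
  set u' : BitStr n → List Bool → Bool → ℂ := fun j =>
    treeVec (quant b) n fun c => stored n b ((rowTree H j).entry c) with hu'
  have hdiff : ∑ j, α j • (∑ k, ∑ s, amp n (u' j) k s • regKet b a H j k s) -
      ∑ j, α j • targetState b a H j =
        ∑ j, ∑ k, ∑ s, (α j * (amp n (u' j) k s - amp n (u j) k s)) • regKet b a H j k s := by
    rw [← Finset.sum_sub_distrib]
    refine Finset.sum_congr rfl fun j _ => ?_
    rw [targetState_eq a hH j, ← smul_sub]
    simp only [← Finset.sum_sub_distrib, ← sub_smul, Finset.smul_sum, smul_smul, hu]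
  rw [hdiff]
  refine le_of_sq_le_sq ?_ (by positivity)
  rw [norm_sq_sum_regKet]
  calc ∑ j, ∑ k, ∑ s, ‖α j * (amp n (u' j) k s - amp n (u j) k s)‖ ^ 2
      = ∑ j, ‖α j‖ ^ 2 * ∑ k, ∑ s, ‖amp n (u j) k s - amp n (u' j) k s‖ ^ 2 := by
        simp only [norm_mul, mul_pow, Finset.mul_sum]
        simp only [norm_sub_rev]
    _ ≤ ∑ j, ‖α j‖ ^ 2 * ((n + 1) ^ 2 * (2 * (24 * ((2 : ℝ) ^ b)⁻¹) ^ 2)) := by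
        refine Finset.sum_le_sum fun j _ => mul_le_mul_of_nonneg_left ?_ (sq_nonneg _)
        exact sum_amp_sub_sq_le (fun v => sum_nodeVec _ _) (fun v => sum_nodeVec _ _)
          fun v hv s => (goodLeaves_rowLeaves hb hs j).norm_treeVec_sub_le hb v hv s
    _ = ‖α‖ ^ 2 * ((n + 1) ^ 2 * (2 * (24 * ((2 : ℝ) ^ b)⁻¹) ^ 2)) := by
        rw [← Finset.sum_mul, EuclideanSpace.norm_sq_eq]
    _ ≤ ((n + 1) * (48 * ((2 : ℝ) ^ b)⁻¹) * ‖α‖) ^ 2 := by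
        have : 0 ≤ ‖α‖ ^ 2 * ((n + 1) ^ 2 * (((2 : ℝ) ^ b)⁻¹) ^ 2) := by positivity
        linarith

end Assembly

end StatePrep

open StatePrep
theorem lemma1 :
    -- state preparation by one circuit for all `H`, with access to the memory
    (∃ C : ℝ, ∀ n b : ℕ, 1 ≤ n → 1 ≤ b →
      ∃ (a : ℕ) (c : Circuit (Wire n b a)),
        (c.depth : ℝ) ≤ C * n * (b : ℝ) ^ (5 / 2 : ℝ) ∧
        ∀ H : Mat n, H.IsHermitian → H ≠ 0 → Storable b H →
          ∀ α : EuclideanSpace ℂ (BitStr n),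
            ‖c.run (∑ j, α j • inputState b a H j) - ∑ j, α j • targetState b a H j‖
              ≤ C * n * (2 : ℝ) ^ (-(b : ℝ)) * ‖α‖) ∧
    -- the square roots
    (∀ z : ℂ, root z ^ 2 = z ∧ rootConj z ^ 2 = star z ∧ root z * star (rootConj z) = z) ∧
    -- the number of bits of the memory
    (∀ c₀ : ℝ, ∃ C : ℝ, ∀ n b : ℕ, 1 ≤ n → 1 ≤ b → (b : ℝ) ≤ c₀ * n →
      (Fintype.card (MemBit n b) : ℝ) ≤ C * ((2 : ℝ) ^ n) ^ 2 * (n : ℝ) ^ 2) := by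
  refine ⟨⟨20000, fun n b hn hb => ?_⟩,
    fun z => ⟨root_sq z, rootConj_sq z, root_mul_star_rootConj z⟩,
    fun c₀ => ⟨5 * (5 + 2 * c₀), fun n b hn hb hbn => ?_⟩⟩
  · have hnR : (1 : ℝ) ≤ n := by exact_mod_cast hn
    have hbR : (1 : ℝ) ≤ b := by exact_mod_cast hb
    obtain ⟨a, c, hd, hc⟩ := exists_prepare_stored n b
    refine ⟨a, c, ?_, fun H _ hH hs α => ?_⟩
    · have h1 : c.depth ≤ 20000 * (n * b) := by
        have k1 : n ≤ n * b := Nat.le_mul_of_pos_right n hb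
        have k2 : b ≤ n * b := Nat.le_mul_of_pos_left b hn
        have k3 : 1 ≤ n * b := Nat.mul_pos hn hb
        have k4 : (n + 1) * (6 * (b + 3) + 8) = 6 * (n * b) + 26 * n + 6 * b + 26 := by ring
        rw [k4] at hd
        omega
      have h2 : (b : ℝ) ≤ (b : ℝ) ^ (5 / 2 : ℝ) := by
        simpa using Real.rpow_le_rpow_of_exponent_le hbR (by norm_num : (1 : ℝ) ≤ 5 / 2)
      calc (c.depth : ℝ) ≤ 20000 * n * b := by
            have : (c.depth : ℝ) ≤ 20000 * (n * b) := by exact_mod_cast h1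
            linarith
        _ ≤ _ := by gcongr
    · have h1 : c.run (∑ j, α j • inputState b a H j) = ∑ j, α j • ∑ k, ∑ s,
          amp n (treeVec (quant b) n fun c => stored n b ((rowTree H j).entry c)) k s •
            regKet b a H j k s := by
        rw [Circuit.run_sum]
        exact Finset.sum_congr rfl fun j _ => by rw [Circuit.run_smul, hc]
      rw [h1, Real.rpow_neg (by norm_num), Real.rpow_natCast]
      refine (norm_sum_sub_le hb hs hH a α).trans ?_
      refine mul_le_mul_of_nonneg_right ?_ (norm_nonneg α)
      rw [← mul_assoc]
      exact mul_le_mul_of_nonneg_right (by linarith) (by positivity)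
  · have hnR : (1 : ℝ) ≤ n := by exact_mod_cast hn
    have h1 : (Fintype.card (MemBit n b) : ℝ) ≤ 5 * (2 ^ n) ^ 2 * (n + 2 * b + 4) := by
      exact_mod_cast card_memBit_le n b
    have hc₀ : 0 ≤ c₀ := by
      by_contra! h
      have : c₀ * n < 0 := mul_neg_of_neg_of_pos h (by linarith)
      have : (0 : ℝ) ≤ b := Nat.cast_nonneg b
      linarith
    have h2 : (n : ℝ) + 2 * b + 4 ≤ (5 + 2 * c₀) * n ^ 2 := by
      have h3 : (n : ℝ) ≤ n ^ 2 := le_self_pow₀ hnR two_ne_zero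
      have h4 := mul_le_mul_of_nonneg_left h3 hc₀
      linarith
    calc (Fintype.card (MemBit n b) : ℝ) ≤ 5 * (2 ^ n) ^ 2 * (n + 2 * b + 4) := h1
      _ ≤ 5 * (2 ^ n) ^ 2 * ((5 + 2 * c₀) * n ^ 2) := by gcongr
      _ = _ := by ring
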